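/- **Setting.** Let $D\subset\mathbb R^2$ be a bounded open set with $C^{1,1}$ boundary $\Sigma=\partial D$, let $d_\circ>0$, $\alpha>0$ and $\rho>0$ be constants, and let $f,g\in L^2(\Sigma)$ be real-valued (in particular $f\in H^{3/2}(\Sigma)$, $g\in H^{1/2}(\Sigma)$ is allowed). Let $\mathcal A$ be the set of connected nonempty open sets $\omega$ of class $C^{1,1}$ with $\overline\omega\subset D$, $\operatorname{dist}(\omega,\partial D)>d_\circ$ and $D\setminus\overline\omega$ connected. A domain $\Omega$ is admissible if $\Omega=D\setminus\overline\omega$ with $\omega\in\mathcal A$. For a domain $\Omega$ with outer boundary $\Sigma$ and inner boundary $\Gamma=\partial\Omega\setminus\Sigma$, the state $u=u_1+iu_2\in H^1(\Omega;\mathbb C)$ is the weak solution of $$-\Delta u=0\ \text{in }\Omega,\qquad \partial_n u+i\rho u=g+i\rho f\ \text{on }\Sigma,\qquad \partial_n u+\alpha u=0\ \text{on }\Gamma,$$ that is, for all $v\in H^1(\Omega;\mathbb C)$, $$\int_\Omega\nabla u\cdot\nabla\overline v\,dx+i\rho\int_\Sigma u\overline v\,ds+\alpha\int_\Gamma u\overline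 v\,ds=\int_\Sigma g\overline v\,ds+i\rho\int_\Sigma f\overline v\,ds .$$ Put $J(\Omega)=\frac12\int_\Omega|u_2|^2\,dx$. Let $D_{d_\circ}$ be an open set with $C^\infty$ boundary such that $\{x\in D: d(x,\partial D)>d_\circ/2\}\subset D_{d_\circ}\subset\{x\in D: d(x,\partial D)>d_\circ/3\}$, and let $\Theta^1$ be the set of vector fields $\theta\in C^{1,1}(\mathbb R^2;\mathbb R^2)$ with compact support in $\overline{D_{d_\circ}}$. For $\theta\in\Theta^1$ let $T_t=\mathrm{Id}+t\theta$, $\Omega_t=T_t(\Omega)$ and $dJ(\Omega)[\theta]=\lim_{t\searrow0}\frac{J(\Omega_t)-J(\Omega)}{t}$. **Corollary 3.1 (necessary condition).** Let $\Omega^\star$ be an admissible domain and $u=u_1+iu_2$ its state. The following are equivalent: 1. $u_2=0$ (a.e.) in $\Omega^\star$; 2. $u$ is a weak solution of the overdetermined problem $-\Delta u=0$ in $\Omega^\star$, $u=f$ and $\partial_n u=g$ on $\Sigma$, $\partial_n u+\alpha u=0$ on $\Gamma$; 3. $u|_\Sigma=f$ and $\partial_n u|_\Sigma=g$ (the normal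 derivative in the weak sense). If they hold, then $\Omega^\star$ is a stationary point of $J$: for every $\theta\in\Theta^1$, the state on $\Omega^\star_t$ exists and is unique for all sufficiently small $t\ge0$, the limit $dJ(\Omega^\star)[\theta]$ exists, and $$dJ(\Omega^\star)[\theta]=0 .$$ -/

import Mathlib

open MeasureTheory Filter Topology ComplexConjugate

noncomputable section

namespace CCBM

/-- The Euclidean plane. -/
abbrev Plane := EuclideanSpace ℝ (Fin 2)

/-! ### Domains -/

/-- `U` lies locally on one side of its boundary, and the boundary is locally, in suitable
Cartesian coordinates (`R` is a rigid motion), the graph of a function in the class `P`. -/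
def HasGraphBoundary (P : (ℝ → ℝ) → Prop) (U : Set Plane) : Prop :=
  ∀ x₀ ∈ frontier U, ∃ (R : Plane ≃ᵃⁱ[ℝ] Plane) (ψ : ℝ → ℝ), P ψ ∧
    ∃ V ∈ 𝓝 x₀, ∀ x ∈ V, (x ∈ U ↔ R x 1 < ψ (R x 0))

/-- Real functions of one variable of class `C^{1,1}`. -/
def IsC11Fun (ψ : ℝ → ℝ) : Prop :=
  ContDiff ℝ 1 ψ ∧ ∃ K, LipschitzWith K (deriv ψ)

/-- Boundary of class `C^{1,1}`. -/
def HasC11Boundary (U : Set Plane) : Prop := HasGraphBoundary IsC11Fun U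

/-- Boundary of class `C^∞`. -/
def HasSmoothBoundary (U : Set Plane) : Prop :=
  HasGraphBoundary (fun ψ => ContDiff ℝ (⊤ : ℕ∞) ψ) U

/-- The class `𝒜` of admissible cavities `ω`, compactly contained in `D`. The admissible
domains are the sets `D \ closure ω` for such `ω`. -/
structure IsAdmissibleCavity (D : Set Plane) (d₀ : ℝ) (ω : Set Plane) : Prop where
  isOpen : IsOpen ω
  closure_subset : closure ω ⊆ D
  isConnected : IsConnected ω
  c11 : HasC11Boundary ω
  /-- `dist(ω, ∂D) > d₀` -/
  dist_gt : ∃ δ > d₀, ∀ x ∈ ω, ∀ y ∈ frontier D, δ ≤ dist x y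
  isConnected_compl : IsConnected (D \ closure ω)

/-- A set `D_{d₀}` with smooth boundary lying between
`{x ∈ D | d(x, ∂D) > d₀ / 2}` and `{x ∈ D | d(x, ∂D) > d₀ / 3}`. -/
structure IsHoldAll (D : Set Plane) (d₀ : ℝ) (Dd : Set Plane) : Prop where
  isOpen : IsOpen Dd
  smooth : HasSmoothBoundary Dd
  subset_of : {x | x ∈ D ∧ d₀ / 2 < Metric.infDist x (frontier D)} ⊆ Dd
  subset : Dd ⊆ {x | x ∈ D ∧ d₀ / 3 < Metric.infDist x (frontier D)}

/-- The set `Θ¹` of admissible deformation fields: `C^{1,1}` vector fields with compact support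
contained in the closure of `D_{d₀}`. -/
structure IsDeformation (Dd : Set Plane) (θ : Plane → Plane) : Prop where
  contDiff : ContDiff ℝ 1 θ
  lipschitz : ∃ K, LipschitzWith K (fderiv ℝ θ)
  hasCompactSupport : HasCompactSupport θ
  tsupport_subset : tsupport θ ⊆ closure Dd

/-- The perturbed domain `Ω_t = T_t(Ω)` with `T_t = Id + t θ`. -/
def perturb (θ : Plane → Plane) (t : ℝ) (Ω : Set Plane) : Set Plane :=
  (fun x => x + t • θ x) '' Ω

/-- The Eulerian semiderivative of the shape functional `F` at `Ω` in direction `θ` exists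
and equals `L`. -/
def HasEulerianSemiderivative (F : Set Plane → ℝ) (Ω : Set Plane) (θ : Plane → Plane)
    (L : ℝ) : Prop :=
  Tendsto (fun t : ℝ => (F (perturb θ t Ω) - F Ω) / t) (𝓝[>] 0) (𝓝 L)

/-! ### Sobolev functions and traces -/

/-- Arc length on a subset `S` of the plane (one-dimensional Hausdorff measure). -/
def arcLength (S : Set Plane) : Measure Plane := (Measure.hausdorffMeasure 1).restrict S

/-- The partial derivative in the `i`-th coordinate direction. -/
def partialDeriv {F : Type*} [NormedAddCommGroup F] [NormedSpace ℝ F]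
    (i : Fin 2) (φ : Plane → F) (x : Plane) : F :=
  fderiv ℝ φ x (EuclideanSpace.single i 1)

/-- `u` belongs to the complex Sobolev space `H¹(Ω)`, with weak partial derivatives
`G 0, G 1`. -/
structure IsH1 (Ω : Set Plane) (u : Plane → ℂ) (G : Fin 2 → Plane → ℂ) : Prop where
  memLp : MemLp u 2 (volume.restrict Ω)
  memLp_grad : ∀ i, MemLp (G i) 2 (volume.restrict Ω)
  weak : ∀ i, ∀ φ : Plane → ℝ, ContDiff ℝ (⊤ : ℕ∞) φ → HasCompactSupport φ → tsupport φ ⊆ Ω →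
    ∫ x in Ω, ((partialDeriv i φ x : ℝ) : ℂ) * u x = - ∫ x in Ω, (φ x : ℂ) * G i x

/-- `u ∈ H¹(Ω)` has weak gradient `G` and boundary trace `η ∈ L²(∂Ω)`. The trace operator is
the continuous extension to `H¹(Ω)` of the restriction `φ ↦ φ|_∂Ω` of functions that are `C¹` up
to the boundary: `η` is the limit in `L²(∂Ω)` of `φ n|_∂Ω` for `C¹` functions `φ n` that
converge to `u` in `H¹(Ω)`. -/
structure HasTrace (Ω : Set Plane) (u : Plane → ℂ) (G : Fin 2 → Plane → ℂ)
    (η : Plane → ℂ) : Prop where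
  isH1 : IsH1 Ω u G
  memLp_trace : MemLp η 2 (arcLength (frontier Ω))
  approx : ∃ φ : ℕ → Plane → ℂ, (∀ n, ContDiff ℝ 1 (φ n)) ∧
    Tendsto (fun n => eLpNorm (fun x => φ n x - u x) 2 (volume.restrict Ω)) atTop (𝓝 0) ∧
    (∀ i, Tendsto (fun n => eLpNorm (fun x => partialDeriv i (φ n) x - G i x) 2
      (volume.restrict Ω)) atTop (𝓝 0)) ∧
    Tendsto (fun n => eLpNorm (fun x => φ n x - η x) 2 (arcLength (frontier Ω))) atTop (𝓝 0)

/-! ### The boundary value problems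

The fixed outer boundary is `Σ = frontier D`, the inner boundary of `Ω = D \ closure ω` is
`Γ = frontier Ω \ frontier D`. -/

/-- `∫_Ω ∇u · ∇v̄` in terms of the gradients. -/
def dirichletForm (Ω : Set Plane) (G H : Fin 2 → Plane → ℂ) : ℂ :=
  ∑ i, ∫ x in Ω, G i x * conj (H i x)

/-- `∫_S η ζ̄ ds`. -/
def boundaryForm (S : Set Plane) (η ζ : Plane → ℂ) : ℂ :=
  ∫ x, η x * conj (ζ x) ∂(arcLength S)

/-- `u` is a weak solution in `H¹(Ω)` of the complex coupled boundary problem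
`-Δu = 0` in `Ω`, `∂ₙu + iρu = g + iρf` on `Σ`, `∂ₙu + αu = 0` on `Γ`. -/
def IsState (D : Set Plane) (α ρ : ℝ) (f g : Plane → ℝ) (Ω : Set Plane) (u : Plane → ℂ) :
    Prop :=
  ∃ G η, HasTrace Ω u G η ∧ ∀ v H ζ, HasTrace Ω v H ζ →
    dirichletForm Ω G H + Complex.I * ρ * boundaryForm (frontier D) η ζ
        + α * boundaryForm (frontier Ω \ frontier D) η ζ
      = boundaryForm (frontier D) (fun x => (g x : ℂ)) ζ
        + Complex.I * ρ * boundaryForm (frontier D) (fun x => (f x : ℂ)) ζ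

/-- Existence and (almost everywhere) uniqueness of the state on `Ω`. -/
def HasUniqueState (D : Set Plane) (α ρ : ℝ) (f g : Plane → ℝ) (Ω : Set Plane) : Prop :=
  (∃ u, IsState D α ρ f g Ω u) ∧
    ∀ u v, IsState D α ρ f g Ω u → IsState D α ρ f g Ω v → u =ᵐ[volume.restrict Ω] v

/-- `u` is a weak solution in `H¹(Ω)` of the overdetermined problem
`-Δu = 0` in `Ω`, `u = f` and `∂ₙu = g` on `Σ`, `∂ₙu + αu = 0` on `Γ`. -/
def SolvesOverdetermined (D : Set Plane) (α : ℝ) (f g : Plane → ℝ) (Ω : Set Plane)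
    (u : Plane → ℂ) : Prop :=
  ∃ G η, HasTrace Ω u G η ∧ (∀ᵐ x ∂(arcLength (frontier D)), η x = f x) ∧
    ∀ v H ζ, HasTrace Ω v H ζ →
      dirichletForm Ω G H + α * boundaryForm (frontier Ω \ frontier D) η ζ
        = boundaryForm (frontier D) (fun x => (g x : ℂ)) ζ

/-- The Cauchy data on `Σ` of the harmonic function `u` are `(f, g)`: the trace is `f`, and the
weak normal derivative, given by Green's formula with test functions that vanish on `Γ`,
is `g`. -/
def HasCauchyData (D : Set Plane) (f g : Plane → ℝ) (Ω : Set Plane) (u : Plane → ℂ) : Prop :=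
  ∃ G η, HasTrace Ω u G η ∧ (∀ᵐ x ∂(arcLength (frontier D)), η x = f x) ∧
    ∀ v H ζ, HasTrace Ω v H ζ →
      (∀ᵐ x ∂(arcLength (frontier Ω \ frontier D)), ζ x = 0) →
      dirichletForm Ω G H = boundaryForm (frontier D) (fun x => (g x : ℂ)) ζ

open Classical in
/-- The cost `J(Ω) = ½ ∫_Ω |u₂|²`, where `u₂` is the imaginary part of the state on `Ω`. -/
def cost (D : Set Plane) (α ρ : ℝ) (f g : Plane → ℝ) (Ω : Set Plane) : ℝ :=
  if h : ∃ u, IsState D α ρ f g Ω u then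
    (1 / 2) * ∫ x in Ω, (h.choose x).im ^ 2
  else 0

end CCBM

end

namespace CCBM

open Set ENNReal

/-! ### Preliminary inequalities -/

/-! The equivalences come from complex conjugation. The data `f`, `g`, `α`, `ρ` are real, so
conjugating the state equation changes only the sign of the `iρ` terms. If `u` is real, the equation
and its conjugate differ by `2iρ ∫_Σ (u - f) v̄ = 0` for all `v` vanishing on `Γ`. This forces `u =
f` on `Σ`, and what remains of the state equation is the overdetermined problem
(`solvesOverdetermined_of_im_eq_zero`). Conversely, if `u` solves the overdetermined problem then
`ū` is also a state, and uniqueness gives `u = ū` (`im_eq_zero_of_solvesOverdetermined`). The Cauchy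
condition is the overdetermined problem tested only with functions vanishing on `Γ`; the state
equation supplies the missing Robin condition.

Stationarity needs neither a shape derivative nor an adjoint state. The cost is nonnegative and
vanishes at `Ω`, so a bound `J(Ω_t) ≤ C t²` suffices (`hasEulerianSemiderivative_zero`). Since `u`
is real, so is its transport `u ∘ T_t⁻¹`, hence `|Im u_t| ≤ |u_t - u ∘ T_t⁻¹|`. The forms on `Ω` and
`Ω_t` differ by `O(t)` relative to the energies, and coercivity turns this into an `L²` bound of
order `t` for the difference (`integral_state_sub_le`). The field `θ` vanishes on `Σ`, so the data
do not move. Lengths and areas are compared through Hausdorff measures of Lipschitz images, without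
a Jacobian formula.

Well-posedness rests on coercivity: on the diagonal, the real part of the form carries the gradient
and the `Γ` term, the imaginary part the `Σ` term (`energy_le_norm_energyForm`). The `L²` norm is
recovered from a Friedrichs inequality proved by slicing into vertical lines
(`friedrichs_contDiff`), which needs no boundary regularity. Existence is Lax–Milgram on the closure
of the jets of `C¹` functions in a product of five `L²` spaces, which is exactly what `HasTrace`
describes. The `C^{1,1}` boundary enters through local graphs: they give finite boundary length and
show that the zero function has zero trace on `Σ`. -/

theorem ennreal_add_sq_le (a b : ℝ≥0∞) : (a + b) ^ 2 ≤ 2 * a ^ 2 + 2 * b ^ 2 := by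
  have := ENNReal.rpow_add_le_mul_rpow_add_rpow a b (p := 2) (by norm_num)
  norm_num at this
  rw [mul_add] at this
  exact_mod_cast this

theorem eLpNorm_two_sq {X E : Type*} [MeasurableSpace X] [NormedAddCommGroup E] (μ : Measure X)
    (h : X → E) : eLpNorm h 2 μ ^ 2 = ∫⁻ x, ‖h x‖ₑ ^ 2 ∂μ := by
  have := eLpNorm_nnreal_pow_eq_lintegral (μ := μ) (f := h) (p := 2) (by norm_num)
  norm_num at this
  exact_mod_cast this

theorem sq_lintegral_le {X : Type*} [MeasurableSpace X] (μ : Measure X) {h : X → ℝ≥0∞}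
    (hh : AEMeasurable h μ) : (∫⁻ x, h x ∂μ) ^ 2 ≤ μ univ * ∫⁻ x, h x ^ 2 ∂μ := by
  have := ENNReal.lintegral_mul_le_Lp_mul_Lq μ (p := 2) (q := 2)
    (by rw [Real.holderConjugate_iff]; norm_num) (f := fun _ => 1) (g := h) aemeasurable_const hh
  simp only [Pi.mul_apply, one_mul, one_rpow, lintegral_const] at this
  calc (∫⁻ x, h x ∂μ) ^ 2 ≤ (μ univ ^ (1 / 2 : ℝ) * (∫⁻ x, h x ^ (2 : ℝ) ∂μ) ^ (1 / 2 : ℝ)) ^ 2 := by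
        gcongr
    _ = _ := by
        rw [mul_pow, ← ENNReal.rpow_natCast, ← ENNReal.rpow_natCast, ← ENNReal.rpow_mul,
          ← ENNReal.rpow_mul]
        norm_num

/-- A one-dimensional Sobolev inequality: point values are controlled by one other point value
and the Dirichlet integral. -/
theorem enorm_sq_le_of_hasDerivAt {q q' : ℝ → ℂ} (hq : ∀ t, HasDerivAt q (q' t) t)
    (hc : Continuous q') {a b : ℝ} (hab : a ≤ b) :
    ‖q a‖ₑ ^ 2 ≤ 2 * ‖q b‖ₑ ^ 2 + 2 * ENNReal.ofReal (b - a) * ∫⁻ t in Ioo a b, ‖q' t‖ₑ ^ 2 ∧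
    ‖q b‖ₑ ^ 2 ≤ 2 * ‖q a‖ₑ ^ 2 + 2 * ENNReal.ofReal (b - a) * ∫⁻ t in Ioo a b, ‖q' t‖ₑ ^ 2 := by
  have h1 : ∫ y in a..b, q' y = q b - q a :=
    intervalIntegral.integral_eq_sub_of_hasDerivAt (fun x _ => hq x) (hc.intervalIntegrable _ _)
  have h2 : ‖q b - q a‖ₑ ≤ ∫⁻ t in Ioo a b, ‖q' t‖ₑ := by
    rw [← h1, intervalIntegral.integral_of_le hab, integral_Ioc_eq_integral_Ioo]
    exact enorm_integral_le_lintegral_enorm _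
  have h3 : ‖q b - q a‖ₑ ^ 2 ≤ ENNReal.ofReal (b - a) * ∫⁻ t in Ioo a b, ‖q' t‖ₑ ^ 2 := by
    refine (pow_le_pow_left' h2 2).trans ((sq_lintegral_le _ hc.enorm.aemeasurable).trans ?_)
    simp
  constructor
  · calc ‖q a‖ₑ ^ 2 = ‖q b + -(q b - q a)‖ₑ ^ 2 := by congr 2; ring
      _ ≤ (‖q b‖ₑ + ‖q b - q a‖ₑ) ^ 2 := by
        gcongr; exact (enorm_add_le _ _).trans (by rw [enorm_neg])
      _ ≤ _ := (ennreal_add_sq_le _ _).trans (by rw [mul_assoc 2 (ENNReal.ofReal _)]; gcongr)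
  · calc ‖q b‖ₑ ^ 2 = ‖q a + (q b - q a)‖ₑ ^ 2 := by congr 2; ring
      _ ≤ (‖q a‖ₑ + ‖q b - q a‖ₑ) ^ 2 := by gcongr; exact enorm_add_le _ _
      _ ≤ _ := (ennreal_add_sq_le _ _).trans (by rw [mul_assoc 2 (ENNReal.ofReal _)]; gcongr)

/-! ### Cartesian coordinates -/

theorem lintegral_plane {h : Plane → ℝ≥0∞} (hh : Measurable h) :
    ∫⁻ x, h x = ∫⁻ s, ∫⁻ y, h !₂[s, y] := by
  have h1 := (EuclideanSpace.volume_preserving_symm_measurableEquiv_toLp (Fin 2)).symm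
  have h2 := (volume_preserving_finTwoArrow ℝ).symm
  have h3 := h1.comp h2
  have h4 : ∀ p : ℝ × ℝ, ((MeasurableEquiv.toLp 2 (Fin 2 → ℝ)).symm.symm ∘
    (MeasurableEquiv.finTwoArrow (α := ℝ)).symm) p = !₂[p.1, p.2] := fun p => rfl
  rw [← h3.lintegral_comp hh]
  simp only [h4]
  have hm : Measurable fun p : ℝ × ℝ => h !₂[p.1, p.2] := by
    simp only [← h4]; exact hh.comp h3.measurable
  exact lintegral_prod _ hm.aemeasurable

theorem continuous_pair : Continuous fun p : ℝ × ℝ => (!₂[p.1, p.2] : Plane) := by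
  refine (PiLp.continuous_toLp 2 _).comp ?_
  refine continuous_pi fun i => ?_
  fin_cases i
  · exact continuous_fst
  · exact continuous_snd

theorem continuous_pair_right (s : ℝ) : Continuous fun y : ℝ => (!₂[s, y] : Plane) :=
  continuous_pair.comp (by fun_prop : Continuous fun y : ℝ => (s, y))

theorem hasDerivAt_pair (s y : ℝ) :
    HasDerivAt (fun y : ℝ => (!₂[s, y] : Plane)) (EuclideanSpace.single 1 1) y := by
  have h : (fun y : ℝ => (!₂[s, y] : Plane)) =
      fun y => !₂[s, 0] + y • EuclideanSpace.single (1 : Fin 2) (1 : ℝ) := by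
    funext y; ext i; fin_cases i <;> simp
  rw [h]
  simpa using ((hasDerivAt_id y).smul_const (EuclideanSpace.single (1 : Fin 2) (1 : ℝ))).const_add
    (!₂[s, 0] : Plane)

theorem hasDerivAt_comp_pair {φ : Plane → ℂ} (hφ : ContDiff ℝ 1 φ) (s y : ℝ) :
    HasDerivAt (fun y : ℝ => φ !₂[s, y]) (partialDeriv 1 φ !₂[s, y]) y :=
  ((hφ.differentiable one_ne_zero _).hasFDerivAt).comp_hasDerivAt y (hasDerivAt_pair s y)

theorem continuous_partialDeriv {φ : Plane → ℂ} (hφ : ContDiff ℝ 1 φ) (i : Fin 2) :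
    Continuous (partialDeriv i φ) :=
  (hφ.continuous_fderiv one_ne_zero).clm_apply continuous_const

/-! ### The Friedrichs inequality -/

/-- A coordinate is 1-Lipschitz, so it does not increase one-dimensional Hausdorff measure, which on
the line is Lebesgue measure. -/
theorem volume_image_coord_le (A : Set Plane) (i : Fin 2) :
    volume ((fun x : Plane => x i) '' A) ≤ (Measure.hausdorffMeasure 1 : Measure Plane) A := by
  have h : LipschitzWith 1 fun x : Plane => x i := by
    refine LipschitzWith.of_dist_le_mul fun x y => ?_
    rw [NNReal.coe_one, one_mul, dist_eq_norm, dist_eq_norm]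
    exact PiLp.norm_apply_le (x - y) i
  have := h.hausdorffMeasure_image_le (d := 1) zero_le_one A
  rw [hausdorffMeasure_real] at this
  simpa using this

/-- The integral of the fibrewise maximum of a function on a compact set `K` with respect to a
coordinate projection is controlled by its integral over `K` with respect to arc length. -/
theorem exists_fiber_bound {K : Set Plane} (hK : IsCompact K) {h : Plane → ℝ} (hc : Continuous h)
    (h0 : ∀ x, 0 ≤ h x) : ∃ M : ℝ → ℝ, Measurable M ∧ (∀ s, 0 ≤ M s) ∧ (∀ x ∈ K, h x ≤ M (x 0)) ∧
      ∫⁻ s, ENNReal.ofReal (M s) ≤ ∫⁻ x, ENNReal.ofReal (h x) ∂(arcLength K) := by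
  set S : ℝ → Set ℝ := fun s => h '' (K ∩ {x | x 0 = s}) with hS
  have hcx : ∀ i, Continuous fun x : Plane => x i := fun i => by fun_prop
  have hSc : ∀ s, IsCompact (S s) := fun s =>
    (hK.inter_right (isClosed_eq (hcx 0) continuous_const)).image hc
  -- For `t > 0` a superlevel set of the fibrewise maximum is the projection of a compact set. This
  -- gives measurability and, with the layer-cake formula, the comparison with arc length.
  -- Positivity of `t` excludes empty fibres, where `sSup ∅ = 0`.
  have hlevel : ∀ t > 0, {s | t ≤ sSup (S s)} = (fun x : Plane => x 0) '' (K ∩ {x | t ≤ h x}) := by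
    intro t ht
    ext s
    constructor
    · intro hs
      have hne : (S s).Nonempty := by
        by_contra hne
        rw [not_nonempty_iff_eq_empty] at hne
        simp only [mem_ofPred_eq, hne, Real.sSup_empty] at hs
        linarith
      obtain ⟨x, ⟨hxK, hxs⟩, hx⟩ := (hSc s).sSup_mem hne
      exact ⟨x, ⟨hxK, by simpa [hx] using hs⟩, hxs⟩
    · rintro ⟨x, ⟨hxK, hx⟩, rfl⟩
      exact le_trans hx (le_csSup (hSc _).bddAbove ⟨x, ⟨hxK, rfl⟩, rfl⟩)
  have hM0 : ∀ s, 0 ≤ sSup (S s) := fun s => Real.sSup_nonneg (by rintro _ ⟨x, _, rfl⟩; exact h0 x)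
  have hMm : Measurable fun s => sSup (S s) := by
    refine measurable_of_Ici fun t => ?_
    rcases le_or_gt t 0 with ht | ht
    · convert MeasurableSet.univ
      ext s
      simpa using ht.trans (hM0 s)
    · change MeasurableSet {s | t ≤ sSup (S s)}
      rw [hlevel t ht]
      exact ((hK.inter_right (isClosed_le continuous_const hc)).image (hcx 0)).measurableSet
  refine ⟨fun s => sSup (S s), hMm, hM0,
    fun x hx => le_csSup (hSc _).bddAbove ⟨x, ⟨hx, rfl⟩, rfl⟩, ?_⟩
  rw [lintegral_eq_lintegral_meas_le _ (Eventually.of_forall hM0) hMm.aemeasurable,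
    lintegral_eq_lintegral_meas_le _ (Eventually.of_forall h0) hc.aemeasurable]
  refine setLIntegral_mono_ae' measurableSet_Ioi (Eventually.of_forall fun t ht => ?_)
  rw [hlevel t ht, arcLength, Measure.restrict_apply' hK.measurableSet, inter_comm]
  exact volume_image_coord_le _ 0

/-- The height `τ` is where the upward vertical ray from the point first leaves `Ω`; it exists
because `Ω` is bounded. -/
theorem exists_frontier_above {Ω : Set Plane} (hΩ : IsOpen Ω) {R : ℝ}
    (hR : ∀ x ∈ Ω, ‖x‖ ≤ R) {s y : ℝ} (h : !₂[s, y] ∈ Ω) :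
    ∃ τ, y ≤ τ ∧ τ ≤ R ∧ !₂[s, τ] ∈ frontier Ω ∧ ∀ t ∈ Ioo y τ, !₂[s, t] ∈ Ω := by
  set A : Set ℝ := {t | y ≤ t ∧ !₂[s, t] ∉ Ω} with hA
  have hb : ∀ t, !₂[s, t] ∈ Ω → t ≤ R := fun t ht => by
    refine le_trans ?_ (hR _ ht)
    have := PiLp.norm_apply_le (!₂[s, t] : Plane) 1
    simp only [Real.norm_eq_abs] at this
    exact (le_abs_self t).trans (by simpa using this)
  have hclosed : IsClosed A := by
    rw [hA, ofPred_and]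
    exact isClosed_Ici.inter (hΩ.isClosed_compl.preimage (continuous_pair_right s))
  have hne : A.Nonempty := by
    refine ⟨max y (R + 1), le_max_left _ _, fun hm => ?_⟩
    have := hb _ hm
    have := le_max_right y (R + 1)
    linarith
  have hbd : BddBelow A := ⟨y, fun t ht => ht.1⟩
  have hmem := hclosed.csInf_mem hne hbd
  set τ := sInf A with hτ
  have hin : ∀ t ∈ Ico y τ, !₂[s, t] ∈ Ω := by
    intro t ht
    by_contra hc
    exact absurd (csInf_le hbd (show t ∈ A from ⟨ht.1, hc⟩)) (not_le.2 ht.2)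
  have hlt : y < τ := by
    rcases eq_or_lt_of_le hmem.1 with he | hl
    · exact absurd (he ▸ h) hmem.2
    · exact hl
  have hcl : !₂[s, τ] ∈ closure Ω := by
    have : τ ∈ closure (Ico y τ) := by
      rw [closure_Ico hlt.ne]; exact ⟨hlt.le, le_rfl⟩
    exact map_mem_closure (f := fun t : ℝ => (!₂[s, t] : Plane)) (continuous_pair_right s) this hin
  refine ⟨τ, hlt.le, ?_, ?_, fun t ht => hin t ⟨ht.1.le, ht.2⟩⟩
  · have : τ ∈ closure (Ico y τ) := by
      rw [closure_Ico hlt.ne]; exact ⟨hlt.le, le_rfl⟩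
    exact closure_minimal (fun t ht => hb t (hin t ht)) isClosed_Iic this
  · rw [hΩ.frontier_eq]; exact ⟨hcl, hmem.2⟩

/-- The Friedrichs inequality for `C¹` functions on a bounded open set. -/
theorem friedrichs_contDiff {Ω : Set Plane} (hΩ : IsOpen Ω) {R : ℝ}
    (hR : ∀ x ∈ Ω, ‖x‖ ≤ R) {φ : Plane → ℂ} (hφ : ContDiff ℝ 1 φ) :
    ∫⁻ x in Ω, ‖φ x‖ₑ ^ 2 ≤ ENNReal.ofReal (2 * R) * (2 * (∫⁻ x, ‖φ x‖ₑ ^ 2 ∂(arcLength (frontier Ω)))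
      + 2 * ENNReal.ofReal (2 * R) * ∫⁻ x in Ω, ‖partialDeriv 1 φ x‖ₑ ^ 2) := by
  have hbd : Bornology.IsBounded Ω := (Metric.isBounded_closedBall (x := (0 : Plane)) (r := R)).subset
    fun x hx => by simpa using hR x hx
  have hK : IsCompact (frontier Ω) :=
    Metric.isCompact_of_isClosed_isBounded isClosed_frontier
      (hbd.closure.subset frontier_subset_closure)
  obtain ⟨M, hMm, -, hMK, hMi⟩ := exists_fiber_bound hK (h := fun x => ‖φ x‖ ^ 2)
    (hφ.continuous.norm.pow 2) (fun x => by positivity)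
  have hsq : ∀ x, ENNReal.ofReal (‖φ x‖ ^ 2) = ‖φ x‖ₑ ^ 2 := fun x => by
    rw [ENNReal.ofReal_pow (norm_nonneg _), ofReal_norm]
  simp only [hsq] at hMi
  set F : Plane → ℝ≥0∞ := Ω.indicator fun x => ‖partialDeriv 1 φ x‖ₑ ^ 2 with hF
  have hFm : Measurable F :=
    ((continuous_partialDeriv hφ 1).enorm.measurable.pow_const 2).indicator hΩ.measurableSet
  have hco : ∀ s y, !₂[s, y] ∈ Ω → y ∈ Icc (-R) R := fun s y h => by
    have h1 := PiLp.norm_apply_le (!₂[s, y] : Plane) 1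
    have h2 : |y| ≤ R := le_trans (by simpa using h1) (hR _ h)
    exact abs_le.1 h2
  -- The one-dimensional inequality is applied on the vertical segment up to the first exit point.
  -- Its length is at most `2 * R`, its interior lies in `Ω`, and its endpoint lies on the frontier,
  -- where `M` bounds the function.
  have hpt : ∀ s y, (Ω.indicator (fun x => ‖φ x‖ₑ ^ 2) !₂[s, y]) ≤
      (Icc (-R) R).indicator (fun _ => 2 * ENNReal.ofReal (M s)
        + 2 * ENNReal.ofReal (2 * R) * ∫⁻ t, F !₂[s, t]) y := by
    intro s y
    by_cases h : !₂[s, y] ∈ Ω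
    · rw [indicator_of_mem h, indicator_of_mem (hco s y h)]
      obtain ⟨τ, h1, h2, h3, h4⟩ := exists_frontier_above hΩ hR h
      refine (enorm_sq_le_of_hasDerivAt (hasDerivAt_comp_pair hφ s)
        ((continuous_partialDeriv hφ 1).comp (continuous_pair_right s)) h1).1.trans ?_
      have h5 := (hco s y h).1
      refine add_le_add ?_ (mul_le_mul' (mul_le_mul_right (ENNReal.ofReal_le_ofReal ?_) _) ?_)
      · rw [← hsq]
        exact mul_le_mul_right (ENNReal.ofReal_le_ofReal (hMK _ h3)) _
      · linarith
      · rw [← lintegral_indicator measurableSet_Ioo]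
        refine lintegral_mono (indicator_le fun t ht => ?_)
        rw [hF, indicator_of_mem (h4 t ht)]
    · rw [indicator_of_notMem h]; exact zero_le
  rw [← lintegral_indicator hΩ.measurableSet, lintegral_plane
    ((hφ.continuous.enorm.measurable.pow_const 2).indicator hΩ.measurableSet)]
  have hin : Measurable fun s => ∫⁻ t, F !₂[s, t] :=
    Measurable.lintegral_prod_right' (f := fun p : ℝ × ℝ => F !₂[p.1, p.2])
      (hFm.comp continuous_pair.measurable)
  calc ∫⁻ s, ∫⁻ y, (Ω.indicator (fun x => ‖φ x‖ₑ ^ 2) !₂[s, y])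
      ≤ ∫⁻ s, ∫⁻ y, (Icc (-R) R).indicator (fun _ => 2 * ENNReal.ofReal (M s)
        + 2 * ENNReal.ofReal (2 * R) * ∫⁻ t, F !₂[s, t]) y :=
        lintegral_mono fun s => lintegral_mono fun y => hpt s y
    _ = ∫⁻ s, ENNReal.ofReal (2 * R) * (2 * ENNReal.ofReal (M s)
        + 2 * ENNReal.ofReal (2 * R) * ∫⁻ t, F !₂[s, t]) := by
        refine lintegral_congr fun s => ?_
        rw [lintegral_indicator measurableSet_Icc, setLIntegral_const, Real.volume_Icc, mul_comm]
        congr 2; ring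
    _ = ENNReal.ofReal (2 * R) * (2 * (∫⁻ s, ENNReal.ofReal (M s))
        + 2 * ENNReal.ofReal (2 * R) * ∫⁻ s, ∫⁻ t, F !₂[s, t]) := by
        rw [lintegral_const_mul _ (by fun_prop), lintegral_add_left (by fun_prop),
          lintegral_const_mul _ (by fun_prop), lintegral_const_mul _ hin]
    _ ≤ _ := by
        rw [← lintegral_plane hFm, hF, lintegral_indicator hΩ.measurableSet]
        gcongr

/-! ### Hausdorff measures under Lipschitz maps -/

/-- Both measures are translation invariant and locally finite, so they are proportional. The value
of the constant never matters: only ratios of areas are compared. -/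
theorem exists_volume_eq_smul_hausdorffMeasure :
    ∃ c : NNReal, (volume : Measure Plane) = c • (Measure.hausdorffMeasure 2 : Measure Plane) := by
  have h := isAddHaarMeasure_hausdorffMeasure (E := Plane)
  simp only [finrank_euclideanSpace, Fintype.card_fin, Nat.cast_ofNat] at h
  exact ⟨_, Measure.isAddLeftInvariant_eq_smul _ _⟩

theorem measurePreserving_isometryEquiv (e : Plane ≃ᵢ Plane) :
    MeasurePreserving e (volume : Measure Plane) volume := by
  obtain ⟨c, hc⟩ := exists_volume_eq_smul_hausdorffMeasure
  rw [hc]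
  exact (e.measurePreserving_hausdorffMeasure 2).smul_measure _

/-- The Lipschitz bound for Hausdorff measure applied to every piece `p (p⁻¹ A ∩ s)` of the image;
as an inequality of measures it transfers to integrals. -/
theorem restrict_hausdorffMeasure_image_le {X Y : Type*} [EMetricSpace X] [EMetricSpace Y]
    [MeasurableSpace X] [BorelSpace X] [MeasurableSpace Y] [BorelSpace Y] {K : NNReal} {p : X → Y}
    {s : Set X} (hp : LipschitzOnWith K p s) (hpm : Measurable p) {d : ℝ} (hd : 0 ≤ d) :
    (Measure.hausdorffMeasure d).restrict (p '' s) ≤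
      ((K : ℝ≥0∞) ^ d) • ((Measure.hausdorffMeasure d).restrict s).map p := by
  refine Measure.le_iff.2 fun A hA => ?_
  rw [Measure.restrict_apply hA, Measure.smul_apply, Measure.map_apply hpm hA,
    Measure.restrict_apply (hpm hA), smul_eq_mul]
  have : A ∩ p '' s = p '' (p ⁻¹' A ∩ s) := by
    ext y; constructor
    · rintro ⟨hy, x, hx, rfl⟩; exact ⟨x, ⟨hy, hx⟩, rfl⟩
    · rintro ⟨x, ⟨hy, hx⟩, rfl⟩; exact ⟨hy, x, hx, rfl⟩
  rw [this]
  exact (hp.mono inter_subset_right).hausdorffMeasure_image_le hd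

/-! ### The local trace inequality at a graph boundary -/

theorem dist_pair_le (s y s' y' : ℝ) :
    dist (!₂[s, y] : Plane) (!₂[s', y'] : Plane) ≤ dist s s' + dist y y' := by
  rw [EuclideanSpace.dist_eq, Fin.sum_univ_two]
  simp only [Matrix.cons_val_zero, Matrix.cons_val_one]
  have h1 : 0 ≤ dist s s' := dist_nonneg
  have h2 : 0 ≤ dist y y' := dist_nonneg
  exact Real.sqrt_le_iff.2 ⟨by positivity, by nlinarith⟩

theorem pair_coords (z : Plane) : !₂[z 0, z 1] = z := by
  ext i; fin_cases i <;> rfl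

theorem abs_coord_sub_le (x y : Plane) (i : Fin 2) : |x i - y i| ≤ dist x y := by
  rw [dist_eq_norm]
  simpa using PiLp.norm_apply_le (x - y) i

theorem lipschitzOnWith_graph {ψ : ℝ → ℝ} {K : NNReal} {I : Set ℝ} (h : LipschitzOnWith K ψ I) :
    LipschitzOnWith (1 + K) (fun s => (!₂[s, ψ s] : Plane)) I := by
  refine LipschitzOnWith.of_dist_le_mul fun s hs s' hs' => (dist_pair_le _ _ _ _).trans ?_
  have := h.dist_le_mul s hs s' hs'
  push_cast
  linarith

/-- The energy of `C¹` functions below a graph controls their `L²` norm on the graph. -/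
theorem lintegral_graph_le {A : Set Plane} (hA : IsOpen A) {ψ : ℝ → ℝ} {I : Set ℝ} {h : ℝ}
    (hI : MeasurableSet I) (hsub : ∀ s ∈ I, ∀ y ∈ Ioo (ψ s - h) (ψ s), !₂[s, y] ∈ A)
    {Φ : Plane → ℂ} (hΦ : ContDiff ℝ 1 Φ) :
    ENNReal.ofReal h * ∫⁻ s in I, ‖Φ !₂[s, ψ s]‖ₑ ^ 2 ≤
      2 * (∫⁻ x in A, ‖Φ x‖ₑ ^ 2) + 2 * ENNReal.ofReal h ^ 2 *
        ∫⁻ x in A, ‖partialDeriv 1 Φ x‖ₑ ^ 2 := by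
  have hd := continuous_partialDeriv hΦ 1
  set F : Plane → ℝ≥0∞ := A.indicator fun x => ‖Φ x‖ₑ ^ 2 with hF
  set G : Plane → ℝ≥0∞ := A.indicator fun x => ‖partialDeriv 1 Φ x‖ₑ ^ 2 with hG
  have hFm : Measurable F := (hΦ.continuous.enorm.measurable.pow_const 2).indicator hA.measurableSet
  have hGm : Measurable G := (hd.enorm.measurable.pow_const 2).indicator hA.measurableSet
  have hFi : Measurable fun s => ∫⁻ t, F !₂[s, t] :=
    Measurable.lintegral_prod_right' (f := fun p : ℝ × ℝ => F !₂[p.1, p.2])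
      (hFm.comp continuous_pair.measurable)
  have hGi : Measurable fun s => ∫⁻ t, G !₂[s, t] :=
    Measurable.lintegral_prod_right' (f := fun p : ℝ × ℝ => G !₂[p.1, p.2])
      (hGm.comp continuous_pair.measurable)
  have key : ∀ s ∈ I, ENNReal.ofReal h * ‖Φ !₂[s, ψ s]‖ₑ ^ 2 ≤
      2 * (∫⁻ t, F !₂[s, t]) + 2 * ENNReal.ofReal h ^ 2 * ∫⁻ t, G !₂[s, t] := by
    intro s hs
    have hJ : ∀ (f : Plane → ℝ≥0∞), ∫⁻ t in Ioo (ψ s - h) (ψ s), f !₂[s, t] ≤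
        ∫⁻ t, A.indicator f !₂[s, t] := fun f => by
      rw [← lintegral_indicator measurableSet_Ioo]
      refine lintegral_mono (indicator_le fun t ht => ?_)
      rw [indicator_of_mem (hsub s hs t ht)]
    have hvol : volume (Ioo (ψ s - h) (ψ s)) = ENNReal.ofReal h := by simp
    -- The value on the graph is constant in `y`, so it can be averaged over a strip of depth `h`,
    -- with the one-dimensional inequality applied from each height `y` up to the graph.
    calc ENNReal.ofReal h * ‖Φ !₂[s, ψ s]‖ₑ ^ 2
        = ∫⁻ y in Ioo (ψ s - h) (ψ s), ‖Φ !₂[s, ψ s]‖ₑ ^ 2 := by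
          rw [setLIntegral_const, hvol, mul_comm]
      _ ≤ ∫⁻ y in Ioo (ψ s - h) (ψ s), (2 * ‖Φ !₂[s, y]‖ₑ ^ 2 +
            2 * ENNReal.ofReal h * ∫⁻ t, G !₂[s, t]) := by
          refine setLIntegral_mono' measurableSet_Ioo fun y hy => ?_
          refine (enorm_sq_le_of_hasDerivAt (hasDerivAt_comp_pair hΦ s)
            (hd.comp (continuous_pair_right s)) hy.2.le).2.trans ?_
          refine add_le_add le_rfl (mul_le_mul' (mul_le_mul_right
            (ENNReal.ofReal_le_ofReal (by linarith [hy.1])) _) ?_)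
          exact (lintegral_mono_set (Ioo_subset_Ioo_left hy.1.le)).trans
            (hJ fun x => ‖partialDeriv 1 Φ x‖ₑ ^ 2)
      _ = 2 * (∫⁻ y in Ioo (ψ s - h) (ψ s), ‖Φ !₂[s, y]‖ₑ ^ 2) +
            2 * ENNReal.ofReal h ^ 2 * ∫⁻ t, G !₂[s, t] := by
          have hm : Measurable fun y : ℝ => ‖Φ !₂[s, y]‖ₑ ^ 2 :=
            ((hΦ.continuous.comp (continuous_pair_right s)).enorm.measurable.pow_const 2)
          rw [lintegral_add_left (by fun_prop), lintegral_const_mul _ hm, setLIntegral_const, hvol]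
          ring
      _ ≤ _ := add_le_add (mul_le_mul_right (hJ fun x => ‖Φ x‖ₑ ^ 2) _) le_rfl
  rw [← lintegral_const_mul' _ _ ENNReal.ofReal_ne_top, ← lintegral_indicator hA.measurableSet,
    ← lintegral_indicator hA.measurableSet, lintegral_plane hFm, lintegral_plane hGm,
    ← lintegral_const_mul _ hFi, ← lintegral_const_mul _ hGi, ← lintegral_add_left (by fun_prop)]
  exact (setLIntegral_mono' hI key).trans (setLIntegral_le_lintegral _ _)

theorem enorm_fderiv_le (φ : Plane → ℂ) (x : Plane) :
    ‖fderiv ℝ φ x‖ₑ ≤ ‖partialDeriv 0 φ x‖ₑ + ‖partialDeriv 1 φ x‖ₑ := by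
  rw [← ofReal_norm, ← ofReal_norm, ← ofReal_norm, ← ENNReal.ofReal_add (by positivity) (by positivity)]
  refine ENNReal.ofReal_le_ofReal (ContinuousLinearMap.opNorm_le_bound _ (by positivity) fun v => ?_)
  have hv : v = v 0 • EuclideanSpace.single 0 1 + v 1 • EuclideanSpace.single 1 1 := by
    ext i; fin_cases i <;> simp
  have h0 := PiLp.norm_apply_le v 0
  have h1 := PiLp.norm_apply_le v 1
  calc ‖fderiv ℝ φ x v‖ = ‖v 0 • partialDeriv 0 φ x + v 1 • partialDeriv 1 φ x‖ := by
        conv_lhs => rw [hv]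
        rw [map_add, map_smul, map_smul]; rfl
    _ ≤ ‖v 0‖ * ‖partialDeriv 0 φ x‖ + ‖v 1‖ * ‖partialDeriv 1 φ x‖ := by
        refine (norm_add_le _ _).trans ?_
        rw [norm_smul, norm_smul]
    _ ≤ ‖v‖ * ‖partialDeriv 0 φ x‖ + ‖v‖ * ‖partialDeriv 1 φ x‖ := by gcongr
    _ = _ := by ring

/-- Quantitative form of the local graph description: a strip of fixed depth below the graph stays
in `U ∩ W`, and the graph over one interval covers the nearby frontier. The set `W` later keeps the
strip away from the cavity. -/
theorem exists_graph_chart {U : Set Plane} (hU : IsOpen U) (hg : HasC11Boundary U) {x₀ : Plane}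
    (hx₀ : x₀ ∈ frontier U) {W : Set Plane} (hW : W ∈ 𝓝 x₀) :
    ∃ (e : Plane ≃ᵃⁱ[ℝ] Plane) (ψ : ℝ → ℝ) (K : NNReal) (a r h : ℝ), 0 < r ∧ 0 < h ∧
      Continuous ψ ∧ LipschitzOnWith K ψ (Metric.closedBall a r) ∧
      (∀ s ∈ Metric.closedBall a r, ∀ y ∈ Ioo (ψ s - h) (ψ s), e !₂[s, y] ∈ U ∩ W) ∧
      frontier U ∩ Metric.ball x₀ r ⊆ (fun s => e !₂[s, ψ s]) '' Metric.closedBall a r := by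
  obtain ⟨R, ψ, ⟨hψ1, -⟩, V, hV, hVU⟩ := hg x₀ hx₀
  have hψc := hψ1.continuous
  obtain ⟨ε, hε, hball⟩ := Metric.mem_nhds_iff.1 (inter_mem hV hW)
  have hcoord : ∀ i, Continuous fun x : Plane => R x i := fun i => by
    have := R.continuous; fun_prop
  -- A frontier point is not in the open set `U`, so it is not below the graph; strictly above the
  -- graph it would have a neighbourhood disjoint from `U`.
  have hfr : ∀ x ∈ frontier U ∩ Metric.ball x₀ ε, R x 1 = ψ (R x 0) := by
    rintro x ⟨hx, hxb⟩
    have hxV : ∀ᶠ y in 𝓝 x, y ∈ V :=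
      mem_of_superset (Metric.isOpen_ball.mem_nhds hxb) fun y hy => (hball hy).1
    rw [hU.frontier_eq] at hx
    refine le_antisymm ?_ (not_lt.1 fun hlt => hx.2 ((hVU x (hball hxb).1).2 hlt))
    by_contra! hlt
    have h1 : ∀ᶠ y in 𝓝 x, ψ (R y 0) < R y 1 :=
      (isOpen_lt (hψc.comp (hcoord 0)) (hcoord 1)).mem_nhds hlt
    obtain ⟨y, hy, hyU⟩ := mem_closure_iff_nhds.1 hx.1 _ (hxV.and h1)
    exact lt_asymm ((hVU y hy.1).1 hyU) hy.2
  have hx₀ψ := hfr x₀ ⟨hx₀, Metric.mem_ball_self hε⟩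
  obtain ⟨K, t, ht, hK⟩ := (hψ1.contDiffAt (x := R x₀ 0)).exists_lipschitzOnWith
  obtain ⟨δ, hδ, hδt⟩ := Metric.mem_nhds_iff.1 ht
  -- The first bound keeps the interval where `ψ` is `K`-Lipschitz. The second makes `r + K r ≤ ε /
  -- 4`, so points in the strip of depth `ε / 4` are within `ε / 2` of `x₀`.
  set r : ℝ := min (δ / 2) (ε / (4 * (1 + K))) with hr
  have hK1 : (0 : ℝ) < 1 + K := by positivity
  have hr0 : 0 < r := by positivity
  have hrK : r * (1 + K) ≤ ε / 4 := by
    have := min_le_right (δ / 2) (ε / (4 * (1 + K)))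
    calc r * (1 + K) ≤ ε / (4 * (1 + K)) * (1 + K) := by gcongr
      _ = ε / 4 := by field_simp
  have hrε : r ≤ ε / 4 := by nlinarith [K.2, hr0, mul_nonneg hr0.le K.2, show (K : ℝ) = K.1 from rfl]
  have hI : Metric.closedBall (R x₀ 0) r ⊆ t := fun s hs => hδt <| by
    have := min_le_left (δ / 2) (ε / (4 * (1 + K)))
    rw [Metric.mem_closedBall] at hs
    rw [Metric.mem_ball]; linarith
  have hKI := hK.mono hI
  refine ⟨R.symm, ψ, K, R x₀ 0, r, ε / 4, hr0, by positivity, hψc, hKI, ?_, ?_⟩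
  · intro s hs y hy
    have hmem : R.symm !₂[s, y] ∈ Metric.ball x₀ ε := by
      rw [Metric.mem_ball, ← R.dist_map, R.apply_symm_apply, ← pair_coords (R x₀)]
      refine (dist_pair_le _ _ _ _).trans_lt ?_
      have h1 := hKI.dist_le_mul s hs _ (Metric.mem_closedBall_self hr0.le)
      have h2 : dist y (ψ s) ≤ ε / 4 := by
        rw [Real.dist_eq, abs_le]; constructor <;> linarith [hy.1, hy.2]
      have h3 := dist_triangle y (ψ s) (ψ (R x₀ 0))
      rw [hx₀ψ]
      rw [Metric.mem_closedBall] at hs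
      have h4 : (K : ℝ) * dist s (R x₀ 0) ≤ K * r := by gcongr
      nlinarith
    refine ⟨(hVU _ (hball hmem).1).2 ?_, (hball hmem).2⟩
    simpa using hy.2
  · rintro x ⟨hx, hxb⟩
    refine ⟨R x 0, ?_, ?_⟩
    · rw [Metric.mem_closedBall, Real.dist_eq]
      refine (abs_coord_sub_le _ _ _).trans ?_
      rw [R.dist_map]; exact (Metric.mem_ball.1 hxb).le
    · have : R x 1 = ψ (R x 0) :=
        hfr x ⟨hx, Metric.ball_subset_ball (by linarith) hxb⟩
      simp only
      rw [← this, pair_coords, R.symm_apply_apply]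

/-- Near a boundary point of a `C^{1,1}` set the boundary has finite length, and the `L²` norms of
`C¹` functions on the boundary are controlled by their energy in the set. -/
theorem exists_local_trace_bound {U : Set Plane} (hU : IsOpen U) (hg : HasC11Boundary U)
    {x₀ : Plane} (hx₀ : x₀ ∈ frontier U) {W : Set Plane} (hWo : IsOpen W) (hW : x₀ ∈ W) :
    ∃ r > 0, arcLength (frontier U) (Metric.ball x₀ r) < ∞ ∧ ∃ C : ℝ≥0∞, C ≠ ∞ ∧
      ∀ φ : Plane → ℂ, ContDiff ℝ 1 φ →
        ∫⁻ x in Metric.ball x₀ r, ‖φ x‖ₑ ^ 2 ∂(arcLength (frontier U)) ≤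
          C * ((∫⁻ x in U ∩ W, ‖φ x‖ₑ ^ 2) + (∫⁻ x in U ∩ W, ‖partialDeriv 0 φ x‖ₑ ^ 2) +
            ∫⁻ x in U ∩ W, ‖partialDeriv 1 φ x‖ₑ ^ 2) := by
  obtain ⟨e, ψ, K, a, r, h, hr, hh, hψ, hK, hsub, hfr⟩ :=
    exists_graph_chart hU hg hx₀ (hWo.mem_nhds hW)
  set I := Metric.closedBall a r with hI
  set p : ℝ → Plane := fun s => e !₂[s, ψ s] with hp
  have hgc : Continuous fun s => (!₂[s, ψ s] : Plane) :=
    continuous_pair.comp (continuous_id.prodMk hψ)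
  have hpc : Continuous p := e.continuous.comp hgc
  have hpL : LipschitzOnWith (1 + K) p I := by
    have := e.isometry.lipschitz.comp_lipschitzOnWith (lipschitzOnWith_graph hK)
    rw [one_mul] at this
    exact this
  set κ : ℝ≥0∞ := ((1 + K : NNReal) : ℝ≥0∞) with hκ
  have hle : (Measure.hausdorffMeasure 1).restrict (p '' I) ≤ κ • (volume.restrict I).map p := by
    have := restrict_hausdorffMeasure_image_le hpL hpc.measurable (d := 1) zero_le_one
    rwa [hausdorffMeasure_real, ENNReal.rpow_one] at this
  have hball : (arcLength (frontier U)).restrict (Metric.ball x₀ r) ≤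
      κ • (volume.restrict I).map p := by
    refine le_trans ?_ hle
    rw [arcLength, Measure.restrict_restrict measurableSet_ball, inter_comm]
    exact Measure.restrict_mono hfr le_rfl
  refine ⟨r, hr, ?_, ?_⟩
  · rw [← Measure.restrict_apply_univ]
    refine (hball univ).trans_lt ?_
    rw [Measure.smul_apply, Measure.map_apply hpc.measurable MeasurableSet.univ, preimage_univ,
      Measure.restrict_apply_univ, smul_eq_mul]
    exact ENNReal.mul_lt_top ENNReal.coe_lt_top (isCompact_closedBall _ _).measure_lt_top
  set h' := ENNReal.ofReal h with hh'
  have hh0 : h' ≠ 0 := by simpa [hh'] using hh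
  have hht : h' ≠ ∞ := ENNReal.ofReal_ne_top
  -- The factor `κ` bounds arc length by the parameter measure, `h'⁻¹` comes from averaging over the
  -- strip, and `4` is `2 * 2`: the factor of the strip estimate times that of `hD`, where the rigid
  -- motion mixes both partial derivatives.
  refine ⟨κ * (h'⁻¹ * (2 + 4 * h' ^ 2)), by finiteness, fun φ hφ => ?_⟩
  set Φ : Plane → ℂ := fun z => φ (e z) with hΦ
  have heD : ContDiff ℝ 1 e := e.toContinuousAffineEquiv.toContinuousAffineMap.contDiff
  have hΦD : ContDiff ℝ 1 Φ := hφ.comp heD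
  have hopen : IsOpen (e ⁻¹' (U ∩ W)) := (hU.inter hWo).preimage e.continuous
  have h1 := lintegral_graph_le hopen (Metric.isClosed_closedBall (x := a) (ε := r)).measurableSet
    hsub hΦD
  have hmp := measurePreserving_isometryEquiv e.toIsometryEquiv
  have hcv : ∀ f : Plane → ℝ≥0∞, Measurable f →
      ∫⁻ z in e ⁻¹' (U ∩ W), f (e z) = ∫⁻ x in U ∩ W, f x := fun f hf =>
    hmp.setLIntegral_comp_preimage (hU.inter hWo).measurableSet hf
  have hD : ∀ z, ‖partialDeriv 1 Φ z‖ₑ ^ 2 ≤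
      2 * ‖partialDeriv 0 φ (e z)‖ₑ ^ 2 + 2 * ‖partialDeriv 1 φ (e z)‖ₑ ^ 2 := by
    intro z
    refine le_trans ?_ (ennreal_add_sq_le _ _)
    gcongr
    refine le_trans ?_ (enorm_fderiv_le φ (e z))
    have hfe : HasFDerivAt e (e.linearIsometryEquiv.toContinuousLinearEquiv : Plane →L[ℝ] Plane) z := by
      have := e.toContinuousAffineEquiv.toContinuousAffineMap.hasFDerivAt (x := z)
      exact this
    have hder : partialDeriv 1 Φ z = fderiv ℝ φ (e z)
        (e.linearIsometryEquiv (EuclideanSpace.single 1 1)) := by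
      have := ((hφ.differentiable one_ne_zero (e z)).hasFDerivAt).comp z hfe
      rw [partialDeriv, show Φ = φ ∘ e from rfl, this.fderiv]; rfl
    rw [hder]
    refine (ContinuousLinearMap.le_opENorm _ _).trans ?_
    have : ‖e.linearIsometryEquiv (EuclideanSpace.single (1 : Fin 2) (1 : ℝ))‖ₑ = 1 := by
      rw [← ofReal_norm, LinearIsometryEquiv.norm_map]; simp
    rw [this, mul_one]
  have hm0 : Measurable fun x => ‖φ x‖ₑ ^ 2 := hφ.continuous.enorm.measurable.pow_const 2
  have hmi : ∀ i, Measurable fun x => ‖partialDeriv i φ x‖ₑ ^ 2 := fun i =>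
    (continuous_partialDeriv hφ i).enorm.measurable.pow_const 2
  have h2 : ∫⁻ z in e ⁻¹' (U ∩ W), ‖partialDeriv 1 Φ z‖ₑ ^ 2 ≤
      2 * (∫⁻ x in U ∩ W, ‖partialDeriv 0 φ x‖ₑ ^ 2) +
        2 * ∫⁻ x in U ∩ W, ‖partialDeriv 1 φ x‖ₑ ^ 2 := by
    refine (lintegral_mono hD).trans (le_of_eq ?_)
    rw [hcv (fun x => 2 * ‖partialDeriv 0 φ x‖ₑ ^ 2 + 2 * ‖partialDeriv 1 φ x‖ₑ ^ 2)
      (((hmi 0).const_mul 2).add ((hmi 1).const_mul 2)), lintegral_add_left ((hmi 0).const_mul 2),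
      lintegral_const_mul _ (hmi 0), lintegral_const_mul _ (hmi 1)]
  have h3 : ∫⁻ z in e ⁻¹' (U ∩ W), ‖Φ z‖ₑ ^ 2 = ∫⁻ x in U ∩ W, ‖φ x‖ₑ ^ 2 := hcv _ hm0
  calc ∫⁻ x in Metric.ball x₀ r, ‖φ x‖ₑ ^ 2 ∂(arcLength (frontier U))
      ≤ ∫⁻ x, ‖φ x‖ₑ ^ 2 ∂(κ • (volume.restrict I).map p) := lintegral_mono' hball le_rfl
    _ = κ * (h'⁻¹ * (h' * ∫⁻ s in I, ‖Φ !₂[s, ψ s]‖ₑ ^ 2)) := by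
        rw [lintegral_smul_measure, lintegral_map hm0 hpc.measurable, ← mul_assoc h'⁻¹,
          ENNReal.inv_mul_cancel hh0 hht, one_mul]; rfl
    _ ≤ κ * (h'⁻¹ * (2 * (∫⁻ x in U ∩ W, ‖φ x‖ₑ ^ 2) + 2 * h' ^ 2 *
          (2 * (∫⁻ x in U ∩ W, ‖partialDeriv 0 φ x‖ₑ ^ 2) +
        2 * ∫⁻ x in U ∩ W, ‖partialDeriv 1 φ x‖ₑ ^ 2))) := by
        rw [← h3]
        gcongr
        exact h1.trans (by gcongr)
    _ ≤ _ := by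
        rw [mul_assoc κ, mul_assoc h'⁻¹]
        gcongr
        generalize (∫⁻ x in U ∩ W, ‖φ x‖ₑ ^ 2) = A
        generalize (∫⁻ x in U ∩ W, ‖partialDeriv 0 φ x‖ₑ ^ 2) = B
        generalize (∫⁻ x in U ∩ W, ‖partialDeriv 1 φ x‖ₑ ^ 2) = C
        have e1 : (2 + 4 * h' ^ 2) * (A + B + C) = (2 * A + 2 * h' ^ 2 * (2 * B + 2 * C)) +
          (4 * h' ^ 2 * A + 2 * B + 2 * C) := by ring
        rw [e1]
        exact le_self_add

/-- The frontier is compact and, by the graph charts, has locally finite length. -/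
theorem arcLength_frontier_lt_top {U : Set Plane} (hU : IsOpen U) (hb : Bornology.IsBounded U)
    (hg : HasC11Boundary U) : (Measure.hausdorffMeasure 1 : Measure Plane) (frontier U) < ∞ := by
  have hK : IsCompact (frontier U) :=
    Metric.isCompact_of_isClosed_isBounded isClosed_frontier
      (hb.closure.subset frontier_subset_closure)
  have := hK.measure_lt_top_of_nhdsWithin (μ := arcLength (frontier U)) fun x hx => by
    obtain ⟨r, hr, hfin, -⟩ := exists_local_trace_bound hU hg hx isOpen_univ (mem_univ x)
    exact ⟨Metric.ball x r, mem_nhdsWithin_of_mem_nhds (Metric.ball_mem_nhds x hr), hfin⟩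
  rwa [arcLength, Measure.restrict_apply_self] at this

/-! ### Convergence in `L²` -/

section L2

variable {X : Type*} [MeasurableSpace X] {μ : Measure X}

theorem lintegral_enorm_sq_eq {f : X → ℂ} (hf : MemLp f 2 μ) :
    ∫⁻ x, ‖f x‖ₑ ^ 2 ∂μ = ENNReal.ofReal (∫ x, ‖f x‖ ^ 2 ∂μ) := by
  have hi := (memLp_two_iff_integrable_sq_norm hf.1).1 hf
  rw [ofReal_integral_eq_lintegral_ofReal hi (Eventually.of_forall fun x => by positivity)]
  refine lintegral_congr fun x => ?_
  rw [ENNReal.ofReal_pow (norm_nonneg _), ofReal_norm]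

/-- Norm convergence used to pass inequalities from `C¹` functions to their Sobolev limits. -/
theorem tendsto_lintegral_sq {f : X → ℂ} {F : ℕ → X → ℂ} (hf : MemLp f 2 μ)
    (hF : ∀ n, AEStronglyMeasurable (F n) μ)
    (h : Tendsto (fun n => eLpNorm (fun x => F n x - f x) 2 μ) atTop (𝓝 0)) :
    Tendsto (fun n => ∫⁻ x, ‖F n x‖ₑ ^ 2 ∂μ) atTop (𝓝 (∫⁻ x, ‖f x‖ₑ ^ 2 ∂μ)) := by
  simp only [← eLpNorm_two_sq]
  refine ((ENNReal.continuous_pow 2).tendsto _).comp ?_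
  have h1 : Tendsto (fun n => eLpNorm f 2 μ - eLpNorm (fun x => F n x - f x) 2 μ) atTop
      (𝓝 (eLpNorm f 2 μ)) := by
    simpa using ENNReal.Tendsto.sub (tendsto_const_nhds (x := eLpNorm f 2 μ)) h
      (Or.inl hf.2.ne)
  have h2 : Tendsto (fun n => eLpNorm (fun x => F n x - f x) 2 μ + eLpNorm f 2 μ) atTop
      (𝓝 (eLpNorm f 2 μ)) := by
    simpa using h.add (tendsto_const_nhds (x := eLpNorm f 2 μ))
  refine tendsto_of_tendsto_of_tendsto_of_le_of_le h1 h2 (fun n => ?_) fun n => ?_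
  · refine tsub_le_iff_left.2 ?_
    have := eLpNorm_sub_le (hF n) ((hF n).sub hf.1) (p := 2) (by norm_num)
    refine le_trans (le_of_eq ?_) (this.trans (le_of_eq (add_comm _ _)))
    congr 1; funext x; simp
  · have := eLpNorm_add_le ((hF n).sub hf.1) hf.1 (p := 2) (by norm_num)
    refine le_trans (le_of_eq ?_) this
    congr 1; funext x; simp

theorem memLp_of_eLpNorm_sub_lt_top {f g : X → ℂ} (hf : MemLp f 2 μ)
    (hg : AEStronglyMeasurable g μ) (h : eLpNorm (fun x => g x - f x) 2 μ < ∞) : MemLp g 2 μ := by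
  have h1 : MemLp (fun x => g x - f x) 2 μ := ⟨hg.sub hf.1, h⟩
  convert h1.add hf using 1
  funext x; simp

theorem tendsto_integral_mul {k f : X → ℂ} {F : ℕ → X → ℂ} (hk : MemLp k 2 μ) (hf : MemLp f 2 μ)
    (hF : ∀ n, AEStronglyMeasurable (F n) μ)
    (h : Tendsto (fun n => eLpNorm (fun x => F n x - f x) 2 μ) atTop (𝓝 0)) :
    Tendsto (fun n => ∫ x, k x * F n x ∂μ) atTop (𝓝 (∫ x, k x * f x ∂μ)) := by
  refine tendsto_integral_of_L1' _ (hk.integrable_mul hf).1 ?_ ?_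
  · filter_upwards [h.eventually (gt_mem_nhds (show (0 : ℝ≥0∞) < ∞ by simp))] with n hn
    exact hk.integrable_mul (memLp_of_eLpNorm_sub_lt_top hf (hF n) hn)
  · have h1 : Tendsto (fun n => eLpNorm k 2 μ * eLpNorm (fun x => F n x - f x) 2 μ) atTop (𝓝 0) := by
      simpa using ENNReal.Tendsto.const_mul h (Or.inr hk.2.ne)
    refine tendsto_of_tendsto_of_tendsto_of_le_of_le tendsto_const_nhds h1 (fun _ => zero_le)
      fun n => ?_
    have := eLpNorm_smul_le_mul_eLpNorm (p := 2) (q := 2) (r := 1) ((hF n).sub hf.1) hk.1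
    refine le_trans (le_of_eq ?_) this
    congr 1; funext x; simp [mul_sub]

end L2

theorem memLp_conj {X : Type*} [MeasurableSpace X] {μ : Measure X} {f : X → ℂ} (hf : MemLp f 2 μ) :
    MemLp (fun x => conj (f x)) 2 μ :=
  hf.norm.of_le_enorm (Complex.continuous_conj.comp_aestronglyMeasurable hf.1)
    (Eventually.of_forall fun x => by simp)

theorem memLp_of_continuous {μ : Measure Plane} [IsFiniteMeasure μ] {S : Set Plane}
    (hS : Bornology.IsBounded S) (hμ : ∀ᵐ x ∂μ, x ∈ S) {φ : Plane → ℂ} (hφ : Continuous φ) :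
    MemLp φ 2 μ := by
  obtain ⟨C, hC⟩ := hS.isCompact_closure.exists_bound_of_continuousOn hφ.continuousOn
  exact MemLp.of_bound hφ.aestronglyMeasurable C
    (hμ.mono fun x hx => hC x (subset_closure hx))

/-! ### Weak gradients -/

/-- Integration by parts holds for each `C¹` approximant, and both sides are pairings with fixed
`L²` functions, so it survives the limit. Consequently the weak-derivative clause of `HasTrace` is
implied by the approximation clause. -/
theorem weak_of_approx {Ω : Set Plane} {u : Plane → ℂ} {G : Fin 2 → Plane → ℂ}
    (hu : MemLp u 2 (volume.restrict Ω)) (hG : ∀ i, MemLp (G i) 2 (volume.restrict Ω))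
    {φ : ℕ → Plane → ℂ} (hφ : ∀ n, ContDiff ℝ 1 (φ n))
    (h0 : Tendsto (fun n => eLpNorm (fun x => φ n x - u x) 2 (volume.restrict Ω)) atTop (𝓝 0))
    (h1 : ∀ i, Tendsto (fun n => eLpNorm (fun x => partialDeriv i (φ n) x - G i x) 2
      (volume.restrict Ω)) atTop (𝓝 0)) (i : Fin 2) {χ : Plane → ℝ} (hχ : ContDiff ℝ (⊤ : ℕ∞) χ)
    (hc : HasCompactSupport χ) (hs : tsupport χ ⊆ Ω) :
    ∫ x in Ω, ((partialDeriv i χ x : ℝ) : ℂ) * u x = - ∫ x in Ω, (χ x : ℂ) * G i x := by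
  have hχ1 : ContDiff ℝ 1 χ := hχ.of_le (by exact_mod_cast le_top)
  have hdc : Continuous fun x => ((partialDeriv i χ x : ℝ) : ℂ) :=
    Complex.continuous_ofReal.comp ((hχ1.continuous_fderiv one_ne_zero).clm_apply continuous_const)
  have hcc : Continuous fun x => (χ x : ℂ) := Complex.continuous_ofReal.comp hχ.continuous
  have hds : HasCompactSupport fun x => ((partialDeriv i χ x : ℝ) : ℂ) :=
    (hc.fderiv_apply ℝ (EuclideanSpace.single i (1 : ℝ))).comp_left (g := fun t : ℝ => (t : ℂ)) (by simp)
  have hcs : HasCompactSupport fun x => (χ x : ℂ) :=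
    hc.comp_left (g := fun t : ℝ => (t : ℂ)) (by simp)
  have hn : ∀ n, ∫ x in Ω, ((partialDeriv i χ x : ℝ) : ℂ) * φ n x =
      - ∫ x in Ω, (χ x : ℂ) * partialDeriv i (φ n) x := by
    intro n
    have z1 : ∀ x, x ∉ Ω → χ x = 0 := fun x hx => image_eq_zero_of_notMem_tsupport fun h => hx (hs h)
    have z2 : ∀ x, x ∉ Ω → partialDeriv i χ x = 0 := fun x hx => by
      have : fderiv ℝ χ x = 0 := image_eq_zero_of_notMem_tsupport
        fun h => hx (hs (tsupport_fderiv_subset ℝ h))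
      simp [partialDeriv, this]
    -- The test function and its derivative vanish outside `Ω`, so the integration by parts takes
    -- place in the whole plane and no boundary term appears.
    rw [setIntegral_eq_integral_of_forall_compl_eq_zero fun x hx => by simp [z2 x hx],
      setIntegral_eq_integral_of_forall_compl_eq_zero fun x hx => by simp [z1 x hx]]
    have hd := continuous_partialDeriv (hφ n) i
    have hder : ∀ x, fderiv ℝ (fun x => (χ x : ℂ)) x (EuclideanSpace.single i 1) =
        ((partialDeriv i χ x : ℝ) : ℂ) := fun x => by
      have := Complex.ofRealCLM.hasFDerivAt.comp x (hχ1.differentiable one_ne_zero x).hasFDerivAt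
      rw [show (fun x => (χ x : ℂ)) = Complex.ofRealCLM ∘ χ from rfl, this.fderiv]; rfl
    have := integral_mul_fderiv_eq_neg_fderiv_mul_of_integrable (μ := (volume : Measure Plane))
      (f := φ n) (g := fun x => (χ x : ℂ)) (v := EuclideanSpace.single i 1)
      ((hd.mul hcc).integrable_of_hasCompactSupport hcs.mul_left)
      (by simp only [hder]
          exact ((hφ n).continuous.mul hdc).integrable_of_hasCompactSupport hds.mul_left)
      (((hφ n).continuous.mul hcc).integrable_of_hasCompactSupport hcs.mul_left)
      (fun x _ => (hφ n).differentiable one_ne_zero x)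
      (fun x _ => (Complex.ofRealCLM.contDiff.comp hχ1).differentiable one_ne_zero x)
    simp only [hder] at this
    simp only [mul_comm (((partialDeriv i χ _ : ℝ) : ℂ)), mul_comm ((χ _ : ℝ) : ℂ)]
    exact this
  have l1 := tendsto_integral_mul ((hdc.memLp_of_hasCompactSupport hds).restrict Ω) hu
    (fun n => (hφ n).continuous.aestronglyMeasurable) h0
  have l2 := tendsto_integral_mul ((hcc.memLp_of_hasCompactSupport hcs).restrict Ω) (hG i)
    (fun n => (continuous_partialDeriv (hφ n) i).aestronglyMeasurable) (h1 i)
  simp only [hn] at l1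
  exact tendsto_nhds_unique l1 l2.neg

theorem locallyIntegrableOn_of_memLp {S : Set Plane} {μ : Measure Plane} {f : Plane → ℂ}
    (hf : MemLp f 2 μ) [IsFiniteMeasureOnCompacts μ] : LocallyIntegrableOn f S μ :=
  (hf.locallyIntegrable (by norm_num)).locallyIntegrableOn S

/-- The difference of the gradients annihilates every test function, so the fundamental lemma of the
calculus of variations applies. -/
theorem IsH1.grad_ae_eq {Ω : Set Plane} (hΩ : IsOpen Ω) {u v : Plane → ℂ}
    {G H : Fin 2 → Plane → ℂ} (hu : IsH1 Ω u G) (hv : IsH1 Ω v H)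
    (h : u =ᵐ[volume.restrict Ω] v) (i : Fin 2) : G i =ᵐ[volume.restrict Ω] H i := by
  have hm : MemLp (fun x => G i x - H i x) 2 (volume.restrict Ω) :=
    (hu.memLp_grad i).sub (hv.memLp_grad i)
  have := hΩ.ae_eq_zero_of_integral_contDiff_smul_eq_zero (μ := volume.restrict Ω)
    (locallyIntegrableOn_of_memLp hm) fun χ hχ hc hs => ?_
  · filter_upwards [this, ae_restrict_mem hΩ.measurableSet] with x hx hxΩ
    exact sub_eq_zero.1 (hx hxΩ)
  · have hcm : MemLp (fun x => (χ x : ℂ)) 2 (volume.restrict Ω) :=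
      ((Complex.continuous_ofReal.comp hχ.continuous).memLp_of_hasCompactSupport
        (hc.comp_left (g := fun t : ℝ => (t : ℂ)) (by simp))).restrict Ω
    have e1 := hu.weak i χ hχ hc hs
    have e2 := hv.weak i χ hχ hc hs
    have e3 : ∫ x in Ω, ((partialDeriv i χ x : ℝ) : ℂ) * u x =
        ∫ x in Ω, ((partialDeriv i χ x : ℝ) : ℂ) * v x :=
      integral_congr_ae (h.mono fun x hx => by simp only [hx])
    rw [e1, e2, neg_inj] at e3
    simp only [Complex.real_smul, mul_sub]
    refine (integral_sub (hcm.integrable_mul (hu.memLp_grad i))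
      (hcm.integrable_mul (hv.memLp_grad i))).trans ?_
    exact sub_eq_zero.2 e3

/-! ### Operations on functions with a trace -/

theorem partialDeriv_sub {φ ψ : Plane → ℂ} (hφ : ContDiff ℝ 1 φ) (hψ : ContDiff ℝ 1 ψ) (i : Fin 2)
    (x : Plane) :
    partialDeriv i (fun x => φ x - ψ x) x = partialDeriv i φ x - partialDeriv i ψ x := by
  have := ((hφ.differentiable one_ne_zero x).hasFDerivAt).sub
    ((hψ.differentiable one_ne_zero x).hasFDerivAt)
  rw [partialDeriv, show (fun x => φ x - ψ x) = φ - ψ from rfl, this.fderiv]; rfl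

theorem partialDeriv_conj {φ : Plane → ℂ} (hφ : ContDiff ℝ 1 φ) (i : Fin 2) (x : Plane) :
    partialDeriv i (fun x => conj (φ x)) x = conj (partialDeriv i φ x) := by
  have := (Complex.conjCLE : ℂ →L[ℝ] ℂ).hasFDerivAt.comp x
    (hφ.differentiable one_ne_zero x).hasFDerivAt
  rw [partialDeriv, show (fun x => conj (φ x)) = (Complex.conjCLE : ℂ →L[ℝ] ℂ) ∘ φ from rfl,
    this.fderiv]; rfl

theorem tendsto_eLpNorm_sub_sub {X : Type*} [MeasurableSpace X] {μ : Measure X} {f g : X → ℂ}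
    {F K : ℕ → X → ℂ} (hf : AEStronglyMeasurable f μ) (hg : AEStronglyMeasurable g μ)
    (hF : ∀ n, AEStronglyMeasurable (F n) μ) (hK : ∀ n, AEStronglyMeasurable (K n) μ)
    (h1 : Tendsto (fun n => eLpNorm (fun x => F n x - f x) 2 μ) atTop (𝓝 0))
    (h2 : Tendsto (fun n => eLpNorm (fun x => K n x - g x) 2 μ) atTop (𝓝 0)) :
    Tendsto (fun n => eLpNorm (fun x => (F n x - K n x) - (f x - g x)) 2 μ) atTop (𝓝 0) := by
  refine tendsto_of_tendsto_of_tendsto_of_le_of_le tendsto_const_nhds (by simpa using h1.add h2)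
    (fun _ => zero_le) fun n => ?_
  refine le_trans (le_of_eq ?_) (eLpNorm_sub_le ((hF n).sub hf) ((hK n).sub hg) (by norm_num))
  congr 1; funext x; simp; ring

theorem hasTrace_of_approx {Ω : Set Plane} {u : Plane → ℂ} {G : Fin 2 → Plane → ℂ}
    {η : Plane → ℂ} (hu : MemLp u 2 (volume.restrict Ω))
    (hG : ∀ i, MemLp (G i) 2 (volume.restrict Ω)) (hη : MemLp η 2 (arcLength (frontier Ω)))
    {φ : ℕ → Plane → ℂ} (hφ : ∀ n, ContDiff ℝ 1 (φ n))
    (h0 : Tendsto (fun n => eLpNorm (fun x => φ n x - u x) 2 (volume.restrict Ω)) atTop (𝓝 0))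
    (h1 : ∀ i, Tendsto (fun n => eLpNorm (fun x => partialDeriv i (φ n) x - G i x) 2
      (volume.restrict Ω)) atTop (𝓝 0))
    (h2 : Tendsto (fun n => eLpNorm (fun x => φ n x - η x) 2 (arcLength (frontier Ω)))
      atTop (𝓝 0)) : HasTrace Ω u G η :=
  ⟨⟨hu, hG, fun i _ hχ hc hs => weak_of_approx hu hG hφ h0 h1 i hχ hc hs⟩, hη, φ, hφ, h0, h1, h2⟩

theorem HasTrace.sub {Ω : Set Plane} {u v : Plane → ℂ} {G H : Fin 2 → Plane → ℂ}
    {η ζ : Plane → ℂ} (hu : HasTrace Ω u G η) (hv : HasTrace Ω v H ζ) :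
    HasTrace Ω (fun x => u x - v x) (fun i x => G i x - H i x) fun x => η x - ζ x := by
  obtain ⟨φ, hφ, a0, a1, a2⟩ := hu.approx
  obtain ⟨ψ, hψ, b0, b1, b2⟩ := hv.approx
  refine hasTrace_of_approx (φ := fun n x => φ n x - ψ n x) (hu.isH1.memLp.sub hv.isH1.memLp)
    (fun i => (hu.isH1.memLp_grad i).sub (hv.isH1.memLp_grad i))
    (hu.memLp_trace.sub hv.memLp_trace) (fun n => (hφ n).sub (hψ n)) ?_ (fun i => ?_) ?_
  · exact tendsto_eLpNorm_sub_sub hu.isH1.memLp.1 hv.isH1.memLp.1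
      (fun n => (hφ n).continuous.aestronglyMeasurable)
      (fun n => (hψ n).continuous.aestronglyMeasurable) a0 b0
  · simp only [partialDeriv_sub (hφ _) (hψ _)]
    exact tendsto_eLpNorm_sub_sub (hu.isH1.memLp_grad i).1 (hv.isH1.memLp_grad i).1
      (fun n => (continuous_partialDeriv (hφ n) i).aestronglyMeasurable)
      (fun n => (continuous_partialDeriv (hψ n) i).aestronglyMeasurable) (a1 i) (b1 i)
  · exact tendsto_eLpNorm_sub_sub hu.memLp_trace.1 hv.memLp_trace.1
      (fun n => (hφ n).continuous.aestronglyMeasurable)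
      (fun n => (hψ n).continuous.aestronglyMeasurable) a2 b2

theorem HasTrace.conj {Ω : Set Plane} {u : Plane → ℂ} {G : Fin 2 → Plane → ℂ}
    {η : Plane → ℂ} (hu : HasTrace Ω u G η) :
    HasTrace Ω (fun x => conj (u x)) (fun i x => conj (G i x)) fun x => conj (η x) := by
  obtain ⟨φ, hφ, a0, a1, a2⟩ := hu.approx
  have key : ∀ (μ : Measure Plane) (f g : Plane → ℂ),
      eLpNorm (fun x => (starRingEnd ℂ) (f x) - (starRingEnd ℂ) (g x)) 2 μ =
        eLpNorm (fun x => f x - g x) 2 μ := fun μ f g =>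
    eLpNorm_congr_norm_ae (Eventually.of_forall fun x => by rw [← map_sub, RCLike.norm_conj])
  refine hasTrace_of_approx (φ := fun n x => (starRingEnd ℂ) (φ n x)) (memLp_conj hu.isH1.memLp)
    (fun i => memLp_conj (hu.isH1.memLp_grad i)) (memLp_conj hu.memLp_trace)
    (fun n => (Complex.conjCLE : ℂ →L[ℝ] ℂ).contDiff.comp (hφ n)) ?_ (fun i => ?_) ?_
  · simpa only [key] using a0
  · simpa only [partialDeriv_conj (hφ _), key] using a1 i
  · simpa only [key] using a2

theorem hasTrace_of_contDiff {Ω : Set Plane} (hb : Bornology.IsBounded Ω) (hΩ : IsOpen Ω)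
    (hfin : (Measure.hausdorffMeasure 1 : Measure Plane) (frontier Ω) < ∞) {φ : Plane → ℂ}
    (hφ : ContDiff ℝ 1 φ) : HasTrace Ω φ (fun i => partialDeriv i φ) φ := by
  have : IsFiniteMeasure (volume.restrict Ω) := isFiniteMeasure_restrict.2 hb.measure_lt_top.ne
  have : IsFiniteMeasure (arcLength (frontier Ω)) := isFiniteMeasure_restrict.2 hfin.ne
  have hm : ∀ᵐ x ∂(volume.restrict Ω), x ∈ Ω := ae_restrict_mem hΩ.measurableSet
  refine hasTrace_of_approx (φ := fun _ => φ) (memLp_of_continuous hb hm hφ.continuous)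
    (fun i => memLp_of_continuous hb hm (continuous_partialDeriv hφ i))
    (memLp_of_continuous (μ := arcLength (frontier Ω)) (hb.closure.subset frontier_subset_closure)
      (ae_restrict_mem isClosed_frontier.measurableSet) hφ.continuous) (fun _ => hφ) ?_ ?_ ?_ <;>
  simp

/-! ### Friedrichs inequality and uniqueness of traces -/

theorem le_of_ofReal_le {a b c r : ℝ} (hb : 0 ≤ b) (hc : 0 ≤ c) (hr : 0 ≤ r)
    (h : ENNReal.ofReal a ≤ ENNReal.ofReal r * (2 * ENNReal.ofReal b +
      2 * ENNReal.ofReal r * ENNReal.ofReal c)) : a ≤ r * (2 * b + 2 * r * c) := by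
  rw [show (2 : ℝ≥0∞) = ENNReal.ofReal 2 by simp,
    ← ENNReal.ofReal_mul (by norm_num), ← ENNReal.ofReal_mul (by norm_num),
    ← ENNReal.ofReal_mul (by positivity), ← ENNReal.ofReal_add (by positivity) (by positivity),
    ← ENNReal.ofReal_mul (by positivity)] at h
  exact (ENNReal.ofReal_le_ofReal_iff (by positivity)).1 h

/-- The Friedrichs inequality for Sobolev functions. -/
theorem HasTrace.friedrichs {Ω : Set Plane} (hΩ : IsOpen Ω) {R : ℝ} (hR0 : 0 ≤ R)
    (hR : ∀ x ∈ Ω, ‖x‖ ≤ R) {u : Plane → ℂ} {G : Fin 2 → Plane → ℂ} {η : Plane → ℂ}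
    (hu : HasTrace Ω u G η) :
    ∫ x in Ω, ‖u x‖ ^ 2 ≤ 2 * R * (2 * (∫ x, ‖η x‖ ^ 2 ∂(arcLength (frontier Ω)))
      + 2 * (2 * R) * ∫ x in Ω, ‖G 1 x‖ ^ 2) := by
  obtain ⟨φ, hφ, a0, a1, a2⟩ := hu.approx
  have h0 := tendsto_lintegral_sq hu.isH1.memLp
    (fun n => (hφ n).continuous.aestronglyMeasurable) a0
  have h1 := tendsto_lintegral_sq (hu.isH1.memLp_grad 1)
    (fun n => (continuous_partialDeriv (hφ n) 1).aestronglyMeasurable) (a1 1)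
  have h2 := tendsto_lintegral_sq hu.memLp_trace
    (fun n => (hφ n).continuous.aestronglyMeasurable) a2
  have hlim := le_of_tendsto_of_tendsto' h0
    (ENNReal.Tendsto.const_mul ((ENNReal.Tendsto.const_mul h2 (Or.inr ENNReal.ofNat_ne_top)).add
      (ENNReal.Tendsto.const_mul h1 (Or.inr (by finiteness : 2 * ENNReal.ofReal (2 * R) ≠ ∞))))
      (Or.inr (ENNReal.ofReal_ne_top (r := 2 * R)))) fun n => friedrichs_contDiff hΩ hR (hφ n)
  rw [lintegral_enorm_sq_eq hu.isH1.memLp, lintegral_enorm_sq_eq (hu.isH1.memLp_grad 1),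
    lintegral_enorm_sq_eq hu.memLp_trace] at hlim
  exact le_of_ofReal_le (by positivity) (by positivity) (by positivity) hlim

/-- The trace of zero on a `C^{1,1}` part of the boundary vanishes. -/
theorem HasTrace.trace_ae_eq_zero {D Ω W : Set Plane} (hD : IsOpen D) (hDr : HasC11Boundary D)
    (hW : IsOpen W) (hWD : frontier D ⊆ W) (hΩ : D ∩ W ⊆ Ω) (hfr : frontier D ⊆ frontier Ω)
    {u : Plane → ℂ} {G : Fin 2 → Plane → ℂ} {η : Plane → ℂ} (hu : HasTrace Ω u G η)
    (hu0 : u =ᵐ[volume.restrict Ω] 0) (hG0 : ∀ i, G i =ᵐ[volume.restrict Ω] 0) :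
    ∀ᵐ x ∂(arcLength (frontier D)), η x = 0 := by
  obtain ⟨φ, hφ, a0, a1, a2⟩ := hu.approx
  have c0 := tendsto_lintegral_sq hu.isH1.memLp
    (fun n => (hφ n).continuous.aestronglyMeasurable) a0
  have c1 := fun i => tendsto_lintegral_sq (hu.isH1.memLp_grad i)
    (fun n => (continuous_partialDeriv (hφ n) i).aestronglyMeasurable) (a1 i)
  have z : ∀ f : Plane → ℂ, f =ᵐ[volume.restrict Ω] 0 → ∫⁻ x in Ω, ‖f x‖ₑ ^ 2 = 0 := fun f hf => by
    rw [lintegral_congr_ae (g := fun _ => 0) (hf.mono fun x hx => by simp [hx]), lintegral_zero]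
  rw [z u hu0] at c0
  simp only [z _ (hG0 _)] at c1
  have hle : arcLength (frontier D) ≤ arcLength (frontier Ω) := Measure.restrict_mono hfr le_rfl
  have hηm : AEStronglyMeasurable η (arcLength (frontier D)) := hu.memLp_trace.1.mono_measure hle
  have hloc : ∀ x₀ ∈ frontier D, ∃ r > 0,
      ∀ᵐ x ∂(arcLength (frontier D)).restrict (Metric.ball x₀ r), η x = 0 := by
    intro x₀ hx₀
    obtain ⟨r, hr, -, C, hC, htr⟩ := exists_local_trace_bound hD hDr hx₀ hW (hWD hx₀)
    refine ⟨r, hr, ?_⟩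
    have hsm : (arcLength (frontier D)).restrict (Metric.ball x₀ r) ≤ arcLength (frontier Ω) :=
      Measure.restrict_le_self.trans hle
    -- Split `η` into `φ n` minus the error `φ n - η`. The error vanishes by trace convergence; `φ
    -- n` is controlled by its `H¹` energy through the local trace inequality, and this energy tends
    -- to zero with `u` and `G`.
    have hb : ∀ n, ∫⁻ x in Metric.ball x₀ r, ‖η x‖ₑ ^ 2 ∂(arcLength (frontier D)) ≤
        2 * eLpNorm (fun x => φ n x - η x) 2 (arcLength (frontier Ω)) ^ 2 +
        2 * (C * ((∫⁻ x in Ω, ‖φ n x‖ₑ ^ 2) + (∫⁻ x in Ω, ‖partialDeriv 0 (φ n) x‖ₑ ^ 2) +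
            ∫⁻ x in Ω, ‖partialDeriv 1 (φ n) x‖ₑ ^ 2)) := by
      intro n
      calc ∫⁻ x in Metric.ball x₀ r, ‖η x‖ₑ ^ 2 ∂(arcLength (frontier D))
          ≤ ∫⁻ x in Metric.ball x₀ r, (2 * ‖φ n x - η x‖ₑ ^ 2 + 2 * ‖φ n x‖ₑ ^ 2)
              ∂(arcLength (frontier D)) := by
            refine lintegral_mono fun x => le_trans ?_ (ennreal_add_sq_le _ _)
            gcongr
            calc ‖η x‖ₑ = ‖φ n x - (φ n x - η x)‖ₑ := by congr 1; ring
              _ ≤ _ := (enorm_sub_le).trans (le_of_eq (add_comm _ _))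
        _ = 2 * (∫⁻ x in Metric.ball x₀ r, ‖φ n x - η x‖ₑ ^ 2 ∂(arcLength (frontier D))) +
            2 * ∫⁻ x in Metric.ball x₀ r, ‖φ n x‖ₑ ^ 2 ∂(arcLength (frontier D)) := by
            have m1 : Measurable fun x => ‖φ n x‖ₑ ^ 2 :=
              (hφ n).continuous.enorm.measurable.pow_const 2
            rw [lintegral_add_right _ (m1.const_mul 2), lintegral_const_mul' _ _ (by simp),
              lintegral_const_mul' _ _ (by simp)]
        _ ≤ _ := by
            rw [eLpNorm_two_sq]
            refine add_le_add (mul_le_mul_right (lintegral_mono' hsm le_rfl) _)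
              (mul_le_mul_right ((htr _ (hφ n)).trans (mul_le_mul_right ?_ _)) _)
            exact add_le_add (add_le_add (lintegral_mono_set hΩ) (lintegral_mono_set hΩ))
              (lintegral_mono_set hΩ)
    have hlim : Tendsto (fun n => 2 * eLpNorm (fun x => φ n x - η x) 2 (arcLength (frontier Ω)) ^ 2 +
        2 * (C * ((∫⁻ x in Ω, ‖φ n x‖ₑ ^ 2) + (∫⁻ x in Ω, ‖partialDeriv 0 (φ n) x‖ₑ ^ 2) +
            ∫⁻ x in Ω, ‖partialDeriv 1 (φ n) x‖ₑ ^ 2))) atTop (𝓝 0) := by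
      have e1 := ((ENNReal.continuous_pow 2).tendsto _).comp a2
      have e2 := ENNReal.Tendsto.const_mul e1 (Or.inr ENNReal.ofNat_ne_top) (a := 2)
      have e3 := ENNReal.Tendsto.const_mul (ENNReal.Tendsto.const_mul ((c0.add (c1 0)).add (c1 1))
        (Or.inr hC)) (Or.inr ENNReal.ofNat_ne_top) (a := 2)
      simpa using e2.add e3
    have h0 := le_antisymm (ge_of_tendsto' hlim hb) zero_le
    rw [lintegral_eq_zero_iff' ((hηm.restrict).enorm.pow_const 2)] at h0
    filter_upwards [h0] with x hx
    simpa using hx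
  have hnull : arcLength (frontier D) ({x | η x ≠ 0} ∩ frontier D) = 0 := by
    refine measure_null_of_locally_null _ fun x₀ hx₀ => ?_
    obtain ⟨r, hr, h⟩ := hloc x₀ hx₀.2
    refine ⟨{x | η x ≠ 0} ∩ Metric.ball x₀ r, ?_, ?_⟩
    · filter_upwards [self_mem_nhdsWithin, mem_nhdsWithin_of_mem_nhds (Metric.ball_mem_nhds x₀ hr)]
        with x h1 h2 using ⟨h1.1, h2⟩
    · rw [ae_iff, Measure.restrict_apply' measurableSet_ball] at h
      exact h
  filter_upwards [measure_eq_zero_iff_ae_notMem.1 hnull,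
    ae_restrict_mem isClosed_frontier.measurableSet] with x h1 h2
  by_contra h
  exact h1 ⟨h, h2⟩

/-! ### The sesquilinear form of the state problem -/

/-- The sesquilinear form of the complex coupled boundary problem. -/
noncomputable def energyForm (D : Set Plane) (α ρ : ℝ) (Ω : Set Plane) (G : Fin 2 → Plane → ℂ)
    (η : Plane → ℂ) (H : Fin 2 → Plane → ℂ) (ζ : Plane → ℂ) : ℂ :=
  dirichletForm Ω G H + Complex.I * ρ * boundaryForm (frontier D) η ζ
    + α * boundaryForm (frontier Ω \ frontier D) η ζ

/-- The squared energy of a gradient `H` in `Ω` and a trace `ζ` on `∂Ω`. -/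
noncomputable def energy (Ω : Set Plane) (H : Fin 2 → Plane → ℂ) (ζ : Plane → ℂ) : ℝ :=
  (∫ x in Ω, ‖H 0 x‖ ^ 2) + (∫ x in Ω, ‖H 1 x‖ ^ 2) + ∫ x, ‖ζ x‖ ^ 2 ∂(arcLength (frontier Ω))

/-- The properties of the domains `Ω` that make the state problem well posed. -/
structure IsStateDomain (D Ω : Set Plane) : Prop where
  isOpen : IsOpen Ω
  isBounded : Bornology.IsBounded Ω
  finite : (Measure.hausdorffMeasure 1 : Measure Plane) (frontier Ω) < ∞
  subset : frontier D ⊆ frontier Ω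

theorem arcLength_eq_add {S T : Set Plane} (hS : MeasurableSet S) (h : S ⊆ T) :
    arcLength T = arcLength S + arcLength (T \ S) := by
  have := Measure.restrict_inter_add_sdiff (μ := (Measure.hausdorffMeasure 1 : Measure Plane)) T hS
  rw [inter_eq_self_of_subset_right h] at this
  exact this.symm

theorem arcLength_mono {S T : Set Plane} (h : S ⊆ T) : arcLength S ≤ arcLength T :=
  Measure.restrict_mono h le_rfl

theorem integrable_mul_conj {X : Type*} [MeasurableSpace X] {μ : Measure X} {f g : X → ℂ}
    (hf : MemLp f 2 μ) (hg : MemLp g 2 μ) : Integrable (fun x => f x * conj (g x)) μ :=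
  hf.integrable_mul (memLp_conj hg)

theorem integral_mul_conj_self {X : Type*} [MeasurableSpace X] {μ : Measure X} (f : X → ℂ) :
    ∫ x, f x * conj (f x) ∂μ = ((∫ x, ‖f x‖ ^ 2 ∂μ : ℝ) : ℂ) := by
  rw [← integral_complex_ofReal]
  refine integral_congr_ae (Eventually.of_forall fun x => ?_)
  simp only [Complex.mul_conj, Complex.normSq_eq_norm_sq]

theorem integrable_norm_sq {X : Type*} [MeasurableSpace X] {μ : Measure X} {f : X → ℂ}
    (hf : MemLp f 2 μ) : Integrable (fun x => ‖f x‖ ^ 2) μ :=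
  (memLp_two_iff_integrable_sq_norm hf.1).1 hf

theorem energy_eq {D Ω : Set Plane} (h : frontier D ⊆ frontier Ω) (H : Fin 2 → Plane → ℂ)
    {ζ : Plane → ℂ} (hζ : MemLp ζ 2 (arcLength (frontier Ω))) :
    energy Ω H ζ = (∫ x in Ω, ‖H 0 x‖ ^ 2) + (∫ x in Ω, ‖H 1 x‖ ^ 2) +
      ((∫ x, ‖ζ x‖ ^ 2 ∂(arcLength (frontier D))) +
        ∫ x, ‖ζ x‖ ^ 2 ∂(arcLength (frontier Ω \ frontier D))) := by
  have hi := integrable_norm_sq hζ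
  have he := arcLength_eq_add isClosed_frontier.measurableSet h
  rw [energy, he, integral_add_measure]
  · exact hi.mono_measure (arcLength_mono h)
  · exact hi.mono_measure (arcLength_mono sdiff_subset)

/-- Coercivity of the sesquilinear form with respect to the energy. -/
theorem energy_le_norm_energyForm {D Ω : Set Plane} (h : frontier D ⊆ frontier Ω) (α ρ : ℝ)
    (H : Fin 2 → Plane → ℂ) {ζ : Plane → ℂ}
    (hζ : MemLp ζ 2 (arcLength (frontier Ω))) :
    min 1 (min α ρ) / 2 * energy Ω H ζ ≤ ‖energyForm D α ρ Ω H ζ H ζ‖ := by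
  rw [energy_eq h H hζ, energyForm, dirichletForm, boundaryForm, boundaryForm, Fin.sum_univ_two]
  simp only [integral_mul_conj_self]
  have p0 : 0 ≤ ∫ x in Ω, ‖H 0 x‖ ^ 2 := by positivity
  have p1 : 0 ≤ ∫ x in Ω, ‖H 1 x‖ ^ 2 := by positivity
  have p2 : 0 ≤ ∫ x, ‖ζ x‖ ^ 2 ∂(arcLength (frontier D)) := by positivity
  have p3 : 0 ≤ ∫ x, ‖ζ x‖ ^ 2 ∂(arcLength (frontier Ω \ frontier D)) := by positivity
  generalize (∫ x in Ω, ‖H 0 x‖ ^ 2) = a at *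
  generalize (∫ x in Ω, ‖H 1 x‖ ^ 2) = b at *
  generalize (∫ x, ‖ζ x‖ ^ 2 ∂(arcLength (frontier D))) = c at *
  generalize (∫ x, ‖ζ x‖ ^ 2 ∂(arcLength (frontier Ω \ frontier D))) = d at *
  set κ := min 1 (min α ρ) with hκ
  have k1 : κ ≤ 1 := min_le_left _ _
  have k2 : κ ≤ α := (min_le_right _ _).trans (min_le_left _ _)
  have k3 : κ ≤ ρ := (min_le_right _ _).trans (min_le_right _ _)
  set z : ℂ := (a : ℂ) + b + Complex.I * ρ * c + α * d with hz
  have hre : z.re = a + b + α * d := by simp [hz]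
  have him : z.im = ρ * c := by simp [hz]
  -- Real and imaginary parts are each at most `‖z‖`; adding the two bounds costs the factor `1 / 2`
  -- in the coercivity constant.
  have h1 : a + b + α * d ≤ ‖z‖ := hre ▸ Complex.re_le_norm z
  have h2 : ρ * c ≤ ‖z‖ := him ▸ Complex.im_le_norm z
  nlinarith [mul_le_mul_of_nonneg_right k1 p0, mul_le_mul_of_nonneg_right k1 p1,
    mul_le_mul_of_nonneg_right k3 p2, mul_le_mul_of_nonneg_right k2 p3]

/-- The Friedrichs inequality has coefficient `4 * R` on the trace and `8 * R ^ 2` on the gradient;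
their sum dominates both. Hence the energy alone controls the full `H¹` norm. -/
theorem HasTrace.integral_sq_le {Ω : Set Plane} (hΩ : IsOpen Ω) {R : ℝ} (hR0 : 0 ≤ R)
    (hR : ∀ x ∈ Ω, ‖x‖ ≤ R) {u : Plane → ℂ} {G : Fin 2 → Plane → ℂ} {η : Plane → ℂ}
    (hu : HasTrace Ω u G η) :
    ∫ x in Ω, ‖u x‖ ^ 2 ≤ (4 * R + 8 * R ^ 2) * energy Ω G η := by
  have h := hu.friedrichs hΩ hR0 hR
  rw [energy]
  have p0 : 0 ≤ ∫ x in Ω, ‖G 0 x‖ ^ 2 := by positivity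
  have p1 : 0 ≤ ∫ x in Ω, ‖G 1 x‖ ^ 2 := by positivity
  have p2 : 0 ≤ ∫ x, ‖η x‖ ^ 2 ∂(arcLength (frontier Ω)) := by positivity
  have q : 0 ≤ R ^ 2 := by positivity
  nlinarith [mul_nonneg hR0 p0, mul_nonneg hR0 p1, mul_nonneg q p0, mul_nonneg q p2]

theorem energy_nonneg (Ω : Set Plane) (H : Fin 2 → Plane → ℂ) (ζ : Plane → ℂ) :
    0 ≤ energy Ω H ζ := by unfold energy; positivity

theorem IsStateDomain.exists_radius {D Ω : Set Plane} (h : IsStateDomain D Ω) :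
    ∃ R, 0 ≤ R ∧ ∀ x ∈ Ω, ‖x‖ ≤ R := by
  obtain ⟨R, hR⟩ := h.isBounded.exists_norm_le
  exact ⟨max R 0, le_max_right _ _, fun x hx => (hR x hx).trans (le_max_left _ _)⟩

theorem ae_eq_zero_of_integral_sq_le {X : Type*} [MeasurableSpace X] {μ : Measure X} {f : X → ℂ}
    (hf : MemLp f 2 μ) (h : ∫ x, ‖f x‖ ^ 2 ∂μ ≤ 0) : f =ᵐ[μ] 0 := by
  have h0 := le_antisymm h (by positivity)
  rw [integral_eq_zero_iff_of_nonneg (fun x => by positivity) (integrable_norm_sq hf)] at h0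
  filter_upwards [h0] with x hx
  simpa using hx

theorem integral_sub_mul_conj {X : Type*} [MeasurableSpace X] {μ : Measure X} {f g h : X → ℂ}
    (hf : MemLp f 2 μ) (hg : MemLp g 2 μ) (hh : MemLp h 2 μ) :
    ∫ x, (f x - g x) * conj (h x) ∂μ = ∫ x, f x * conj (h x) ∂μ - ∫ x, g x * conj (h x) ∂μ := by
  rw [← integral_sub (integrable_mul_conj hf hh) (integrable_mul_conj hg hh)]
  simp only [sub_mul]

theorem HasTrace.energyForm_sub {D Ω : Set Plane} (h : frontier D ⊆ frontier Ω) (α ρ : ℝ)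
    {u v w : Plane → ℂ} {G H K : Fin 2 → Plane → ℂ} {η ζ ξ : Plane → ℂ} (hu : HasTrace Ω u G η)
    (hv : HasTrace Ω v H ζ) (hw : HasTrace Ω w K ξ) :
    energyForm D α ρ Ω (fun i x => G i x - H i x) (fun x => η x - ζ x) K ξ =
      energyForm D α ρ Ω G η K ξ - energyForm D α ρ Ω H ζ K ξ := by
  have b : ∀ S ⊆ frontier Ω, boundaryForm S (fun x => η x - ζ x) ξ =
      boundaryForm S η ξ - boundaryForm S ζ ξ := fun S hS =>
    integral_sub_mul_conj (hu.memLp_trace.mono_measure (arcLength_mono hS))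
      (hv.memLp_trace.mono_measure (arcLength_mono hS))
      (hw.memLp_trace.mono_measure (arcLength_mono hS))
  have d : dirichletForm Ω (fun i x => G i x - H i x) K = dirichletForm Ω G K - dirichletForm Ω H K := by
    simp only [dirichletForm, ← Finset.sum_sub_distrib]
    exact Finset.sum_congr rfl fun i _ => integral_sub_mul_conj (hu.isH1.memLp_grad i)
      (hv.isH1.memLp_grad i) (hw.isH1.memLp_grad i)
  rw [energyForm, b _ h, b _ sdiff_subset, d]
  simp only [energyForm]
  ring

/-- Uniqueness of the state. -/
theorem IsState.unique {D Ω : Set Plane} (hd : IsStateDomain D Ω) {α ρ : ℝ} (hα : 0 < α)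
    (hρ : 0 < ρ) {f g : Plane → ℝ} {u v : Plane → ℂ} (hu : IsState D α ρ f g Ω u)
    (hv : IsState D α ρ f g Ω v) : u =ᵐ[volume.restrict Ω] v := by
  obtain ⟨G, η, hG, eu⟩ := hu
  obtain ⟨H, ζ, hH, ev⟩ := hv
  have hs := hG.sub hH
  obtain ⟨R, hR0, hR⟩ := hd.exists_radius
  have h0 : energyForm D α ρ Ω (fun i x => G i x - H i x) (fun x => η x - ζ x)
      (fun i x => G i x - H i x) (fun x => η x - ζ x) = 0 := by
    rw [hG.energyForm_sub hd.subset α ρ hH hs]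
    exact sub_eq_zero.2 ((eu _ _ _ hs).trans (ev _ _ _ hs).symm)
  have h1 := energy_le_norm_energyForm hd.subset α ρ (fun i x => G i x - H i x) hs.memLp_trace
  rw [h0, norm_zero] at h1
  have hκ : 0 < min 1 (min α ρ) / 2 := by positivity
  have h2 : energy Ω (fun i x => G i x - H i x) (fun x => η x - ζ x) ≤ 0 := by
    by_contra! hc
    exact absurd (mul_pos hκ hc) (not_lt.2 h1)
  have h3 := hs.integral_sq_le hd.isOpen hR0 hR
  have h4 : ∫ x in Ω, ‖u x - v x‖ ^ 2 ≤ 0 :=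
    h3.trans (mul_nonpos_of_nonneg_of_nonpos (by positivity) h2)
  filter_upwards [ae_eq_zero_of_integral_sq_le hs.isH1.memLp h4] with x hx
  exact sub_eq_zero.1 hx

/-! ### Existence of the state -/

/-- The Lax–Milgram lemma for operators on a complex Hilbert space. -/
theorem surjective_of_coercive {E : Type*} [NormedAddCommGroup E] [InnerProductSpace ℂ E]
    [CompleteSpace E] (A : E →L[ℂ] E) {c : ℝ} (hc : 0 < c)
    (h : ∀ x, c * ‖x‖ ^ 2 ≤ ‖inner ℂ x (A x)‖) : Function.Surjective A := by
  have hanti : ∀ x, ‖x‖ ≤ c⁻¹ * ‖A x‖ := fun x => by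
    rw [← div_eq_inv_mul, le_div_iff₀ hc]
    rcases eq_or_ne x 0 with rfl | hx
    · simp
    · have := (h x).trans (norm_inner_le_norm x (A x))
      have hx' : 0 < ‖x‖ := norm_pos_iff.2 hx
      refine le_of_mul_le_mul_left ?_ hx'
      linarith
  have hcl : IsClosed (LinearMap.range (A : E →ₗ[ℂ] E) : Set E) := by
    have : AntilipschitzWith (Real.toNNReal c⁻¹) A :=
      A.antilipschitz_of_bound fun x => by
        rw [Real.coe_toNNReal _ (by positivity)]; exact hanti x
    rw [LinearMap.coe_range]
    exact this.isClosed_range A.uniformContinuous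
  have hcomp : CompleteSpace (LinearMap.range (A : E →ₗ[ℂ] E)) := hcl.completeSpace_coe
  have htop : LinearMap.range (A : E →ₗ[ℂ] E) = ⊤ := by
    rw [← Submodule.orthogonal_eq_bot_iff, Submodule.eq_bot_iff]
    intro x hx
    have h0 : inner ℂ x (A x) = 0 :=
      Submodule.inner_left_of_mem_orthogonal (K := LinearMap.range (A : E →ₗ[ℂ] E)) ⟨x, rfl⟩ hx
    have := h x
    rw [h0, norm_zero] at this
    have h2 : ‖x‖ ^ 2 ≤ 0 := by
      by_contra! hn
      exact absurd (mul_pos hc hn) (not_lt.2 this)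
    exact norm_eq_zero.1 (pow_eq_zero_iff two_ne_zero |>.1 (le_antisymm h2 (by positivity)))
  exact LinearMap.range_eq_top.1 htop

/-- Solvability of coercive variational problems on a closed subspace. -/
theorem exists_variational_solution {E : Type*} [NormedAddCommGroup E] [InnerProductSpace ℂ E]
    [CompleteSpace E] (V : Submodule ℂ E) [CompleteSpace V] (M : E →L[ℂ] E) {c : ℝ} (hc : 0 < c)
    (h : ∀ x ∈ V, c * ‖x‖ ^ 2 ≤ ‖inner ℂ x (M x)‖) (l : E) :
    ∃ x ∈ V, ∀ y ∈ V, inner ℂ y (M x) = inner ℂ y l := by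
  have key : ∀ (y : V) (z : E), inner ℂ y (V.orthogonalProjectionOnto z) = inner ℂ (y : E) z := fun y z => by
    simp
  -- The compression of `M` to `V` inherits coercivity, and vectors of `V` do not see the orthogonal
  -- projection.
  obtain ⟨x, hx⟩ := surjective_of_coercive (V.orthogonalProjectionOnto ∘L M ∘L V.subtypeL) hc
    (fun x => by
      have := h x x.2
      simp only [ContinuousLinearMap.comp_apply, key]
      simpa using this) (V.orthogonalProjectionOnto l)
  refine ⟨x, x.2, fun y hy => ?_⟩
  have := congrArg (fun z => inner ℂ (⟨y, hy⟩ : V) z) hx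
  simp only [ContinuousLinearMap.comp_apply, key] at this
  simpa using this

/-- The measures carrying the components `(u, ∂₀u, ∂₁u, u|_Σ, u|_Γ)`. -/
noncomputable def jetMeasure (D Ω : Set Plane) : Fin 5 → Measure Plane :=
  ![volume.restrict Ω, volume.restrict Ω, volume.restrict Ω, arcLength (frontier D),
    arcLength (frontier Ω \ frontier D)]

/-- The components `(u, ∂₀u, ∂₁u, u|_Σ, u|_Γ)`. -/
def jet (u : Plane → ℂ) (G : Fin 2 → Plane → ℂ) (η : Plane → ℂ) : Fin 5 → Plane → ℂ :=
  ![u, G 0, G 1, η, η]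

theorem forall_fin_five {P : Fin 5 → Prop} : (∀ i, P i) ↔ P 0 ∧ P 1 ∧ P 2 ∧ P 3 ∧ P 4 := by
  simp [Fin.forall_fin_succ]

theorem HasTrace.memLp_jet {D Ω : Set Plane} (h : frontier D ⊆ frontier Ω) {u : Plane → ℂ}
    {G : Fin 2 → Plane → ℂ} {η : Plane → ℂ} (hu : HasTrace Ω u G η) (i : Fin 5) :
    MemLp (jet u G η i) 2 (jetMeasure D Ω i) := by
  revert i
  rw [forall_fin_five]
  exact ⟨hu.isH1.memLp, hu.isH1.memLp_grad 0, hu.isH1.memLp_grad 1,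
    hu.memLp_trace.mono_measure (arcLength_mono h),
    hu.memLp_trace.mono_measure (arcLength_mono sdiff_subset)⟩

/-- The Hilbert space of all quintuples of square integrable components. -/
abbrev JetSpace (D Ω : Set Plane) : Type :=
  PiLp 2 fun i : Fin 5 => Lp ℂ 2 (jetMeasure D Ω i)

theorem jet_add {φ ψ : Plane → ℂ} (hφ : ContDiff ℝ 1 φ) (hψ : ContDiff ℝ 1 ψ) (i : Fin 5) :
    jet (φ + ψ) (fun j => partialDeriv j (φ + ψ)) (φ + ψ) i =
      jet φ (fun j => partialDeriv j φ) φ i + jet ψ (fun j => partialDeriv j ψ) ψ i := by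
  have hd : ∀ j, partialDeriv j (φ + ψ) = partialDeriv j φ + partialDeriv j ψ := fun j => by
    funext x
    have := ((hφ.differentiable one_ne_zero x).hasFDerivAt).add
      ((hψ.differentiable one_ne_zero x).hasFDerivAt)
    rw [partialDeriv, this.fderiv]; rfl
  revert i
  rw [forall_fin_five]
  exact ⟨rfl, hd 0, hd 1, rfl, rfl⟩

theorem jet_smul {φ : Plane → ℂ} (hφ : ContDiff ℝ 1 φ) (c : ℂ) (i : Fin 5) :
    jet (c • φ) (fun j => partialDeriv j (c • φ)) (c • φ) i =
      c • jet φ (fun j => partialDeriv j φ) φ i := by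
  have hd : ∀ j, partialDeriv j (c • φ) = c • partialDeriv j φ := fun j => by
    funext x
    have := ((hφ.differentiable one_ne_zero x).hasFDerivAt).const_smul c
    rw [partialDeriv, this.fderiv]; rfl
  revert i
  rw [forall_fin_five]
  exact ⟨rfl, hd 0, hd 1, rfl, rfl⟩

/-- The space of jets of `C¹` functions. -/
noncomputable def smoothJets (D Ω : Set Plane) : Submodule ℂ (JetSpace D Ω) where
  carrier := {x | ∃ φ : Plane → ℂ, ContDiff ℝ 1 φ ∧
    ∀ i, x i =ᵐ[jetMeasure D Ω i] jet φ (fun j => partialDeriv j φ) φ i}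
  zero_mem' := ⟨0, contDiff_const, fun i => by
    have h0 : jet (0 : Plane → ℂ) (fun j => partialDeriv j (0 : Plane → ℂ)) 0 i = 0 := by
      have := jet_smul (φ := 0) contDiff_const 0 i
      simpa using this
    rw [h0]
    exact Lp.coeFn_zero _ _ _⟩
  add_mem' := by
    rintro x y ⟨φ, hφ, hx⟩ ⟨ψ, hψ, hy⟩
    refine ⟨φ + ψ, hφ.add hψ, fun i => ?_⟩
    rw [jet_add hφ hψ]
    exact (Lp.coeFn_add _ _).trans ((hx i).add (hy i))
  smul_mem' := by
    rintro c x ⟨φ, hφ, hx⟩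
    refine ⟨c • φ, hφ.const_smul c, fun i => ?_⟩
    rw [jet_smul hφ]
    exact (Lp.coeFn_smul _ _).trans ((hx i).const_smul c)

open Classical in
/-- The boundary values of a jet. -/
noncomputable def jetTrace {D Ω : Set Plane} (x : JetSpace D Ω) : Plane → ℂ :=
  (frontier D).piecewise (x 3) (x 4)

/-- The gradient of a jet. -/
noncomputable def jetGrad {D Ω : Set Plane} (x : JetSpace D Ω) : Fin 2 → Plane → ℂ :=
  ![x 1, x 2]

theorem jetTrace_ae_eq {D Ω : Set Plane} (x : JetSpace D Ω) :
    jetTrace x =ᵐ[jetMeasure D Ω 3] x 3 ∧ jetTrace x =ᵐ[jetMeasure D Ω 4] x 4 := by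
  classical
  have hc : ∀ U : Set Plane, MeasurableSet (frontier U) := fun U =>
    isClosed_frontier.measurableSet
  constructor
  · have : ∀ᵐ y ∂(arcLength (frontier D)), y ∈ frontier D :=
      ae_restrict_mem isClosed_frontier.measurableSet
    exact this.mono fun y hy => piecewise_eq_of_mem _ _ _ hy
  · have : ∀ᵐ y ∂(arcLength (frontier Ω \ frontier D)), y ∈ frontier Ω \ frontier D :=
      ae_restrict_mem ((hc Ω).diff (hc D))
    exact this.mono fun y hy => piecewise_eq_of_notMem _ _ _ hy.2

theorem eLpNorm_arcLength_le {S T : Set Plane} (hS : MeasurableSet S) (h : S ⊆ T) {f : Plane → ℂ}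
    (hf : AEStronglyMeasurable f (arcLength T)) :
    eLpNorm f 2 (arcLength T) ≤ eLpNorm f 2 (arcLength S) + eLpNorm f 2 (arcLength (T \ S)) := by
  have e1 : (arcLength T).restrict S = arcLength S := by
    rw [arcLength, Measure.restrict_restrict hS, inter_eq_self_of_subset_left h]; rfl
  have e2 : (arcLength T).restrict Sᶜ = arcLength (T \ S) := by
    rw [arcLength, Measure.restrict_restrict hS.compl, inter_comm, ← sdiff_eq]; rfl
  rw [← e1, ← e2, ← eLpNorm_indicator_eq_eLpNorm_restrict hS,
    ← eLpNorm_indicator_eq_eLpNorm_restrict hS.compl]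
  refine le_trans (le_of_eq ?_) (eLpNorm_add_le (hf.indicator hS) (hf.indicator hS.compl) (by norm_num))
  rw [indicator_self_add_compl]

theorem aestronglyMeasurable_arcLength {S T : Set Plane} (hS : MeasurableSet S) (h : S ⊆ T)
    {f : Plane → ℂ} (h1 : AEStronglyMeasurable f (arcLength S))
    (h2 : AEStronglyMeasurable f (arcLength (T \ S))) : AEStronglyMeasurable f (arcLength T) := by
  rw [arcLength_eq_add hS h]
  exact h1.add_measure h2

theorem eLpNorm_coe_sub {X : Type*} [MeasurableSpace X] {μ : Measure X} (a b : Lp ℂ 2 μ) :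
    eLpNorm (fun y => a y - b y) 2 μ = ‖a - b‖ₑ := by
  rw [Lp.enorm_def]
  exact eLpNorm_congr_ae (Lp.coeFn_sub a b).symm

/-- Limits of jets of `C¹` functions are Sobolev functions together with their traces. -/
theorem hasTrace_of_mem_closure {D Ω : Set Plane} (hd : IsStateDomain D Ω) {x : JetSpace D Ω}
    (hx : x ∈ (smoothJets D Ω).topologicalClosure) :
    HasTrace Ω (x 0) (jetGrad x) (jetTrace x) := by
  have hSm : MeasurableSet (frontier D) := isClosed_frontier.measurableSet
  obtain ⟨X, hX, hlim⟩ := mem_closure_iff_seq_limit.1 (show x ∈ closure (smoothJets D Ω : Set _) from hx)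
  choose φ hφ hae using hX
  have hco : ∀ i, Tendsto (fun n => eLpNorm
      (fun y => jet (φ n) (fun j => partialDeriv j (φ n)) (φ n) i y - x i y) 2 (jetMeasure D Ω i))
      atTop (𝓝 0) := fun i => by
    have h1 : Tendsto (fun n => ‖X n i - x i‖ₑ) atTop (𝓝 0) := by
      have hc : Tendsto (fun n => X n i) atTop (𝓝 (x i)) :=
        ((PiLp.continuous_apply 2 (fun i : Fin 5 => Lp ℂ 2 (jetMeasure D Ω i)) i).tendsto x).comp hlim
      have := (hc.sub_const (x i)).enorm
      simpa using this
    refine h1.congr fun n => ?_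
    rw [← eLpNorm_coe_sub]
    exact eLpNorm_congr_ae ((hae n i).mono fun y hy => by simp only [hy])
  obtain ⟨t3, t4⟩ := jetTrace_ae_eq x
  have m3 : MemLp (jetTrace x) 2 (arcLength (frontier D)) := (memLp_congr_ae t3).2 (Lp.memLp (x 3))
  have m4 : MemLp (jetTrace x) 2 (arcLength (frontier Ω \ frontier D)) :=
    (memLp_congr_ae t4).2 (Lp.memLp (x 4))
  have hm := aestronglyMeasurable_arcLength hSm hd.subset m3.1 m4.1
  refine hasTrace_of_approx (φ := φ) (Lp.memLp (x 0)) ?_ ⟨hm, ?_⟩ hφ (hco 0) ?_ ?_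
  · rw [Fin.forall_fin_two]; exact ⟨Lp.memLp (x 1), Lp.memLp (x 2)⟩
  · exact (eLpNorm_arcLength_le hSm hd.subset hm).trans_lt (ENNReal.add_lt_top.2 ⟨m3.2, m4.2⟩)
  · rw [Fin.forall_fin_two]; exact ⟨hco 1, hco 2⟩
  · have h3 : Tendsto (fun n => eLpNorm (fun y => φ n y - jetTrace x y) 2 (arcLength (frontier D)))
        atTop (𝓝 0) := (hco 3).congr fun n => eLpNorm_congr_ae (t3.mono fun y hy => by
      simp only [hy]; rfl)
    have h4 : Tendsto (fun n => eLpNorm (fun y => φ n y - jetTrace x y) 2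
        (arcLength (frontier Ω \ frontier D))) atTop (𝓝 0) :=
      (hco 4).congr fun n => eLpNorm_congr_ae (t4.mono fun y hy => by simp only [hy]; rfl)
    refine tendsto_of_tendsto_of_tendsto_of_le_of_le tendsto_const_nhds
      (by simpa using h3.add h4) (fun _ => zero_le) fun n =>
        eLpNorm_arcLength_le hSm hd.subset ((hφ n).continuous.aestronglyMeasurable.sub hm)

/-- The jet of a Sobolev function with a trace. -/
noncomputable def HasTrace.toJet {D Ω : Set Plane} (h : frontier D ⊆ frontier Ω) {u : Plane → ℂ}
    {G : Fin 2 → Plane → ℂ} {η : Plane → ℂ} (hu : HasTrace Ω u G η) : JetSpace D Ω :=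
  WithLp.toLp 2 fun i => (hu.memLp_jet h i).toLp _

/-- With `hasTrace_of_mem_closure` this identifies the closed space of jets with the admissible test
functions, so solving on the closure tests against all of `H¹` as encoded by `HasTrace`. -/
theorem HasTrace.toJet_mem {D Ω : Set Plane} (hd : IsStateDomain D Ω) {u : Plane → ℂ}
    {G : Fin 2 → Plane → ℂ} {η : Plane → ℂ} (hu : HasTrace Ω u G η) :
    hu.toJet hd.subset ∈ (smoothJets D Ω).topologicalClosure := by
  obtain ⟨φ, hφ, a0, a1, a2⟩ := hu.approx
  have hφt := fun n => hasTrace_of_contDiff hd.isBounded hd.isOpen hd.finite (hφ n)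
  refine mem_closure_of_tendsto (f := fun n => (hφt n).toJet hd.subset) (b := atTop) ?_
    (Eventually.of_forall fun n => ⟨φ n, hφ n, fun i => ((hφt n).memLp_jet hd.subset i).coeFn_toLp⟩)
  refine ((PiLp.continuous_toLp 2 _).tendsto _).comp (tendsto_pi_nhds.2 ?_)
  have hmono : ∀ S ⊆ frontier Ω, Tendsto (fun n => eLpNorm (fun y => φ n y - η y) 2 (arcLength S))
      atTop (𝓝 0) := fun S hS =>
    tendsto_of_tendsto_of_tendsto_of_le_of_le tendsto_const_nhds a2 (fun _ => zero_le)
      fun n => eLpNorm_mono_measure _ (arcLength_mono hS)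
  have hall : ∀ i, Tendsto (fun n => eLpNorm
      (jet (φ n) (fun j => partialDeriv j (φ n)) (φ n) i - jet u G η i) 2 (jetMeasure D Ω i))
      atTop (𝓝 0) := by
    rw [forall_fin_five]
    exact ⟨a0, a1 0, a1 1, hmono _ hd.subset, hmono _ sdiff_subset⟩
  intro i
  exact (Lp.tendsto_Lp_iff_tendsto_eLpNorm'' _ (fun n => (hφt n).memLp_jet hd.subset i) _
    (hu.memLp_jet hd.subset i)).2 (hall i)

/-- The coefficients of the sesquilinear form. -/
noncomputable def formCoeff (α ρ : ℝ) : Fin 5 → ℂ := ![0, 1, 1, Complex.I * ρ, α]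

/-- The diagonal operator representing the sesquilinear form. -/
noncomputable def formOperator (D : Set Plane) (α ρ : ℝ) (Ω : Set Plane) :
    JetSpace D Ω →L[ℂ] JetSpace D Ω :=
  (PiLp.continuousLinearEquiv 2 ℂ _).symm.toContinuousLinearMap ∘L
    (ContinuousLinearMap.pi fun i => formCoeff α ρ i • ContinuousLinearMap.proj i) ∘L
      (PiLp.continuousLinearEquiv 2 ℂ _).toContinuousLinearMap

theorem inner_Lp_eq {X : Type*} [MeasurableSpace X] {μ : Measure X} (a b : Lp ℂ 2 μ) :
    inner ℂ a b = ∫ x, b x * conj (a x) ∂μ := by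
  rw [L2.inner_def]; rfl

/-- The inner product is conjugate linear in its first argument, so the test jet stands first. The
form is diagonal in the five components, with coefficient `0` on the function itself. -/
theorem inner_formOperator {D Ω : Set Plane} (α ρ : ℝ) (x y : JetSpace D Ω) :
    inner ℂ y (formOperator D α ρ Ω x) =
      energyForm D α ρ Ω (jetGrad x) (jetTrace x) (jetGrad y) (jetTrace y) := by
  have h3 : ∫ z, x 3 z * conj (y 3 z) ∂(jetMeasure D Ω 3) =
      boundaryForm (frontier D) (jetTrace x) (jetTrace y) :=
    integral_congr_ae (by
      filter_upwards [(jetTrace_ae_eq x).1, (jetTrace_ae_eq y).1] with z hx hy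
      rw [hx, hy])
  have h4 : ∫ z, x 4 z * conj (y 4 z) ∂(jetMeasure D Ω 4) =
      boundaryForm (frontier Ω \ frontier D) (jetTrace x) (jetTrace y) :=
    integral_congr_ae (by
      filter_upwards [(jetTrace_ae_eq x).2, (jetTrace_ae_eq y).2] with z hx hy
      rw [hx, hy])
  have hi : ∀ i, (formOperator D α ρ Ω x) i = formCoeff α ρ i • x i := fun i => rfl
  rw [PiLp.inner_apply]
  simp only [hi, inner_smul_right, Fin.sum_univ_five, inner_Lp_eq]
  rw [h3, h4, energyForm, dirichletForm, Fin.sum_univ_two]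
  simp only [formCoeff, jetGrad, Matrix.cons_val]
  have e0 : jetMeasure D Ω 1 = volume.restrict Ω := rfl
  have e1 : jetMeasure D Ω 2 = volume.restrict Ω := rfl
  simp only [e0, e1]
  ring

theorem norm_sq_jet {D Ω : Set Plane} (hd : IsStateDomain D Ω) {x : JetSpace D Ω}
    (hx : x ∈ (smoothJets D Ω).topologicalClosure) :
    ‖x‖ ^ 2 = (∫ y in Ω, ‖x 0 y‖ ^ 2) + energy Ω (jetGrad x) (jetTrace x) := by
  have hn : ∀ i, ‖x i‖ ^ 2 = ∫ y, ‖x i y‖ ^ 2 ∂(jetMeasure D Ω i) := fun i => by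
    have h1 := inner_Lp_eq (x i) (x i)
    rw [integral_mul_conj_self, inner_self_eq_norm_sq_to_K] at h1
    refine Complex.ofReal_injective ?_
    rw [← h1]
    push_cast
    rfl
  have h3 : ∫ y, ‖x 3 y‖ ^ 2 ∂(jetMeasure D Ω 3) = ∫ y, ‖jetTrace x y‖ ^ 2 ∂(arcLength (frontier D)) :=
    integral_congr_ae ((jetTrace_ae_eq x).1.mono fun y hy => by simp only [hy])
  have h4 : ∫ y, ‖x 4 y‖ ^ 2 ∂(jetMeasure D Ω 4) =
      ∫ y, ‖jetTrace x y‖ ^ 2 ∂(arcLength (frontier Ω \ frontier D)) :=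
    integral_congr_ae ((jetTrace_ae_eq x).2.mono fun y hy => by simp only [hy])
  rw [PiLp.norm_sq_eq_of_L2, Fin.sum_univ_five, energy_eq hd.subset _
    (hasTrace_of_mem_closure hd hx).memLp_trace]
  simp only [hn]
  rw [h3, h4]
  simp only [jetGrad, Matrix.cons_val]
  have e0 : jetMeasure D Ω 0 = volume.restrict Ω := rfl
  have e1 : jetMeasure D Ω 1 = volume.restrict Ω := rfl
  have e2 : jetMeasure D Ω 2 = volume.restrict Ω := rfl
  simp only [e0, e1, e2]
  ring

/-- Existence of the state. -/
theorem exists_isState {D Ω : Set Plane} (hd : IsStateDomain D Ω) {α ρ : ℝ} (hα : 0 < α)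
    (hρ : 0 < ρ) {f g : Plane → ℝ} (hf : MemLp f 2 (arcLength (frontier D)))
    (hg : MemLp g 2 (arcLength (frontier D))) : ∃ u, IsState D α ρ f g Ω u := by
  obtain ⟨R, hR0, hR⟩ := hd.exists_radius
  set V := (smoothJets D Ω).topologicalClosure with hV
  have hVc : CompleteSpace V := (Submodule.isClosed_topologicalClosure _).completeSpace_coe
  have hfc : MemLp (fun x => (f x : ℂ)) 2 (arcLength (frontier D)) := hf.ofReal
  have hgc : MemLp (fun x => (g x : ℂ)) 2 (arcLength (frontier D)) := hg.ofReal
  have hl : MemLp (fun x => (g x : ℂ) + Complex.I * ρ * f x) 2 (jetMeasure D Ω 3) :=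
    hgc.add (hfc.const_mul (Complex.I * ρ))
  -- The right-hand side acts only on the trace on `Σ`, so its representative `g + iρf` sits in
  -- component `3`.
  set l : JetSpace D Ω := WithLp.toLp 2 (Pi.single 3 (hl.toLp _)) with hldef
  -- The squared jet norm is the `L²` part plus the energy. The former is at most `4 * R + 8 * R ^
  -- 2` times the energy, and the added `1` accounts for the energy itself.
  set C := 4 * R + 8 * R ^ 2 + 1 with hC
  have hC0 : 0 < C := by positivity
  set κ := min 1 (min α ρ) / 2 with hκdef
  have hκ : 0 < κ := by positivity
  obtain ⟨x, hxV, hx⟩ := exists_variational_solution V (formOperator D α ρ Ω)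
    (c := κ / C) (by positivity) (fun x hx => by
      have ht := hasTrace_of_mem_closure hd hx
      rw [inner_formOperator, norm_sq_jet hd hx]
      refine le_trans ?_ (energy_le_norm_energyForm hd.subset α ρ _ ht.memLp_trace)
      have h1 := ht.integral_sq_le hd.isOpen hR0 hR
      rw [div_mul_eq_mul_div, div_le_iff₀ hC0, mul_assoc]
      refine mul_le_mul_of_nonneg_left ?_ hκ.le
      rw [hC]; linarith) l
  refine ⟨x 0, jetGrad x, jetTrace x, hasTrace_of_mem_closure hd hxV, fun v H ζ hv => ?_⟩
  have hy := hx _ (hv.toJet_mem hd)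
  have hae : ∀ i, (hv.toJet hd.subset) i =ᵐ[jetMeasure D Ω i] jet v H ζ i := fun i =>
    (hv.memLp_jet hd.subset i).coeFn_toLp
  have t3 : jetTrace (hv.toJet hd.subset) =ᵐ[arcLength (frontier D)] ζ :=
    (jetTrace_ae_eq _).1.trans (hae 3)
  have t4 : jetTrace (hv.toJet hd.subset) =ᵐ[arcLength (frontier Ω \ frontier D)] ζ :=
    (jetTrace_ae_eq _).2.trans (hae 4)
  rw [inner_formOperator] at hy
  have e1 : energyForm D α ρ Ω (jetGrad x) (jetTrace x) (jetGrad (hv.toJet hd.subset))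
      (jetTrace (hv.toJet hd.subset)) = energyForm D α ρ Ω (jetGrad x) (jetTrace x) H ζ := by
    have b3 : boundaryForm (frontier D) (jetTrace x) (jetTrace (hv.toJet hd.subset)) =
        boundaryForm (frontier D) (jetTrace x) ζ :=
      integral_congr_ae (t3.mono fun y hy => by simp only [hy])
    have b4 : boundaryForm (frontier Ω \ frontier D) (jetTrace x) (jetTrace (hv.toJet hd.subset)) =
        boundaryForm (frontier Ω \ frontier D) (jetTrace x) ζ :=
      integral_congr_ae (t4.mono fun y hy => by simp only [hy])
    have b0 : dirichletForm Ω (jetGrad x) (jetGrad (hv.toJet hd.subset)) =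
        dirichletForm Ω (jetGrad x) H := by
      refine Finset.sum_congr rfl fun i _ => integral_congr_ae ?_
      have : jetGrad (hv.toJet hd.subset) i =ᵐ[volume.restrict Ω] H i := by
        revert i
        simp only [Finset.mem_univ, forall_const]
        rw [Fin.forall_fin_two]
        exact ⟨hae 1, hae 2⟩
      exact this.mono fun y hy => by simp only [hy]
    rw [energyForm, energyForm, b0, b3, b4]
  have hζ : MemLp ζ 2 (arcLength (frontier D)) := hv.memLp_trace.mono_measure (arcLength_mono hd.subset)
  have e2 : inner ℂ (hv.toJet hd.subset) l = boundaryForm (frontier D) (fun x => (g x : ℂ)) ζ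
        + Complex.I * ρ * boundaryForm (frontier D) (fun x => (f x : ℂ)) ζ := by
    rw [PiLp.inner_apply, Finset.sum_eq_single (3 : Fin 5)]
    · have hl3 : l 3 = hl.toLp _ := by simp [hldef]
      rw [hl3, inner_Lp_eq, boundaryForm, boundaryForm, ← integral_const_mul, ← integral_add
        (integrable_mul_conj hgc hζ) ((integrable_mul_conj hfc hζ).const_mul _)]
      refine integral_congr_ae ?_
      have hae3 : (hv.toJet hd.subset) 3 =ᵐ[jetMeasure D Ω 3] ζ := hae 3
      filter_upwards [hae3, hl.coeFn_toLp] with y h1 h2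
      rw [h1, h2]; ring
    · intro i _ hi
      have : l i = 0 := by simp [hldef, hi]
      rw [this, inner_zero_right]
    · simp
  rw [e1, e2] at hy
  exact hy

/-! ### Comparable measures -/

/-- The measure `ν` and the image of the measure `μ` under `T` agree up to a factor `b`. -/
structure Comparable (T : Plane → Plane) (b : NNReal) (μ ν : Measure Plane) : Prop where
  measurable : Measurable T
  le : ν ≤ (b : ℝ≥0∞) • μ.map T
  ge : μ.map T ≤ (b : ℝ≥0∞) • ν

namespace Comparable

variable {T : Plane → Plane} {b : NNReal} {μ ν : Measure Plane}

theorem absolutelyContinuous (h : Comparable T b μ ν) : μ.map T ≪ ν :=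
  Measure.absolutelyContinuous_of_le_smul h.ge

theorem ae_of_comp (h : Comparable T b μ ν) {p : Plane → Prop} (hp : ∀ᵐ x ∂(μ.map T), p x) :
    ∀ᵐ y ∂ν, p y :=
  (Measure.absolutelyContinuous_of_le_smul h.le).ae_le hp

theorem aestronglyMeasurable (h : Comparable T b μ ν) {f : Plane → ℂ}
    (hf : AEStronglyMeasurable f ν) : AEStronglyMeasurable (fun x => f (T x)) μ :=
  (hf.mono_ac h.absolutelyContinuous).comp_measurable h.measurable

theorem eLpNorm_le (h : Comparable T b μ ν) {f : Plane → ℂ} (hf : AEStronglyMeasurable f ν) :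
    eLpNorm (fun x => f (T x)) 2 μ ≤ (b : ℝ≥0∞) ^ (1 / 2 : ℝ) * eLpNorm f 2 ν := by
  have h1 := eLpNorm_map_measure (p := 2) (hf.mono_ac h.absolutelyContinuous) h.measurable.aemeasurable
  rw [show (fun x => f (T x)) = f ∘ T from rfl, ← h1]
  refine (eLpNorm_mono_measure f h.ge).trans (le_of_eq ?_)
  rw [eLpNorm_smul_measure_of_ne_top (by norm_num)]
  norm_num

theorem memLp (h : Comparable T b μ ν) {f : Plane → ℂ} (hf : MemLp f 2 ν) :
    MemLp (fun x => f (T x)) 2 μ :=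
  ⟨h.aestronglyMeasurable hf.1, (h.eLpNorm_le hf.1).trans_lt
    (ENNReal.mul_lt_top (ENNReal.rpow_lt_top_of_nonneg (by norm_num) ENNReal.coe_ne_top) hf.2)⟩

theorem tendsto_eLpNorm (h : Comparable T b μ ν) {f : ℕ → Plane → ℂ}
    (hf : ∀ n, AEStronglyMeasurable (f n) ν)
    (hl : Tendsto (fun n => eLpNorm (f n) 2 ν) atTop (𝓝 0)) :
    Tendsto (fun n => eLpNorm (fun x => f n (T x)) 2 μ) atTop (𝓝 0) := by
  have h1 := ENNReal.Tendsto.const_mul hl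
    (Or.inr (ENNReal.rpow_ne_top_of_nonneg (by norm_num : (0 : ℝ) ≤ 1 / 2) (ENNReal.coe_ne_top (r := b))))
  rw [mul_zero] at h1
  exact tendsto_of_tendsto_of_tendsto_of_le_of_le tendsto_const_nhds h1 (fun _ => zero_le)
    fun n => h.eLpNorm_le (hf n)

theorem integral_sq_le (h : Comparable T b μ ν) {f : Plane → ℂ} (hf : MemLp f 2 ν) :
    ∫ x, ‖f (T x)‖ ^ 2 ∂μ ≤ b * ∫ y, ‖f y‖ ^ 2 ∂ν := by
  have hm : AEStronglyMeasurable (fun y => ‖f y‖ ^ 2) (μ.map T) :=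
    (hf.1.mono_ac h.absolutelyContinuous).norm.pow 2
  have h1 := integral_map (μ := μ) h.measurable.aemeasurable hm
  have hi : Integrable (fun y => ‖f y‖ ^ 2) ((b : ℝ≥0∞) • ν) :=
    (integrable_norm_sq hf).smul_measure ENNReal.coe_ne_top
  have h2 := integral_mono_measure h.ge (Eventually.of_forall fun y => by positivity) hi
  rw [integral_smul_measure] at h2
  rw [← h1]
  simpa using h2

/-- Integrals with respect to measures that are comparable up to a factor close to `1` are
close to each other. -/
theorem norm_integral_sub_le (h : Comparable T b μ ν) (hb : 1 ≤ b) [IsFiniteMeasure μ]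
    {f : Plane → ℂ} (hf : Integrable f ν) :
    ‖∫ y, f y ∂ν - ∫ x, f (T x) ∂μ‖ ≤ 3 * (b - 1) * ∫ x, ‖f (T x)‖ ∂μ := by
  have hb0 : (b : ℝ≥0∞) ≠ 0 := by
    have : b ≠ 0 := (zero_lt_one.trans_le hb).ne'
    simpa using this
  set c : NNReal := b⁻¹ with hc
  set lam := μ.map T with hlam
  have hfin : IsFiniteMeasure lam := Measure.isFiniteMeasure_map μ T
  have hcle : (c : ℝ≥0∞) • lam ≤ ν := by
    have h1 : (c : ℝ≥0∞) • lam ≤ (c : ℝ≥0∞) • ((b : ℝ≥0∞) • ν) := by gcongr; exact h.ge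
    rw [smul_smul, hc, ENNReal.coe_inv (by simpa using hb0), ENNReal.inv_mul_cancel hb0
      ENNReal.coe_ne_top, one_smul] at h1
    rwa [hc, ENNReal.coe_inv (by simpa using hb0)]
  have hcf : IsFiniteMeasure ((c : ℝ≥0∞) • lam) := Measure.smul_finite lam ENNReal.coe_ne_top
  -- Since `ν` dominates `b⁻¹` times the image measure, it splits as that multiple plus a
  -- nonnegative remainder `κ`. The remainder contributes at most `(b - b⁻¹)` times the integral of
  -- `‖f‖`.
  set κ := ν - (c : ℝ≥0∞) • lam with hκ
  have hadd : κ + (c : ℝ≥0∞) • lam = ν := Measure.sub_add_cancel_of_le hcle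
  have hil : Integrable f lam :=
    (hf.smul_measure (c := (b : ℝ≥0∞)) ENNReal.coe_ne_top).mono_measure h.ge
  have hic : Integrable f ((c : ℝ≥0∞) • lam) := hil.smul_measure ENNReal.coe_ne_top
  have hik : Integrable f κ := hf.mono_measure Measure.sub_le
  have e1 : ∫ y, f y ∂ν = ∫ y, f y ∂κ + (c : ℝ) • ∫ y, f y ∂lam := by
    conv_lhs => rw [← hadd]
    rw [integral_add_measure hik hic, integral_smul_measure]; simp
  have e2 : ∫ y, ‖f y‖ ∂ν = ∫ y, ‖f y‖ ∂κ + (c : ℝ) * ∫ y, ‖f y‖ ∂lam := by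
    conv_lhs => rw [← hadd]
    rw [integral_add_measure hik.norm hic.norm, integral_smul_measure]; simp
  have e3 : ∫ y, ‖f y‖ ∂ν ≤ b * ∫ y, ‖f y‖ ∂lam := by
    have := integral_mono_measure h.le (Eventually.of_forall fun y => norm_nonneg (f y))
      (hil.norm.smul_measure ENNReal.coe_ne_top)
    rw [integral_smul_measure] at this
    simpa using this
  have e4 : ∫ x, f (T x) ∂μ = ∫ y, f y ∂lam := (integral_map h.measurable.aemeasurable hil.1).symm
  have e5 : ∫ x, ‖f (T x)‖ ∂μ = ∫ y, ‖f y‖ ∂lam :=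
    (integral_map h.measurable.aemeasurable hil.1.norm).symm
  rw [e4, e5, e1]
  have hI : 0 ≤ ∫ y, ‖f y‖ ∂lam := by positivity
  have hc1 : (c : ℝ) ≤ 1 := by
    have : c ≤ 1 := inv_le_one_of_one_le₀ hb
    exact_mod_cast this
  have hbr : (1 : ℝ) ≤ b := by exact_mod_cast hb
  have hcb : 1 - (c : ℝ) ≤ b - 1 := by
    rw [hc, NNReal.coe_inv]
    have hb' : (0 : ℝ) < b := by linarith
    have : (b : ℝ) * (b : ℝ)⁻¹ = 1 := mul_inv_cancel₀ hb'.ne'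
    nlinarith [sq_nonneg ((b : ℝ) - 1), inv_pos.2 hb']
  calc ‖∫ y, f y ∂κ + (c : ℝ) • ∫ y, f y ∂lam - ∫ y, f y ∂lam‖
      = ‖∫ y, f y ∂κ - (1 - (c : ℝ)) • ∫ y, f y ∂lam‖ := by
        congr 1; rw [sub_smul, one_smul]; ring
    _ ≤ ‖∫ y, f y ∂κ‖ + ‖(1 - (c : ℝ)) • ∫ y, f y ∂lam‖ := norm_sub_le _ _
    _ ≤ ∫ y, ‖f y‖ ∂κ + (1 - c) * ∫ y, ‖f y‖ ∂lam := by
        rw [norm_smul, Real.norm_of_nonneg (by linarith : 0 ≤ 1 - (c : ℝ))]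
        gcongr
        · exact norm_integral_le_integral_norm _
        · exact norm_integral_le_integral_norm _
    -- Here `b - c + (1 - c) = (b - 1) + 2 * (1 - c)`, and `1 - b⁻¹ ≤ b - 1`; this is the origin of
    -- the factor `3`.
    _ ≤ (b - c + (1 - c)) * ∫ y, ‖f y‖ ∂lam := by nlinarith
    _ ≤ _ := by
        refine mul_le_mul_of_nonneg_right ?_ hI
        linarith

end Comparable

/-! ### Transformations close to the identity -/

/-- `T` and `S` are mutually inverse `C¹` transformations of the plane, close to the identity. -/
structure IsNearIdentity (T S : Plane → Plane) (L ε : NNReal) : Prop where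
  left_inv : ∀ x, S (T x) = x
  right_inv : ∀ y, T (S y) = y
  contDiff : ContDiff ℝ 1 T
  contDiff_inv : ContDiff ℝ 1 S
  lipschitz : LipschitzWith L T
  lipschitz_inv : LipschitzWith L S
  near : LipschitzWith ε fun x => T x - x
  near_inv : LipschitzWith ε fun y => S y - y
  one_le : 1 ≤ L

namespace IsNearIdentity

variable {T S : Plane → Plane} {L ε : NNReal}

theorem symm (h : IsNearIdentity T S L ε) : IsNearIdentity S T L ε :=
  ⟨h.right_inv, h.left_inv, h.contDiff_inv, h.contDiff, h.lipschitz_inv, h.lipschitz, h.near_inv,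
    h.near, h.one_le⟩

/-- The transformation as a homeomorphism. -/
def toHomeomorph (h : IsNearIdentity T S L ε) : Plane ≃ₜ Plane where
  toFun := T
  invFun := S
  left_inv := h.left_inv
  right_inv := h.right_inv
  continuous_toFun := h.contDiff.continuous
  continuous_invFun := h.contDiff_inv.continuous

theorem image_image (h : IsNearIdentity T S L ε) (A : Set Plane) : S '' (T '' A) = A := by
  rw [← image_comp, show S ∘ T = id from funext h.left_inv, image_id]

theorem frontier_image (h : IsNearIdentity T S L ε) (A : Set Plane) :
    frontier (T '' A) = T '' frontier A := (h.toHomeomorph.image_frontier A).symm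

theorem isOpen_image (h : IsNearIdentity T S L ε) {A : Set Plane} (hA : IsOpen A) :
    IsOpen (T '' A) := h.toHomeomorph.isOpenMap A hA

/-- The Lipschitz bound for the inverse `S` on `T '' A`, pushed forward by `T`. -/
theorem hausdorff_map_le (h : IsNearIdentity T S L ε) (A : Set Plane) {d : ℝ} (hd : 0 ≤ d) :
    ((Measure.hausdorffMeasure d).restrict A).map T ≤
      ((L : ℝ≥0∞) ^ d) • (Measure.hausdorffMeasure d).restrict (T '' A) := by
  have h1 := restrict_hausdorffMeasure_image_le (h.lipschitz_inv.lipschitzOnWith (s := T '' A))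
    h.contDiff_inv.continuous.measurable hd
  rw [h.image_image] at h1
  refine (Measure.map_mono h1 h.contDiff.continuous.measurable).trans (le_of_eq ?_)
  rw [Measure.map_smul, Measure.map_map h.contDiff.continuous.measurable
    h.contDiff_inv.continuous.measurable]
  have : T ∘ S = id := funext h.right_inv
  rw [this, Measure.map_id]

/-- The factor `L` would do for lengths; `L ^ 2` is taken so that lengths and areas share one
constant, which is possible as `1 ≤ L`. -/
theorem comparable_arcLength (h : IsNearIdentity T S L ε) (A : Set Plane) :
    Comparable T (L ^ 2) (arcLength A) (arcLength (T '' A)) := by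
  have hL : ((L : ℝ≥0∞) ^ (1 : ℝ)) ≤ ((L ^ 2 : NNReal) : ℝ≥0∞) := by
    rw [ENNReal.rpow_one, ENNReal.coe_le_coe]
    exact le_self_pow₀ h.one_le two_ne_zero
  have hs : ∀ m : Measure Plane, ((L : ℝ≥0∞) ^ (1 : ℝ)) • m ≤ ((L ^ 2 : NNReal) : ℝ≥0∞) • m :=
    fun m => Measure.le_iff.2 fun s _ => by
      simp only [Measure.smul_apply, smul_eq_mul]; gcongr
  exact ⟨h.contDiff.continuous.measurable,
    (restrict_hausdorffMeasure_image_le (h.lipschitz.lipschitzOnWith (s := A))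
      h.contDiff.continuous.measurable zero_le_one).trans (hs _),
    (h.hausdorff_map_le A zero_le_one).trans (hs _)⟩

/-- Area is a multiple of two-dimensional Hausdorff measure, so Lipschitz bounds for `T` and `S`
replace the change of variables formula. -/
theorem comparable_volume (h : IsNearIdentity T S L ε) (A : Set Plane) :
    Comparable T (L ^ 2) (volume.restrict A) (volume.restrict (T '' A)) := by
  obtain ⟨c, hc⟩ := exists_volume_eq_smul_hausdorffMeasure
  have hL : ((L ^ 2 : NNReal) : ℝ≥0∞) = (L : ℝ≥0∞) ^ (2 : ℝ) := by
    rw [ENNReal.coe_pow]; norm_cast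
  have e : ∀ B : Set Plane, volume.restrict B =
      (c : ℝ≥0∞) • (Measure.hausdorffMeasure 2).restrict B := fun B => by
    rw [hc, Measure.restrict_smul]; rfl
  refine ⟨h.contDiff.continuous.measurable, ?_, ?_⟩
  · rw [e, e, Measure.map_smul, smul_comm, hL]
    gcongr
    exact restrict_hausdorffMeasure_image_le (h.lipschitz.lipschitzOnWith (s := A))
      h.contDiff.continuous.measurable zero_le_two
  · rw [e, e, Measure.map_smul, smul_comm, hL]
    gcongr
    exact h.hausdorff_map_le A zero_le_two

theorem norm_fderiv_le (h : IsNearIdentity T S L ε) (x : Plane) (i j : Fin 2) :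
    ‖(fderiv ℝ T x (EuclideanSpace.single i 1)) j‖ ≤ L := by
  have h1 := norm_fderiv_le_of_lipschitz ℝ h.lipschitz (x₀ := x)
  refine (PiLp.norm_apply_le _ j).trans (((fderiv ℝ T x).le_opNorm _).trans ?_)
  simpa using h1

theorem norm_fderiv_sub_le (h : IsNearIdentity T S L ε) (x : Plane) (i j : Fin 2) :
    ‖(fderiv ℝ T x (EuclideanSpace.single i 1)) j - (EuclideanSpace.single i (1 : ℝ) : Plane) j‖ ≤ ε := by
  have h1 := norm_fderiv_le_of_lipschitz ℝ h.near (x₀ := x)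
  have h2 : fderiv ℝ (fun x => T x - x) x = fderiv ℝ T x - ContinuousLinearMap.id ℝ Plane :=
    ((h.contDiff.differentiable one_ne_zero x).hasFDerivAt.sub (hasFDerivAt_id x)).fderiv
  rw [h2] at h1
  have h3 := (PiLp.norm_apply_le ((fderiv ℝ T x - ContinuousLinearMap.id ℝ Plane)
    (EuclideanSpace.single i 1)) j).trans ((ContinuousLinearMap.le_opNorm _ _))
  simp only [PiLp.norm_single, norm_one, mul_one] at h3
  exact h3.trans h1

end IsNearIdentity

/-! ### Pull-back of Sobolev functions -/

/-- The gradient of the pull-back under `T` of a function with gradient `H`. -/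
noncomputable def pullGrad (T : Plane → Plane) (H : Fin 2 → Plane → ℂ) (i : Fin 2) (x : Plane) : ℂ :=
  ((fderiv ℝ T x (EuclideanSpace.single i 1)) 0 : ℂ) * H 0 (T x) +
    ((fderiv ℝ T x (EuclideanSpace.single i 1)) 1 : ℂ) * H 1 (T x)

theorem clm_apply_eq (A : Plane →L[ℝ] ℂ) (v : Plane) :
    A v = (v 0 : ℂ) * A (EuclideanSpace.single 0 1) + (v 1 : ℂ) * A (EuclideanSpace.single 1 1) := by
  have hv : v = v 0 • EuclideanSpace.single 0 1 + v 1 • EuclideanSpace.single 1 1 := by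
    ext i; fin_cases i <;> simp
  conv_lhs => rw [hv]
  rw [map_add, map_smul, map_smul]; rfl

theorem partialDeriv_comp {T : Plane → Plane} (hT : ContDiff ℝ 1 T) {φ : Plane → ℂ}
    (hφ : ContDiff ℝ 1 φ) (i : Fin 2) (x : Plane) :
    partialDeriv i (fun x => φ (T x)) x = pullGrad T (fun j => partialDeriv j φ) i x := by
  have := (hφ.differentiable one_ne_zero (T x)).hasFDerivAt.comp x
    (hT.differentiable one_ne_zero x).hasFDerivAt
  rw [partialDeriv, show (fun x => φ (T x)) = φ ∘ T from rfl, this.fderiv]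
  exact clm_apply_eq (fderiv ℝ φ (T x)) (fderiv ℝ T x (EuclideanSpace.single i 1))

theorem continuous_fderiv_coord {T : Plane → Plane} (hT : ContDiff ℝ 1 T) (i j : Fin 2) :
    Continuous fun x => ((fderiv ℝ T x (EuclideanSpace.single i 1)) j : ℂ) := by
  have h1 : Continuous fun x => fderiv ℝ T x (EuclideanSpace.single i 1) :=
    (hT.continuous_fderiv one_ne_zero).clm_apply continuous_const
  have h2 : Continuous fun v : Plane => v j := by fun_prop
  exact Complex.continuous_ofReal.comp (h2.comp h1)

theorem eLpNorm_coef_mul_le {μ : Measure Plane} {c f : Plane → ℂ} {L : NNReal}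
    (hc : ∀ x, ‖c x‖ ≤ L) : eLpNorm (fun x => c x * f x) 2 μ ≤ L * eLpNorm f 2 μ := by
  have := eLpNorm_le_mul_eLpNorm_of_ae_le_mul (f := fun x => c x * f x) (g := f) (c := (L : ℝ))
    (μ := μ) (Eventually.of_forall fun x => by
      rw [norm_mul]; exact mul_le_mul_of_nonneg_right (hc x) (norm_nonneg _)) 2
  simpa using this

theorem IsNearIdentity.norm_coef_le {T S : Plane → Plane} {L ε : NNReal} (h : IsNearIdentity T S L ε)
    (i j : Fin 2) (x : Plane) :
    ‖((fderiv ℝ T x (EuclideanSpace.single i 1)) j : ℂ)‖ ≤ L := by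
  rw [Complex.norm_real]; exact h.norm_fderiv_le x i j

theorem IsNearIdentity.memLp_pullGrad {T S : Plane → Plane} {L ε : NNReal}
    (h : IsNearIdentity T S L ε) {Ω : Set Plane} {H : Fin 2 → Plane → ℂ}
    (hH : ∀ i, MemLp (H i) 2 (volume.restrict (T '' Ω))) (i : Fin 2) :
    MemLp (pullGrad T H i) 2 (volume.restrict Ω) := by
  have hj : ∀ j, MemLp (fun x => ((fderiv ℝ T x (EuclideanSpace.single i 1)) j : ℂ) * H j (T x)) 2
      (volume.restrict Ω) := fun j => by
    have h1 := (h.comparable_volume Ω).memLp (hH j)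
    exact ⟨(continuous_fderiv_coord h.contDiff i j).aestronglyMeasurable.mul h1.1,
      (eLpNorm_coef_mul_le (h.norm_coef_le i j)).trans_lt (ENNReal.mul_lt_top ENNReal.coe_lt_top h1.2)⟩
  exact (hj 0).add (hj 1)

/-- Pull-back of a Sobolev function and its trace. -/
theorem HasTrace.pull {T S : Plane → Plane} {L ε : NNReal} (h : IsNearIdentity T S L ε)
    {Ω : Set Plane} {v : Plane → ℂ} {H : Fin 2 → Plane → ℂ} {ζ : Plane → ℂ}
    (hv : HasTrace (T '' Ω) v H ζ) :
    HasTrace Ω (fun x => v (T x)) (pullGrad T H) fun x => ζ (T x) := by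
  obtain ⟨φ, hφ, a0, a1, a2⟩ := hv.approx
  have hcv := h.comparable_volume Ω
  have hcb := h.comparable_arcLength (frontier Ω)
  rw [← h.frontier_image] at hcb
  refine hasTrace_of_approx (φ := fun n x => φ n (T x)) (hcv.memLp hv.isH1.memLp)
    (h.memLp_pullGrad hv.isH1.memLp_grad) (hcb.memLp hv.memLp_trace)
    (fun n => (hφ n).comp h.contDiff) ?_ (fun i => ?_) ?_
  · exact hcv.tendsto_eLpNorm (f := fun n y => φ n y - v y)
      (fun n => (hφ n).continuous.aestronglyMeasurable.sub hv.isH1.memLp.1) a0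
  · have hm : ∀ n j, AEStronglyMeasurable (fun y => partialDeriv j (φ n) y - H j y)
        (volume.restrict (T '' Ω)) := fun n j =>
      (continuous_partialDeriv (hφ n) j).aestronglyMeasurable.sub (hv.isH1.memLp_grad j).1
    have hj : ∀ j, Tendsto (fun n => (L : ℝ≥0∞) *
        eLpNorm (fun x => partialDeriv j (φ n) (T x) - H j (T x)) 2 (volume.restrict Ω)) atTop (𝓝 0) :=
      fun j => by
        have := ENNReal.Tendsto.const_mul (hcv.tendsto_eLpNorm
          (f := fun n y => partialDeriv j (φ n) y - H j y) (fun n => hm n j) (a1 j))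
          (Or.inr (ENNReal.coe_ne_top (r := L)))
        rwa [mul_zero] at this
    refine tendsto_of_tendsto_of_tendsto_of_le_of_le tendsto_const_nhds
      (by simpa using (hj 0).add (hj 1)) (fun _ => zero_le) fun n => ?_
    have hk : ∀ j, AEStronglyMeasurable (fun x =>
        ((fderiv ℝ T x (EuclideanSpace.single i 1)) j : ℂ) *
          (partialDeriv j (φ n) (T x) - H j (T x))) (volume.restrict Ω) := fun j =>
      (continuous_fderiv_coord h.contDiff i j).aestronglyMeasurable.mul
        (hcv.aestronglyMeasurable (hm n j))
    refine le_trans (le_of_eq ?_) ((eLpNorm_add_le (hk 0) (hk 1) (by norm_num)).trans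
      (add_le_add (eLpNorm_coef_mul_le (h.norm_coef_le i 0)) (eLpNorm_coef_mul_le (h.norm_coef_le i 1))))
    congr 1
    funext x
    rw [partialDeriv_comp h.contDiff (hφ n)]
    simp only [pullGrad, Pi.add_apply]
    ring
  · exact hcb.tendsto_eLpNorm (f := fun n y => φ n y - ζ y)
      (fun n => (hφ n).continuous.aestronglyMeasurable.sub hv.memLp_trace.1) a2

/-- Pull-back along the inverse, from `S '' (T '' Ω) = Ω`. -/
theorem HasTrace.push {T S : Plane → Plane} {L ε : NNReal} (h : IsNearIdentity T S L ε)
    {Ω : Set Plane} {u : Plane → ℂ} {G : Fin 2 → Plane → ℂ} {η : Plane → ℂ}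
    (hu : HasTrace Ω u G η) :
    HasTrace (T '' Ω) (fun y => u (S y)) (pullGrad S G) fun y => η (S y) := by
  have hu' : HasTrace (S '' (T '' Ω)) u G η := by rwa [h.image_image]
  exact hu'.pull h.symm

theorem IsNearIdentity.norm_pullGrad_sub_le {T S : Plane → Plane} {L ε : NNReal}
    (h : IsNearIdentity T S L ε) (H : Fin 2 → Plane → ℂ) (i : Fin 2) (x : Plane) :
    ‖pullGrad T H i x - H i (T x)‖ ≤ ε * (‖H 0 (T x)‖ + ‖H 1 (T x)‖) := by
  have h0 := h.norm_fderiv_sub_le x i 0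
  have h1 := h.norm_fderiv_sub_le x i 1
  have e : pullGrad T H i x - H i (T x) =
      (((fderiv ℝ T x (EuclideanSpace.single i 1)) 0 - (EuclideanSpace.single i (1 : ℝ) : Plane) 0 : ℝ) : ℂ)
        * H 0 (T x) +
      (((fderiv ℝ T x (EuclideanSpace.single i 1)) 1 - (EuclideanSpace.single i (1 : ℝ) : Plane) 1 : ℝ) : ℂ)
        * H 1 (T x) := by
    rw [pullGrad]
    push_cast
    fin_cases i <;> simp <;> ring
  rw [e, mul_add]
  refine (norm_add_le _ _).trans (add_le_add ?_ ?_) <;> rw [norm_mul, Complex.norm_real] <;> gcongr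

theorem IsNearIdentity.norm_pullGrad_le {T S : Plane → Plane} {L ε : NNReal}
    (h : IsNearIdentity T S L ε) (H : Fin 2 → Plane → ℂ) (i : Fin 2) (x : Plane) :
    ‖pullGrad T H i x‖ ≤ L * (‖H 0 (T x)‖ + ‖H 1 (T x)‖) := by
  rw [pullGrad, mul_add]
  refine (norm_add_le _ _).trans (add_le_add ?_ ?_) <;> rw [norm_mul] <;> gcongr <;>
    exact h.norm_coef_le _ _ _

/-! ### Continuity of the state with respect to the domain -/

theorem image_eq_self_of_forall_eq {T : Plane → Plane} {A : Set Plane} (h : ∀ x ∈ A, T x = x) :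
    T '' A = A := by
  rw [image_congr h, image_id']

theorem IsNearIdentity.image_frontier_diff {T S : Plane → Plane} {L ε : NNReal}
    (h : IsNearIdentity T S L ε) {D : Set Plane} (hfix : ∀ x ∈ frontier D, T x = x) (Ω : Set Plane) :
    T '' (frontier Ω \ frontier D) = frontier (T '' Ω) \ frontier D := by
  rw [image_sdiff (Function.LeftInverse.injective h.left_inv), h.frontier_image,
    image_eq_self_of_forall_eq hfix]

theorem IsNearIdentity.inv_fix {T S : Plane → Plane} {L ε : NNReal} (h : IsNearIdentity T S L ε)
    {A : Set Plane} (hfix : ∀ x ∈ A, T x = x) : ∀ x ∈ A, S x = x := fun x hx => by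
  conv_lhs => rw [← hfix x hx]
  exact h.left_inv x

/-- The weight `s` stays free until `integral_state_sub_le`, where it is chosen so that the unknown
energy is absorbed. -/
theorem mul_le_young {a b s : ℝ} (hs : 0 < s) : a * b ≤ a ^ 2 / s + s * b ^ 2 := by
  have h : 0 ≤ (a - s * b) ^ 2 / s := by positivity
  have e : (a - s * b) ^ 2 / s = a ^ 2 / s - 2 * (a * b) + s * b ^ 2 := by field_simp; ring
  have h2 : 0 ≤ a ^ 2 / s := by positivity
  have h3 : 0 ≤ s * b ^ 2 := by positivity
  linarith

theorem add_mul_add_le_young {a b c d s : ℝ} (hs : 0 < s) :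
    (a + b) * (c + d) ≤ (a ^ 2 + b ^ 2) / s + s * (c ^ 2 + d ^ 2) := by
  have h : 0 ≤ ((a + b) - s * (c + d)) ^ 2 / s := by positivity
  have e : ((a + b) - s * (c + d)) ^ 2 / s =
      (a + b) ^ 2 / s - 2 * ((a + b) * (c + d)) + s * (c + d) ^ 2 := by field_simp; ring
  have h2 : (a + b) ^ 2 / s ≤ 2 * ((a ^ 2 + b ^ 2) / s) := by
    rw [← mul_div_assoc]
    exact div_le_div_of_nonneg_right (by nlinarith [sq_nonneg (a - b)]) hs.le
  have h3 : s * (c + d) ^ 2 ≤ 2 * (s * (c ^ 2 + d ^ 2)) := by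
    nlinarith [mul_nonneg hs.le (sq_nonneg (c - d))]
  linarith

theorem integral_norm_mul_norm_le {X : Type*} [MeasurableSpace X] {μ : Measure X} {f k : X → ℂ}
    (hf : MemLp f 2 μ) (hk : MemLp k 2 μ) {s : ℝ} (hs : 0 < s) :
    ∫ x, ‖f x‖ * ‖k x‖ ∂μ ≤ (∫ x, ‖f x‖ ^ 2 ∂μ) / s + s * ∫ x, ‖k x‖ ^ 2 ∂μ := by
  have h1 := (integrable_norm_sq hf).div_const s
  have h2 := (integrable_norm_sq hk).const_mul s
  rw [← integral_div, ← integral_const_mul, ← integral_add h1 h2]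
  exact integral_mono (hf.norm.integrable_mul hk.norm) (h1.add h2) fun x => mul_le_young hs

/-- Both forms are compared with the integral over `Ω` of the transported integrand. Changing the
measure costs `3 * (L ^ 2 - 1)`, times `L` for the size of the pushed gradient. Replacing the two
chain-rule gradients by the plain ones costs `ε` each. The outer `2` counts the gradient components.
-/
theorem norm_dirichlet_sub_le {T S : Plane → Plane} {L ε : NNReal} (h : IsNearIdentity T S L ε)
    {Ω : Set Plane} (hb : Bornology.IsBounded Ω) {G H : Fin 2 → Plane → ℂ}
    (hG : ∀ i, MemLp (G i) 2 (volume.restrict Ω))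
    (hH : ∀ i, MemLp (H i) 2 (volume.restrict (T '' Ω))) {s : ℝ} (hs : 0 < s) :
    ‖dirichletForm (T '' Ω) (pullGrad S G) H - dirichletForm Ω G (pullGrad T H)‖ ≤
      2 * (3 * (L ^ 2 - 1) * L + 2 * ε) *
        (((∫ x in Ω, ‖G 0 x‖ ^ 2) + ∫ x in Ω, ‖G 1 x‖ ^ 2) / s +
          s * (L ^ 2 * ((∫ x in T '' Ω, ‖H 0 x‖ ^ 2) + ∫ x in T '' Ω, ‖H 1 x‖ ^ 2))) := by
  have hfin : IsFiniteMeasure (volume.restrict Ω) := isFiniteMeasure_restrict.2 hb.measure_lt_top.ne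
  have hc := h.comparable_volume Ω
  have hQ : ∀ i, MemLp (fun x => H i (T x)) 2 (volume.restrict Ω) := fun i => hc.memLp (hH i)
  have hL1 : (1 : ℝ) ≤ (L : ℝ) ^ 2 := one_le_pow₀ (by exact_mod_cast h.one_le)
  have hS : ∀ i, MemLp (pullGrad S G i) 2 (volume.restrict (T '' Ω)) :=
    h.symm.memLp_pullGrad (Ω := T '' Ω) (by rwa [h.image_image])
  have hP : ∀ i, MemLp (fun x => pullGrad S G i (T x)) 2 (volume.restrict Ω) := fun i =>
    hc.memLp (hS i)
  have hT := h.memLp_pullGrad hH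
  set m : Plane → ℝ := fun x => (‖G 0 x‖ + ‖G 1 x‖) * (‖H 0 (T x)‖ + ‖H 1 (T x)‖) with hm
  have hmi : Integrable m (volume.restrict Ω) :=
    ((hG 0).norm.add (hG 1).norm).integrable_mul ((hQ 0).norm.add (hQ 1).norm)
  have hi1 : Integrable (fun x => (‖G 0 x‖ ^ 2 + ‖G 1 x‖ ^ 2) / s) (volume.restrict Ω) :=
    ((integrable_norm_sq (hG 0)).add (integrable_norm_sq (hG 1))).div_const s
  have hi2 : Integrable (fun x => s * (‖H 0 (T x)‖ ^ 2 + ‖H 1 (T x)‖ ^ 2)) (volume.restrict Ω) :=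
    ((integrable_norm_sq (hQ 0)).add (integrable_norm_sq (hQ 1))).const_mul s
  have hmb : ∫ x in Ω, m x ≤ ((∫ x in Ω, ‖G 0 x‖ ^ 2) + ∫ x in Ω, ‖G 1 x‖ ^ 2) / s +
      s * (L ^ 2 * ((∫ x in T '' Ω, ‖H 0 x‖ ^ 2) + ∫ x in T '' Ω, ‖H 1 x‖ ^ 2)) := by
    have q : ∀ i, ∫ x in Ω, ‖H i (T x)‖ ^ 2 ≤ L ^ 2 * ∫ x in T '' Ω, ‖H i x‖ ^ 2 := fun i => by
      simpa using hc.integral_sq_le (hH i)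
    calc ∫ x in Ω, m x ≤ ∫ x in Ω, ((‖G 0 x‖ ^ 2 + ‖G 1 x‖ ^ 2) / s +
          s * (‖H 0 (T x)‖ ^ 2 + ‖H 1 (T x)‖ ^ 2)) :=
          integral_mono hmi (hi1.add hi2) fun x => add_mul_add_le_young hs
      _ = ((∫ x in Ω, ‖G 0 x‖ ^ 2) + ∫ x in Ω, ‖G 1 x‖ ^ 2) / s +
          s * ((∫ x in Ω, ‖H 0 (T x)‖ ^ 2) + ∫ x in Ω, ‖H 1 (T x)‖ ^ 2) := by
          rw [integral_add hi1 hi2, integral_div, integral_const_mul,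
            integral_add (integrable_norm_sq (hG 0)) (integrable_norm_sq (hG 1)),
            integral_add (integrable_norm_sq (hQ 0)) (integrable_norm_sq (hQ 1))]
      _ ≤ _ := by
          have := q 0
          have := q 1
          gcongr
          linarith
  have key : ∀ i, ‖(∫ y in T '' Ω, pullGrad S G i y * conj (H i y)) -
      ∫ x in Ω, G i x * conj (pullGrad T H i x)‖ ≤ (3 * (L ^ 2 - 1) * L + 2 * ε) * ∫ x in Ω, m x := by
    intro i
    have hGi : ∀ x, ‖G i x‖ ≤ ‖G 0 x‖ + ‖G 1 x‖ := fun x => by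
      fin_cases i
      · simp
      · simp
    have hQi : ∀ x, ‖H i (T x)‖ ≤ ‖H 0 (T x)‖ + ‖H 1 (T x)‖ := fun x => by
      fin_cases i
      · simp
      · simp
    have hPi : ∀ x, ‖pullGrad S G i (T x)‖ ≤ L * (‖G 0 x‖ + ‖G 1 x‖) := fun x => by
      have := h.symm.norm_pullGrad_le G i (T x)
      rwa [h.left_inv] at this
    have hPGi : ∀ x, ‖pullGrad S G i (T x) - G i x‖ ≤ ε * (‖G 0 x‖ + ‖G 1 x‖) := fun x => by
      have := h.symm.norm_pullGrad_sub_le G i (T x)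
      rwa [h.left_inv] at this
    have iPQ := integrable_mul_conj (hP i) (hQ i)
    have iGH := integrable_mul_conj (hG i) (hT i)
    have s1 : ‖(∫ y in T '' Ω, pullGrad S G i y * conj (H i y)) -
        ∫ x in Ω, pullGrad S G i (T x) * conj (H i (T x))‖ ≤ 3 * (L ^ 2 - 1) * (L * ∫ x in Ω, m x) := by
      have h1 := hc.norm_integral_sub_le (one_le_pow₀ h.one_le) (integrable_mul_conj (hS i) (hH i))
      have h2 : ∫ x in Ω, ‖pullGrad S G i (T x) * conj (H i (T x))‖ ≤ L * ∫ x in Ω, m x := by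
        rw [← integral_const_mul]
        refine integral_mono iPQ.norm (hmi.const_mul _) fun x => ?_
        simp only [norm_mul, RCLike.norm_conj, hm]
        rw [← mul_assoc]
        exact mul_le_mul (hPi x) (hQi x) (norm_nonneg _) (by positivity)
      refine h1.trans ?_
      push_cast
      exact mul_le_mul_of_nonneg_left h2 (by linarith)
    have s2 : ‖(∫ x in Ω, pullGrad S G i (T x) * conj (H i (T x))) -
        ∫ x in Ω, G i x * conj (pullGrad T H i x)‖ ≤ 2 * ε * ∫ x in Ω, m x := by
      rw [← integral_sub iPQ iGH, ← integral_const_mul]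
      refine norm_integral_le_of_norm_le (hmi.const_mul _) (Eventually.of_forall fun x => ?_)
      have e : pullGrad S G i (T x) * conj (H i (T x)) - G i x * conj (pullGrad T H i x) =
          (pullGrad S G i (T x) - G i x) * conj (H i (T x)) -
            G i x * conj (pullGrad T H i x - H i (T x)) := by
        rw [map_sub]; ring
      rw [e]
      refine (norm_sub_le _ _).trans ?_
      simp only [norm_mul, RCLike.norm_conj, hm]
      have t1 := mul_le_mul (hPGi x) (hQi x) (norm_nonneg _) (by positivity)
      have t2 := mul_le_mul (hGi x) (h.norm_pullGrad_sub_le H i x) (norm_nonneg _) (by positivity)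
      linarith
    have := norm_sub_le_norm_sub_add_norm_sub
      (∫ y in T '' Ω, pullGrad S G i y * conj (H i y))
      (∫ x in Ω, pullGrad S G i (T x) * conj (H i (T x)))
      (∫ x in Ω, G i x * conj (pullGrad T H i x))
    linarith
  rw [dirichletForm, dirichletForm, ← Finset.sum_sub_distrib, Fin.sum_univ_two]
  refine (norm_add_le _ _).trans ((add_le_add (key 0) (key 1)).trans ?_)
  rw [← two_mul, ← mul_assoc]
  refine mul_le_mul_of_nonneg_left hmb ?_
  have : (0 : ℝ) ≤ L := L.2
  have : (0 : ℝ) ≤ ε := ε.2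
  have : 0 ≤ ((L : ℝ) ^ 2 - 1) * L := mul_nonneg (by linarith) L.2
  linarith

/-- No derivatives occur in the boundary terms, so only the distortion of arc length contributes. -/
theorem norm_boundary_sub_le {T S : Plane → Plane} {L ε : NNReal} (h : IsNearIdentity T S L ε)
    {A : Set Plane} (hA : (Measure.hausdorffMeasure 1 : Measure Plane) A < ∞) {η ζ : Plane → ℂ}
    (hη : MemLp η 2 (arcLength A)) (hζ : MemLp ζ 2 (arcLength (T '' A))) {s : ℝ} (hs : 0 < s) :
    ‖boundaryForm (T '' A) (fun y => η (S y)) ζ - boundaryForm A η fun x => ζ (T x)‖ ≤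
      3 * (L ^ 2 - 1) * ((∫ x, ‖η x‖ ^ 2 ∂(arcLength A)) / s +
        s * (L ^ 2 * ∫ x, ‖ζ x‖ ^ 2 ∂(arcLength (T '' A)))) := by
  have hfin : IsFiniteMeasure (arcLength A) := isFiniteMeasure_restrict.2 hA.ne
  have hc := h.comparable_arcLength A
  have hL1 : (1 : ℝ) ≤ (L : ℝ) ^ 2 := one_le_pow₀ (by exact_mod_cast h.one_le)
  have hS : MemLp (fun y => η (S y)) 2 (arcLength (T '' A)) := by
    have hc' := h.symm.comparable_arcLength (T '' A)
    rw [h.image_image] at hc'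
    exact hc'.memLp hη
  have h1 := hc.norm_integral_sub_le (one_le_pow₀ h.one_le) (integrable_mul_conj hS hζ)
  simp only [h.left_inv, norm_mul, RCLike.norm_conj] at h1
  have hT := hc.memLp hζ
  have h2 := integral_norm_mul_norm_le hη hT hs
  have h3 := hc.integral_sq_le hζ
  refine h1.trans ?_
  push_cast at h3 ⊢
  refine mul_le_mul_of_nonneg_left (h2.trans ?_) (by linarith)
  gcongr

/-- The sesquilinear forms on `Ω` and `T(Ω)` are close to each other if `T` is close to the
identity. -/
theorem norm_energyForm_sub_le {T S : Plane → Plane} {L ε : NNReal} (h : IsNearIdentity T S L ε)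
    {D Ω : Set Plane} (hd : IsStateDomain D Ω) (hfix : ∀ x ∈ frontier D, T x = x) {α : ℝ}
    (hα : 0 ≤ α) (ρ : ℝ) {u w : Plane → ℂ} {G H : Fin 2 → Plane → ℂ} {η ζ : Plane → ℂ}
    (hu : HasTrace Ω u G η) (hw : HasTrace (T '' Ω) w H ζ) {s : ℝ} (hs : 0 < s) :
    ‖energyForm D α ρ (T '' Ω) (pullGrad S G) (fun y => η (S y)) H ζ -
      energyForm D α ρ Ω G η (pullGrad T H) fun x => ζ (T x)‖ ≤
      (2 * (3 * (L ^ 2 - 1) * L + 2 * ε) + α * (3 * (L ^ 2 - 1))) *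
        (energy Ω G η / s + s * (L ^ 2 * energy (T '' Ω) H ζ)) := by
  have hout : boundaryForm (frontier D) (fun y => η (S y)) ζ =
      boundaryForm (frontier D) η fun x => ζ (T x) :=
    setIntegral_congr_fun isClosed_frontier.measurableSet fun x hx => by
      simp only [hfix x hx, h.inv_fix hfix x hx]
  have hin := h.image_frontier_diff hfix Ω
  have hb := norm_boundary_sub_le h (A := frontier Ω \ frontier D)
    ((measure_mono sdiff_subset).trans_lt hd.finite)
    (hu.memLp_trace.mono_measure (arcLength_mono sdiff_subset))
    (hw.memLp_trace.mono_measure (arcLength_mono (by rw [hin]; exact sdiff_subset))) hs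
  rw [hin] at hb
  have hdir := norm_dirichlet_sub_le h hd.isBounded hu.isH1.memLp_grad hw.isH1.memLp_grad hs
  have hL1 : (1 : ℝ) ≤ (L : ℝ) ^ 2 := one_le_pow₀ (by exact_mod_cast h.one_le)
  have e : energyForm D α ρ (T '' Ω) (pullGrad S G) (fun y => η (S y)) H ζ -
      energyForm D α ρ Ω G η (pullGrad T H) (fun x => ζ (T x)) =
      (dirichletForm (T '' Ω) (pullGrad S G) H - dirichletForm Ω G (pullGrad T H)) +
      α * (boundaryForm (frontier (T '' Ω) \ frontier D) (fun y => η (S y)) ζ -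
        boundaryForm (frontier Ω \ frontier D) η fun x => ζ (T x)) := by
    rw [energyForm, energyForm, hout]; ring
  have m1 : ∫ x, ‖η x‖ ^ 2 ∂(arcLength (frontier Ω \ frontier D)) ≤
      ∫ x, ‖η x‖ ^ 2 ∂(arcLength (frontier Ω)) :=
    integral_mono_measure (arcLength_mono sdiff_subset)
      (Eventually.of_forall fun x => by positivity) (integrable_norm_sq hu.memLp_trace)
  have m2 : ∫ x, ‖ζ x‖ ^ 2 ∂(arcLength (frontier (T '' Ω) \ frontier D)) ≤
      ∫ x, ‖ζ x‖ ^ 2 ∂(arcLength (frontier (T '' Ω))) :=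
    integral_mono_measure (arcLength_mono sdiff_subset)
      (Eventually.of_forall fun x => by positivity) (integrable_norm_sq hw.memLp_trace)
  have n1 : ∫ x, ‖η x‖ ^ 2 ∂(arcLength (frontier Ω \ frontier D)) ≤ energy Ω G η := by
    rw [energy]
    have : 0 ≤ ∫ x in Ω, ‖G 0 x‖ ^ 2 := by positivity
    have : 0 ≤ ∫ x in Ω, ‖G 1 x‖ ^ 2 := by positivity
    linarith
  have n2 : ∫ x, ‖ζ x‖ ^ 2 ∂(arcLength (frontier (T '' Ω) \ frontier D)) ≤ energy (T '' Ω) H ζ := by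
    rw [energy]
    have : 0 ≤ ∫ x in T '' Ω, ‖H 0 x‖ ^ 2 := by positivity
    have : 0 ≤ ∫ x in T '' Ω, ‖H 1 x‖ ^ 2 := by positivity
    linarith
  have n3 : (∫ x in Ω, ‖G 0 x‖ ^ 2) + ∫ x in Ω, ‖G 1 x‖ ^ 2 ≤ energy Ω G η :=
    le_add_of_nonneg_right (by positivity)
  have n4 : (∫ x in T '' Ω, ‖H 0 x‖ ^ 2) + ∫ x in T '' Ω, ‖H 1 x‖ ^ 2 ≤ energy (T '' Ω) H ζ :=
    le_add_of_nonneg_right (by positivity)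
  have c1 : 0 ≤ 3 * ((L : ℝ) ^ 2 - 1) := by linarith
  have c2 : 0 ≤ 2 * (3 * ((L : ℝ) ^ 2 - 1) * L + 2 * ε) := by
    have := mul_nonneg c1 L.2
    have : (0 : ℝ) ≤ ε := ε.2
    positivity
  rw [e, add_mul]
  refine (norm_add_le _ _).trans (add_le_add (hdir.trans ?_) ?_)
  · gcongr
  · rw [norm_mul, Complex.norm_real, Real.norm_of_nonneg hα, mul_assoc]
    refine mul_le_mul_of_nonneg_left (hb.trans ?_) hα
    gcongr

/-- Continuity of the state with respect to the domain. -/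
theorem integral_state_sub_le {T S : Plane → Plane} {L ε : NNReal} (h : IsNearIdentity T S L ε)
    {D Ω : Set Plane} (hd : IsStateDomain D Ω) (hd' : IsStateDomain D (T '' Ω))
    (hfix : ∀ x ∈ frontier D, T x = x) {α ρ : ℝ} (hα : 0 < α) (hρ : 0 < ρ) {f g : Plane → ℝ}
    {u : Plane → ℂ} {G : Fin 2 → Plane → ℂ} {η : Plane → ℂ} (hu : HasTrace Ω u G η)
    (hstate : ∀ v H ζ, HasTrace Ω v H ζ → energyForm D α ρ Ω G η H ζ
      = boundaryForm (frontier D) (fun x => (g x : ℂ)) ζ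
        + Complex.I * ρ * boundaryForm (frontier D) (fun x => (f x : ℂ)) ζ)
    {u' : Plane → ℂ} (hu' : IsState D α ρ f g (T '' Ω) u') {R : ℝ} (hR0 : 0 ≤ R)
    (hR : ∀ x ∈ T '' Ω, ‖x‖ ≤ R) {δ κ : ℝ} (hδ : 0 < δ)
    (hκ : κ = min 1 (min α ρ) / 2)
    (hδ' : 2 * (3 * (L ^ 2 - 1) * L + 2 * ε) + α * (3 * (L ^ 2 - 1)) ≤ δ) :
    ∫ y in T '' Ω, ‖u' y - u (S y)‖ ^ 2 ≤
      (4 * R + 8 * R ^ 2) * (4 * L ^ 2 * δ ^ 2 / κ ^ 2 * energy Ω G η) := by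
  obtain ⟨G', η', hG', hs'⟩ := hu'
  have hp := hu.push h
  have hw := hG'.sub hp
  set H : Fin 2 → Plane → ℂ := fun i x => G' i x - pullGrad S G i x with hH
  set ζ : Plane → ℂ := fun x => η' x - η (S x) with hζ
  have hκ0 : 0 < κ := by rw [hκ]; positivity
  have hL1 : (1 : ℝ) ≤ L := by exact_mod_cast h.one_le
  have hE := energy_nonneg Ω G η
  have hE' := energy_nonneg (T '' Ω) H ζ
  have h1 := energy_le_norm_energyForm hd'.subset α ρ H hw.memLp_trace
  rw [← hκ] at h1
  -- The error `w = u' - u ∘ S` is a test function on `T '' Ω`, and its pull-back is one on `Ω`.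
  -- Both equations have the same right-hand side because `T` fixes `Σ`. So the form of `w` against
  -- itself is purely the discrepancy between the two forms.
  have h2 : energyForm D α ρ (T '' Ω) H ζ H ζ =
      energyForm D α ρ Ω G η (pullGrad T H) (fun x => ζ (T x)) -
      energyForm D α ρ (T '' Ω) (pullGrad S G) (fun y => η (S y)) H ζ := by
    have e1 := hG'.energyForm_sub hd'.subset α ρ hp hw
    have e2 : energyForm D α ρ (T '' Ω) G' η' H ζ =
        energyForm D α ρ Ω G η (pullGrad T H) (fun x => ζ (T x)) := by
      have hfx : ∀ k : Plane → ℂ, boundaryForm (frontier D) k (fun x => ζ (T x)) =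
          boundaryForm (frontier D) k ζ := fun k =>
        setIntegral_congr_fun isClosed_frontier.measurableSet fun x hx => by simp only [hfix x hx]
      rw [hstate _ _ _ (hw.pull h), hfx, hfx]
      exact hs' _ _ _ hw
    rw [← e2]
    exact e1
  -- Chosen so that `δ * s * L ^ 2 = κ / 2`: half of the coercive term absorbs the unknown energy on
  -- the right.
  set s : ℝ := κ / (2 * L ^ 2 * δ) with hs
  have hs0 : 0 < s := by positivity
  have h3 := norm_energyForm_sub_le h hd hfix hα.le ρ hu hw hs0
  rw [norm_sub_rev, ← h2] at h3
  have h4 : κ * energy (T '' Ω) H ζ ≤ δ * (energy Ω G η / s + s * (L ^ 2 * energy (T '' Ω) H ζ)) :=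
    h1.trans (h3.trans (mul_le_mul_of_nonneg_right hδ' (by positivity)))
  have h5 : energy (T '' Ω) H ζ ≤ 4 * L ^ 2 * δ ^ 2 / κ ^ 2 * energy Ω G η := by
    have e : δ * (energy Ω G η / s + s * (L ^ 2 * energy (T '' Ω) H ζ)) =
        2 * L ^ 2 * δ ^ 2 / κ * energy Ω G η + κ / 2 * energy (T '' Ω) H ζ := by
      rw [hs]; field_simp
    rw [e] at h4
    have e2 : 4 * L ^ 2 * δ ^ 2 / κ ^ 2 * energy Ω G η =
        (2 / κ) * (2 * L ^ 2 * δ ^ 2 / κ * energy Ω G η) := by field_simp; ring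
    have e3 : energy (T '' Ω) H ζ = (2 / κ) * (κ / 2 * energy (T '' Ω) H ζ) := by field_simp
    rw [e2, e3]
    refine mul_le_mul_of_nonneg_left ?_ (by positivity)
    linarith
  exact (hw.integral_sq_le hd'.isOpen hR0 hR).trans (mul_le_mul_of_nonneg_left h5 (by positivity))

/-! ### Perturbations of the identity -/

/-- A perturbation of the identity with Lipschitz constant `τ ≤ 1 / 2` is a homeomorphism. Its
inverse has constant `1 / (1 - τ) ≤ 1 + 2τ`, and `S - id = -σ ∘ S` has constant `τ (1 + 2τ) ≤ 2τ`.
-/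
theorem exists_isNearIdentity {σ : Plane → Plane} (hσ : ContDiff ℝ 1 σ) {τ : NNReal}
    (hτ : τ ≤ 1 / 2) (hL : LipschitzWith τ σ) :
    ∃ S, IsNearIdentity (fun x => x + σ x) S (1 + 2 * τ) (2 * τ) := by
  have hτr : (τ : ℝ) ≤ 1 / 2 := by exact_mod_cast hτ
  have happ : ApproximatesLinearOn (fun x => x + σ x)
      ((ContinuousLinearEquiv.refl ℝ Plane : Plane ≃L[ℝ] Plane) : Plane →L[ℝ] Plane) univ τ := by
    refine fun x _ y _ => ?_
    have := hL.dist_le_mul x y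
    rw [dist_eq_norm, dist_eq_norm] at this
    change ‖(x + σ x) - (y + σ y) - (x - y)‖ ≤ τ * ‖x - y‖
    rwa [show (x + σ x) - (y + σ y) - (x - y) = σ x - σ y by abel]
  have hlt : τ < ‖((ContinuousLinearEquiv.refl ℝ Plane).symm : Plane →L[ℝ] Plane)‖₊⁻¹ := by
    have e : ((ContinuousLinearEquiv.refl ℝ Plane).symm : Plane →L[ℝ] Plane) =
        ContinuousLinearMap.id ℝ Plane := rfl
    have e1 : ‖ContinuousLinearMap.id ℝ Plane‖₊ = 1 := ContinuousLinearMap.nnnorm_id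
    rw [e, e1, inv_one]
    exact hτ.trans_lt (by rw [← NNReal.coe_lt_coe]; norm_num)
  set e := happ.toHomeomorph _ (Or.inr hlt) with he
  have hT : ∀ x, e x = x + σ x := fun x => rfl
  have hTd : ContDiff ℝ 1 fun x => x + σ x := contDiff_id.add hσ
  have hinv : ∀ y, e.symm y + σ (e.symm y) = y := fun y => e.apply_symm_apply y
  have hSL : LipschitzWith (1 + 2 * τ) e.symm := by
    refine LipschitzWith.of_dist_le_mul fun y z => ?_
    have h1 := hL.dist_le_mul (e.symm y) (e.symm z)
    have h2 : dist (e.symm y) (e.symm z) ≤ dist y z + dist (σ (e.symm y)) (σ (e.symm z)) := by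
      rw [dist_eq_norm, dist_eq_norm, dist_eq_norm]
      have : e.symm y - e.symm z = (y - z) - (σ (e.symm y) - σ (e.symm z)) := by
        have hyz : y - z = (e.symm y + σ (e.symm y)) - (e.symm z + σ (e.symm z)) := by
          rw [hinv y, hinv z]
        rw [hyz]
        abel
      rw [this]
      exact norm_sub_le _ _
    push_cast
    have h3 : 0 ≤ dist (e.symm y) (e.symm z) := dist_nonneg
    have h5 : (1 - (τ : ℝ)) * dist (e.symm y) (e.symm z) ≤ dist y z := by linarith
    have h6 : 1 ≤ (1 + 2 * (τ : ℝ)) * (1 - τ) := by nlinarith [τ.2, show (τ : ℝ) = τ.1 from rfl]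
    calc dist (e.symm y) (e.symm z) ≤ ((1 + 2 * (τ : ℝ)) * (1 - τ)) * dist (e.symm y) (e.symm z) :=
          le_mul_of_one_le_left h3 h6
      _ = (1 + 2 * (τ : ℝ)) * ((1 - τ) * dist (e.symm y) (e.symm z)) := by ring
      _ ≤ _ := by gcongr
  have hSd : ContDiff ℝ 1 e.symm := by
    -- A kernel vector satisfies `v = -Dσ v`, so `‖v‖ ≤ τ ‖v‖` forces `v = 0`. In finite dimension
    -- the derivative is then invertible, which makes the inverse `C¹`.
    have hinj : ∀ a, Function.Injective (fderiv ℝ (fun x => x + σ x) a : Plane →ₗ[ℝ] Plane) := by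
      intro a
      rw [← LinearMap.ker_eq_bot, LinearMap.ker_eq_bot']
      intro v hv
      have h1 : fderiv ℝ (fun x => x + σ x) a = ContinuousLinearMap.id ℝ Plane + fderiv ℝ σ a :=
        ((hasFDerivAt_id a).add (hσ.differentiable one_ne_zero a).hasFDerivAt).fderiv
      rw [h1] at hv
      have h2 : v = -(fderiv ℝ σ a v) := eq_neg_of_add_eq_zero_left hv
      have h3 : ‖v‖ ≤ τ * ‖v‖ := by
        calc ‖v‖ = ‖fderiv ℝ σ a v‖ := by conv_lhs => rw [h2, norm_neg]
          _ ≤ ‖fderiv ℝ σ a‖ * ‖v‖ := ContinuousLinearMap.le_opNorm _ _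
          _ ≤ τ * ‖v‖ := by gcongr; exact norm_fderiv_le_of_lipschitz ℝ hL
      have h4 : ‖v‖ ≤ 0 := by nlinarith [norm_nonneg v]
      exact norm_le_zero_iff.1 h4
    refine e.contDiff_symm (f₀' := fun a =>
      (LinearEquiv.ofInjectiveEndo _ (hinj a)).toContinuousLinearEquiv) (fun a => ?_) hTd
    have := (hTd.differentiable one_ne_zero a).hasFDerivAt
    have hcoe : (((LinearEquiv.ofInjectiveEndo _ (hinj a)).toContinuousLinearEquiv :
        Plane ≃L[ℝ] Plane) : Plane →L[ℝ] Plane) = fderiv ℝ (fun x => x + σ x) a := by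
      ext1 v; rfl
    rw [hcoe]
    exact this
  refine ⟨e.symm, ⟨fun x => e.symm_apply_apply x, fun y => e.apply_symm_apply y, hTd, hSd, ?_, hSL,
    ?_, ?_, ?_⟩⟩
  · refine ((LipschitzWith.id (α := Plane)).add hL).weaken ?_
    gcongr
    rw [two_mul]
    exact le_self_add
  · have : (fun x => x + σ x - x) = σ := by funext x; abel
    rw [this]
    exact hL.weaken (by rw [two_mul]; exact le_self_add)
  · have : (fun y => e.symm y - y) = fun y => -(σ (e.symm y)) := by
      funext y
      calc e.symm y - y = e.symm y - (e.symm y + σ (e.symm y)) := by rw [hinv y]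
        _ = -(σ (e.symm y)) := by abel
    rw [this]
    refine ((hL.comp hSL).neg).weaken ?_
    rw [← NNReal.coe_le_coe]
    push_cast
    nlinarith [τ.2, show (τ : ℝ) = τ.1 from rfl]
  · exact le_self_add

/-! ### Admissible domains -/

theorem frontier_sdiff_closure_subset {D ω : Set Plane} (hD : IsOpen D) :
    frontier (D \ closure ω) \ frontier D ⊆ closure ω := by
  rintro x ⟨hx, hxD⟩
  rw [(hD.sdiff isClosed_closure).frontier_eq] at hx
  by_contra hxω
  have h1 : x ∈ closure D := closure_mono sdiff_subset hx.1
  rw [hD.frontier_eq] at hxD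
  have h2 : x ∈ D := by
    by_contra h
    exact hxD ⟨h1, h⟩
  exact hx.2 ⟨h2, hxω⟩

/-- The frontier of `D \ closure ω` lies in `frontier D ∪ frontier ω`, two sets of finite length. It
contains `frontier D` because `closure ω ⊆ D` stays away from it. -/
theorem isStateDomain_sdiff_closure {D ω : Set Plane} (hD : IsOpen D)
    (hDb : Bornology.IsBounded D) (hDr : HasC11Boundary D) (hω : IsOpen ω)
    (hωD : closure ω ⊆ D) (hωr : HasC11Boundary ω) : IsStateDomain D (D \ closure ω) := by
  have hsub : frontier (D \ closure ω) ⊆ frontier D ∪ frontier ω := by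
    intro x hx
    by_cases hxD : x ∈ frontier D
    · exact Or.inl hxD
    · have hxω := frontier_sdiff_closure_subset hD ⟨hx, hxD⟩
      refine Or.inr ?_
      rw [hω.frontier_eq]
      refine ⟨hxω, fun h => ?_⟩
      obtain ⟨y, hy, hyD⟩ := mem_closure_iff_nhds.1 (frontier_subset_closure hx) ω (hω.mem_nhds h)
      exact hyD.2 (subset_closure hy)
  refine ⟨hD.sdiff isClosed_closure, hDb.subset sdiff_subset, ?_, ?_⟩
  · refine (measure_mono hsub).trans_lt ((measure_union_le _ _).trans_lt (ENNReal.add_lt_top.2 ⟨?_, ?_⟩))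
    · exact arcLength_frontier_lt_top hD hDb hDr
    · exact arcLength_frontier_lt_top hω (hDb.subset (subset_closure.trans hωD)) hωr
  · intro x hx
    rw [hD.frontier_eq] at hx
    rw [(hD.sdiff isClosed_closure).frontier_eq]
    refine ⟨?_, fun h => hx.2 h.1⟩
    rw [mem_closure_iff_nhds]
    intro U hU
    have hV : (closure ω)ᶜ ∈ 𝓝 x := isClosed_closure.isOpen_compl.mem_nhds fun h => hx.2 (hωD h)
    obtain ⟨y, hy, hyD⟩ := mem_closure_iff_nhds.1 hx.1 _ (inter_mem hU hV)
    exact ⟨y, hy.1, hyD, hy.2⟩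

/-! ### Boundary forms -/

theorem conj_integral_mul_conj {X : Type*} [MeasurableSpace X] {μ : Measure X} (f h : X → ℂ) :
    conj (∫ x, f x * conj (conj (h x)) ∂μ) = ∫ x, conj (f x) * conj (h x) ∂μ := by
  rw [← integral_conj]
  simp only [map_mul, Complex.conj_conj]

theorem conj_boundaryForm (S : Set Plane) (η ζ : Plane → ℂ) :
    conj (boundaryForm S η fun x => conj (ζ x)) = boundaryForm S (fun x => conj (η x)) ζ :=
  conj_integral_mul_conj _ _

theorem conj_dirichletForm (Ω : Set Plane) (G H : Fin 2 → Plane → ℂ) :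
    conj (dirichletForm Ω G fun i x => conj (H i x)) =
      dirichletForm Ω (fun i x => conj (G i x)) H := by
  rw [dirichletForm, map_sum]
  exact Finset.sum_congr rfl fun i _ => conj_integral_mul_conj _ _

theorem boundaryForm_congr_left {S : Set Plane} {η η' : Plane → ℂ}
    (h : ∀ᵐ x ∂(arcLength S), η x = η' x) (ζ : Plane → ℂ) :
    boundaryForm S η ζ = boundaryForm S η' ζ :=
  integral_congr_ae (h.mono fun x hx => by simp only [hx])

theorem dirichletForm_congr_left {Ω : Set Plane} {G G' : Fin 2 → Plane → ℂ}
    (h : ∀ i, G i =ᵐ[volume.restrict Ω] G' i) (H : Fin 2 → Plane → ℂ) :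
    dirichletForm Ω G H = dirichletForm Ω G' H :=
  Finset.sum_congr rfl fun i _ => integral_congr_ae ((h i).mono fun x hx => by simp only [hx])

theorem boundaryForm_eq_zero {S : Set Plane} {ζ : Plane → ℂ}
    (h : ∀ᵐ x ∂(arcLength S), ζ x = 0) (η : Plane → ℂ) : boundaryForm S η ζ = 0 := by
  rw [boundaryForm, integral_congr_ae (g := fun _ => 0) (h.mono fun x hx => by simp [hx]),
    integral_zero]

/-- The traces of functions vanishing on the inner boundary determine square integrable functions
on the outer boundary. -/
theorem ae_eq_of_boundaryForm_eq {D ω : Set Plane} (hD : IsOpen D) (hωD : closure ω ⊆ D)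
    (hd : IsStateDomain D (D \ closure ω)) {η k : Plane → ℂ}
    (hη : MemLp η 2 (arcLength (frontier D))) (hk : MemLp k 2 (arcLength (frontier D)))
    (h : ∀ v H ζ, HasTrace (D \ closure ω) v H ζ →
      (∀ᵐ x ∂(arcLength (frontier (D \ closure ω) \ frontier D)), ζ x = 0) →
      boundaryForm (frontier D) η ζ = boundaryForm (frontier D) k ζ) :
    ∀ᵐ x ∂(arcLength (frontier D)), η x = k x := by
  have hfin : IsFiniteMeasure (arcLength (frontier D)) :=
    isFiniteMeasure_restrict.2 ((measure_mono hd.subset).trans_lt hd.finite).ne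
  have hm : MemLp (fun x => η x - k x) 2 (arcLength (frontier D)) := hη.sub hk
  -- Smooth functions supported in the complement of `closure ω` vanish on the inner boundary, and
  -- this open set contains all of `frontier D`.
  have key := isClosed_closure.isOpen_compl.ae_eq_zero_of_integral_contDiff_smul_eq_zero
    (U := (closure ω)ᶜ) (μ := arcLength (frontier D)) (locallyIntegrableOn_of_memLp hm)
    fun χ hχ hc hs => ?_
  · filter_upwards [key, ae_restrict_mem isClosed_frontier.measurableSet] with x hx hxD
    refine sub_eq_zero.1 (hx fun hxω => ?_)
    rw [hD.frontier_eq] at hxD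
    exact hxD.2 (hωD hxω)
  · have hχ1 : ContDiff ℝ 1 fun x => (χ x : ℂ) :=
      Complex.ofRealCLM.contDiff.comp (hχ.of_le (by exact_mod_cast le_top))
    have ht := hasTrace_of_contDiff hd.isBounded hd.isOpen hd.finite hχ1
    have hcm : MemLp (fun x => (χ x : ℂ)) 2 (arcLength (frontier D)) :=
      ht.memLp_trace.mono_measure (arcLength_mono hd.subset)
    have e := h _ _ _ ht (by
      have hmem : ∀ᵐ x ∂(arcLength (frontier (D \ closure ω) \ frontier D)),
          x ∈ frontier (D \ closure ω) \ frontier D :=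
        ae_restrict_mem (isClosed_frontier.measurableSet.diff isClosed_frontier.measurableSet)
      refine hmem.mono fun x hx => ?_
      have : χ x = 0 := image_eq_zero_of_notMem_tsupport fun hxs =>
        hs hxs (frontier_sdiff_closure_subset hD hx)
      simp [this])
    have e2 := integral_sub_mul_conj hη hk hcm
    rw [show ∫ x, η x * conj (χ x : ℂ) ∂(arcLength (frontier D)) =
      ∫ x, k x * conj (χ x : ℂ) ∂(arcLength (frontier D)) from e, sub_self] at e2
    rw [← e2]
    refine integral_congr_ae (Eventually.of_forall fun x => ?_)
    simp only [Complex.real_smul, Complex.conj_ofReal]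
    ring

/-! ### The overdetermined problem -/

theorem solvesOverdetermined_of_im_eq_zero {D ω : Set Plane} (hD : IsOpen D)
    (hDr : HasC11Boundary D) (hωD : closure ω ⊆ D) (hd : IsStateDomain D (D \ closure ω))
    {α ρ : ℝ} (hρ : 0 < ρ) {f g : Plane → ℝ} (hf : MemLp f 2 (arcLength (frontier D)))
    {u : Plane → ℂ} (hu : IsState D α ρ f g (D \ closure ω) u)
    (h0 : ∀ᵐ x ∂(volume.restrict (D \ closure ω)), (u x).im = 0) :
    SolvesOverdetermined D α f g (D \ closure ω) u := by
  set Ω := D \ closure ω with hΩ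
  obtain ⟨G, η, hG, hs⟩ := hu
  have huc : u =ᵐ[volume.restrict Ω] fun x => conj (u x) :=
    h0.mono fun x hx => (Complex.conj_eq_iff_im.2 hx).symm
  have hGc := hG.isH1.grad_ae_eq hd.isOpen hG.conj.isH1 huc
  have hηc : ∀ᵐ x ∂(arcLength (frontier D)), η x - conj (η x) = 0 := by
    refine (hG.sub hG.conj).trace_ae_eq_zero hD hDr (W := (closure ω)ᶜ)
      isClosed_closure.isOpen_compl ?_ (fun x hx => hx) hd.subset ?_ fun i => ?_
    · intro x hx hxω
      rw [hD.frontier_eq] at hx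
      exact hx.2 (hωD hxω)
    · exact huc.mono fun x hx => sub_eq_zero.2 hx
    · exact (hGc i).mono fun x hx => sub_eq_zero.2 hx
  have hηD : MemLp η 2 (arcLength (frontier D)) := hG.memLp_trace.mono_measure (arcLength_mono hd.subset)
  have hηf : ∀ᵐ x ∂(arcLength (frontier D)), η x = f x := by
    -- Tests vanishing on the inner boundary suffice, so the traces of `u` and `ū` need not be
    -- compared there. Conjugation flips the sign of `iρ`, and subtraction leaves twice the `Σ`
    -- term.
    refine ae_eq_of_boundaryForm_eq hD hωD hd hηD hf.ofReal fun v H ζ hv hζ => ?_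
    have e1 := hs v H ζ hv
    have e2 := congrArg conj (hs _ _ _ hv.conj)
    simp only [map_add, map_mul, conj_dirichletForm, conj_boundaryForm, Complex.conj_I,
      Complex.conj_ofReal] at e2
    rw [← dirichletForm_congr_left hGc, ← boundaryForm_congr_left
      (hηc.mono fun x hx => sub_eq_zero.1 hx)] at e2
    rw [boundaryForm_eq_zero hζ] at e1 e2
    have e3 : (2 * Complex.I * ρ) * boundaryForm (frontier D) η ζ =
        (2 * Complex.I * ρ) * boundaryForm (frontier D) (fun x => (f x : ℂ)) ζ := by
      linear_combination e1 - e2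
    refine mul_left_cancel₀ ?_ e3
    simp [hρ.ne']
  refine ⟨G, η, hG, hηf, fun v H ζ hv => ?_⟩
  have e1 := hs v H ζ hv
  rw [boundaryForm_congr_left hηf] at e1
  linear_combination e1

theorem im_eq_zero_of_solvesOverdetermined {D Ω : Set Plane} (hd : IsStateDomain D Ω)
    {α ρ : ℝ} (hα : 0 < α) (hρ : 0 < ρ) {f g : Plane → ℝ}
    {u : Plane → ℂ} (hu : IsState D α ρ f g Ω u) (h : SolvesOverdetermined D α f g Ω u) :
    ∀ᵐ x ∂(volume.restrict Ω), (u x).im = 0 := by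
  obtain ⟨G, η, hG, hηf, hs⟩ := h
  have hc : IsState D α ρ f g Ω fun x => conj (u x) := by
    refine ⟨_, _, hG.conj, fun v H ζ hv => ?_⟩
    have e := congrArg conj (hs _ _ _ hv.conj)
    simp only [map_add, map_mul, conj_dirichletForm, conj_boundaryForm, Complex.conj_ofReal] at e
    have hηc : ∀ᵐ x ∂(arcLength (frontier D)), conj (η x) = (f x : ℂ) :=
      hηf.mono fun x hx => by rw [hx, Complex.conj_ofReal]
    rw [boundaryForm_congr_left hηc]
    linear_combination e
  exact (hu.unique hd hα hρ hc).mono fun x hx => Complex.conj_eq_iff_im.1 hx.symm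

theorem SolvesOverdetermined.hasCauchyData {D Ω : Set Plane} {α : ℝ} {f g : Plane → ℝ}
    {u : Plane → ℂ} (h : SolvesOverdetermined D α f g Ω u) : HasCauchyData D f g Ω u := by
  obtain ⟨G, η, hG, hηf, hs⟩ := h
  refine ⟨G, η, hG, hηf, fun v H ζ hv hζ => ?_⟩
  have e := hs v H ζ hv
  rwa [boundaryForm_eq_zero hζ, mul_zero, add_zero] at e

/-- The trace supplied with the Cauchy data is discarded: only the flux identity is used. Compared
with the state equation for tests vanishing on the inner boundary, it yields `u = f` for the trace
of the state itself. -/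
theorem HasCauchyData.solvesOverdetermined {D ω : Set Plane} (hD : IsOpen D)
    (hωD : closure ω ⊆ D) (hd : IsStateDomain D (D \ closure ω))
    {α ρ : ℝ} (hρ : 0 < ρ) {f g : Plane → ℝ} (hf : MemLp f 2 (arcLength (frontier D)))
    {u : Plane → ℂ} (hu : IsState D α ρ f g (D \ closure ω) u)
    (h : HasCauchyData D f g (D \ closure ω) u) :
    SolvesOverdetermined D α f g (D \ closure ω) u := by
  obtain ⟨G, η, hG, hs⟩ := hu
  obtain ⟨G', η', hG', -, hc⟩ := h
  have hGG := hG.isH1.grad_ae_eq hd.isOpen hG'.isH1 (EventuallyEq.refl _ _)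
  have hηD : MemLp η 2 (arcLength (frontier D)) := hG.memLp_trace.mono_measure (arcLength_mono hd.subset)
  have hηf : ∀ᵐ x ∂(arcLength (frontier D)), η x = f x := by
    refine ae_eq_of_boundaryForm_eq hD hωD hd hηD hf.ofReal fun v H ζ hv hζ => ?_
    have e1 := hs v H ζ hv
    rw [boundaryForm_eq_zero hζ, dirichletForm_congr_left hGG, hc v H ζ hv hζ] at e1
    have e3 : (Complex.I * ρ) * boundaryForm (frontier D) η ζ =
        (Complex.I * ρ) * boundaryForm (frontier D) (fun x => (f x : ℂ)) ζ := by
      linear_combination e1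
    refine mul_left_cancel₀ ?_ e3
    simp [hρ.ne']
  refine ⟨G, η, hG, hηf, fun v H ζ hv => ?_⟩
  have e1 := hs v H ζ hv
  rw [boundaryForm_congr_left hηf] at e1
  linear_combination e1

/-! ### The cost and its Eulerian semiderivative -/

/-- Uniqueness of the state makes the choice in `cost` irrelevant. -/
theorem cost_eq {D Ω : Set Plane} (hd : IsStateDomain D Ω) {α ρ : ℝ} (hα : 0 < α) (hρ : 0 < ρ)
    {f g : Plane → ℝ} {u : Plane → ℂ} (hu : IsState D α ρ f g Ω u) :
    cost D α ρ f g Ω = (1 / 2) * ∫ x in Ω, (u x).im ^ 2 := by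
  have hex : ∃ u, IsState D α ρ f g Ω u := ⟨u, hu⟩
  rw [cost, dif_pos hex]
  congr 1
  exact integral_congr_ae ((hex.choose_spec.unique hd hα hρ hu).mono fun x hx => by simp only [hx])

theorem IsDeformation.eq_zero_on_frontier {D Dd : Set Plane} {d₀ : ℝ} (hd₀ : 0 < d₀)
    (hDd : IsHoldAll D d₀ Dd) {θ : Plane → Plane} (hθ : IsDeformation Dd θ) :
    ∀ x ∈ frontier D, θ x = 0 := by
  intro x hx
  refine image_eq_zero_of_notMem_tsupport fun hs => ?_
  have hcl : closure Dd ⊆ {x | d₀ / 3 ≤ Metric.infDist x (frontier D)} :=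
    closure_minimal (fun y hy => (hDd.subset hy).2.le)
      (isClosed_le continuous_const (Metric.continuous_infDist_pt _))
  have h1 : d₀ / 3 ≤ Metric.infDist x (frontier D) := hcl (hθ.tsupport_subset hs)
  rw [Metric.infDist_zero_of_mem hx] at h1
  linarith

/-- `IsStateDomain` asks only for finite boundary length, which Lipschitz maps preserve, so no
smoothness of the perturbed boundary has to be shown. -/
theorem IsNearIdentity.isStateDomain {T S : Plane → Plane} {L ε : NNReal}
    (h : IsNearIdentity T S L ε) {D Ω : Set Plane} (hd : IsStateDomain D Ω)
    (hfix : ∀ x ∈ frontier D, T x = x) : IsStateDomain D (T '' Ω) := by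
  refine ⟨h.isOpen_image hd.isOpen, h.lipschitz.isBounded_image hd.isBounded, ?_, ?_⟩
  · rw [h.frontier_image]
    refine (h.lipschitz.hausdorffMeasure_image_le zero_le_one _).trans_lt ?_
    rw [ENNReal.rpow_one]
    exact ENNReal.mul_lt_top ENNReal.coe_lt_top hd.finite
  · rw [h.frontier_image]
    exact fun x hx => ⟨x, hd.subset hx, hfix x hx⟩

/-- The discrepancy constant for `L = 1 + 2x`, `ε = 2x` is linear in `x`: use `L ^ 2 - 1 ≤ 6x` and
`L ≤ 2`. -/
theorem deviation_le {x α : ℝ} (hx0 : 0 ≤ x) (hx : x ≤ 1 / 2) (hα : 0 ≤ α) :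
    2 * (3 * ((1 + 2 * x) ^ 2 - 1) * (1 + 2 * x) + 2 * (2 * x)) + α * (3 * ((1 + 2 * x) ^ 2 - 1)) ≤
      (80 + 18 * α) * x := by
  have q1 : (1 + 2 * x) ^ 2 - 1 ≤ 6 * x := by nlinarith
  have q0 : 0 ≤ (1 + 2 * x) ^ 2 - 1 := by nlinarith
  have q2 : ((1 + 2 * x) ^ 2 - 1) * (1 + 2 * x) ≤ (6 * x) * 2 :=
    mul_le_mul q1 (by linarith) (by linarith) (by linarith)
  have q3 : α * ((1 + 2 * x) ^ 2 - 1) ≤ α * (6 * x) := mul_le_mul_of_nonneg_left q1 hα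
  linarith

theorem exists_isNearIdentity_smul {θ : Plane → Plane} (hθ : ContDiff ℝ 1 θ) {K : NNReal}
    (hK : LipschitzWith K θ) {t : ℝ} (ht : 0 ≤ t) (htK : t * K ≤ 1 / 2) :
    ∃ (S : Plane → Plane) (L ε : NNReal), (L : ℝ) = 1 + 2 * (t * K) ∧ (ε : ℝ) = 2 * (t * K) ∧
      IsNearIdentity (fun x => x + t • θ x) S L ε := by
  obtain ⟨τ, hτ⟩ : ∃ τ : NNReal, (τ : ℝ) = t * K := ⟨⟨t * K, mul_nonneg ht K.2⟩, rfl⟩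
  have hτ2 : τ ≤ 1 / 2 := by
    rw [← NNReal.coe_le_coe, hτ]
    exact_mod_cast htK
  have hL : LipschitzWith τ fun x => t • θ x := by
    refine LipschitzWith.of_dist_le_mul fun x y => ?_
    rw [hτ, dist_smul₀, Real.norm_of_nonneg ht, mul_assoc]
    exact mul_le_mul_of_nonneg_left (hK.dist_le_mul x y) ht
  obtain ⟨S, hS⟩ := exists_isNearIdentity
    (hθ.const_smul t : ContDiff ℝ 1 fun x => t • θ x) hτ2 hL
  exact ⟨S, _, _, by push_cast; rw [hτ], by push_cast; rw [hτ], hS⟩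

/-- The transport of a real function is real almost everywhere because comparable measures have
corresponding null sets; subtracting it leaves the imaginary part unchanged. -/
theorem integral_im_sq_le {T S : Plane → Plane} {L ε : NNReal} (h : IsNearIdentity T S L ε)
    {Ω : Set Plane} {u u' : Plane → ℂ} (hu : MemLp u 2 (volume.restrict Ω))
    (hu' : MemLp u' 2 (volume.restrict (T '' Ω)))
    (h0 : ∀ᵐ x ∂(volume.restrict Ω), (u x).im = 0) :
    ∫ y in T '' Ω, (u' y).im ^ 2 ≤ ∫ y in T '' Ω, ‖u' y - u (S y)‖ ^ 2 := by
  have hpush : MemLp (fun y => u (S y)) 2 (volume.restrict (T '' Ω)) := by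
    have hc := h.symm.comparable_volume (T '' Ω)
    rw [h.image_image] at hc
    exact hc.memLp hu
  have hreal : ∀ᵐ y ∂(volume.restrict (T '' Ω)), (u (S y)).im = 0 := by
    refine (h.comparable_volume Ω).ae_of_comp ?_
    have hqm : ∀ᵐ x ∂(volume.restrict Ω), (u (S (T x))).im = 0 :=
      h0.mono fun x hx => by rwa [h.left_inv x]
    rw [ae_iff] at hqm ⊢
    have he : MeasurableEmbedding T := h.toHomeomorph.measurableEmbedding
    rw [he.map_apply]
    exact hqm
  refine integral_mono_of_nonneg (Eventually.of_forall fun y => sq_nonneg _)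
    (integrable_norm_sq (hu'.sub hpush)) ?_
  filter_upwards [hreal] with y hy
  have e : (u' y).im = (u' y - u (S y)).im := by rw [Complex.sub_im, hy, sub_zero]
  rw [e, ← sq_abs]
  gcongr
  exact Complex.abs_im_le_norm _

/-- The cost is quadratically small on small perturbations of a domain on which the state is
real. -/
theorem exists_cost_perturb_le {D Ω : Set Plane} (hd : IsStateDomain D Ω) {α ρ : ℝ} (hα : 0 < α)
    (hρ : 0 < ρ) {f g : Plane → ℝ} (hf : MemLp f 2 (arcLength (frontier D)))
    (hg : MemLp g 2 (arcLength (frontier D))) {u : Plane → ℂ} (hu : IsState D α ρ f g Ω u)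
    (h0 : ∀ᵐ x ∂(volume.restrict Ω), (u x).im = 0) {θ : Plane → Plane} (hθ : ContDiff ℝ 1 θ)
    (hθc : HasCompactSupport θ) (hfix : ∀ x ∈ frontier D, θ x = 0) :
    ∃ t₀ > 0, ∃ C : ℝ, ∀ t ∈ Ico (0 : ℝ) t₀, HasUniqueState D α ρ f g (perturb θ t Ω) ∧
      0 ≤ cost D α ρ f g (perturb θ t Ω) ∧ cost D α ρ f g (perturb θ t Ω) ≤ C * t ^ 2 := by
  obtain ⟨K, hK⟩ := hθ.lipschitzWith_of_hasCompactSupport hθc one_ne_zero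
  obtain ⟨B, hB⟩ := hθc.exists_bound_of_continuous hθ.continuous
  obtain ⟨R, hR0, hR⟩ := hd.exists_radius
  obtain ⟨G, η, hG, hs⟩ := hu
  have hB0 : 0 ≤ B := (norm_nonneg _).trans (hB 0)
  obtain ⟨κ, hκ⟩ : ∃ κ, κ = min 1 (min α ρ) / 2 := ⟨_, rfl⟩
  have hκ0 : 0 < κ := by rw [hκ]; positivity
  have hK0 : (0 : ℝ) ≤ K := K.2
  obtain ⟨m, hm⟩ : ∃ m : ℝ, m = (K + 1) * (80 + 18 * α) := ⟨_, rfl⟩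
  have hm0 : 0 < m := by rw [hm]; positivity
  -- This bound on `t` gives both `t * K ≤ 1 / 2` and `t ≤ 1`; adding `1` covers `K = 0`. All
  -- perturbed domains then lie in the ball of radius `R + B`, and `16` is `4 * L ^ 2` with `L ≤ 2`.
  refine ⟨1 / (2 * (K + 1)), by positivity,
    (4 * (R + B) + 8 * (R + B) ^ 2) * (16 * m ^ 2 / κ ^ 2 * energy Ω G η), fun t ht => ?_⟩
  have ht0 : 0 ≤ t := ht.1
  have htK1 : t * (K + 1) ≤ 1 / 2 := by
    calc t * (K + 1) ≤ 1 / (2 * (K + 1)) * (K + 1) :=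
          mul_le_mul_of_nonneg_right ht.2.le (by positivity)
      _ = 1 / 2 := by field_simp
  have htK0 : 0 ≤ t * K := mul_nonneg ht0 hK0
  have htK : t * K ≤ 1 / 2 := by linarith
  have ht1 : t ≤ 1 := by linarith
  obtain ⟨S, L, ε, hL, hε, hTS⟩ := exists_isNearIdentity_smul hθ hK ht0 htK
  have hfixT : ∀ x ∈ frontier D, x + t • θ x = x := fun x hx => by simp [hfix x hx]
  have hd' : IsStateDomain D (perturb θ t Ω) := hTS.isStateDomain hd hfixT
  obtain ⟨u', hu'⟩ := exists_isState hd' hα hρ hf hg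
  have hcost := cost_eq hd' hα hρ hu'
  refine ⟨⟨⟨u', hu'⟩, fun v w hv hw => hv.unique hd' hα hρ hw⟩, ?_, ?_⟩
  · rw [hcost]; positivity
  -- The case `t = 0` is separate because the discrepancy bound `m * t` must be positive.
  rcases eq_or_lt_of_le ht0 with rfl | htpos
  · have hp : perturb θ 0 Ω = Ω := by simp [perturb]
    rw [hp, cost_eq hd hα hρ ⟨G, η, hG, hs⟩,
      integral_congr_ae (g := fun _ => 0) (h0.mono fun x hx => by simp [hx])]
    simp
  have hR'' : ∀ x ∈ perturb θ t Ω, ‖x‖ ≤ R + B := by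
    rintro _ ⟨x, hx, rfl⟩
    refine (norm_add_le _ _).trans (add_le_add (hR x hx) ?_)
    rw [norm_smul, Real.norm_of_nonneg ht0]
    exact (mul_le_mul ht1 (hB x) (norm_nonneg _) zero_le_one).trans (one_mul B).le
  have hdev : 2 * (3 * ((L : ℝ) ^ 2 - 1) * L + 2 * ε) + α * (3 * ((L : ℝ) ^ 2 - 1)) ≤ m * t := by
    rw [hL, hε]
    refine (deviation_le htK0 htK hα.le).trans ?_
    have : 0 ≤ (80 + 18 * α) * t := by positivity
    rw [hm]
    linarith
  have hle : ∫ y in perturb θ t Ω, ‖u' y - u (S y)‖ ^ 2 ≤ _ :=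
    integral_state_sub_le hTS hd hd' hfixT hα hρ hG hs hu' (add_nonneg hR0 hB0) hR''
      (mul_pos hm0 htpos) hκ hdev
  have hmono : ∫ y in perturb θ t Ω, (u' y).im ^ 2 ≤ ∫ y in perturb θ t Ω, ‖u' y - u (S y)‖ ^ 2 :=
    integral_im_sq_le hTS hG.isH1.memLp hu'.choose_spec.choose_spec.1.isH1.memLp h0
  have hE := energy_nonneg Ω G η
  have hL4 : (L : ℝ) ^ 2 ≤ 4 := by rw [hL]; nlinarith
  have hfinal : (4 * (R + B) + 8 * (R + B) ^ 2) * (4 * (L : ℝ) ^ 2 * (m * t) ^ 2 / κ ^ 2 *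
      energy Ω G η) ≤ (4 * (R + B) + 8 * (R + B) ^ 2) * (16 * m ^ 2 / κ ^ 2 * energy Ω G η) * t ^ 2 := by
    calc (4 * (R + B) + 8 * (R + B) ^ 2) * (4 * (L : ℝ) ^ 2 * (m * t) ^ 2 / κ ^ 2 * energy Ω G η)
        ≤ (4 * (R + B) + 8 * (R + B) ^ 2) * (4 * 4 * (m * t) ^ 2 / κ ^ 2 * energy Ω G η) := by
          gcongr
      _ = _ := by ring
  have hnn : 0 ≤ ∫ y in perturb θ t Ω, (u' y).im ^ 2 := integral_nonneg fun y => sq_nonneg _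
  rw [hcost]
  linarith [hmono.trans (hle.trans hfinal)]

/-- The bound at `t = 0` forces `F Ω = 0`, so the difference quotient lies between `0` and `C * t`.
-/
theorem hasEulerianSemiderivative_zero {F : Set Plane → ℝ} {Ω : Set Plane} {θ : Plane → Plane}
    {t₀ C : ℝ} (ht₀ : 0 < t₀) (hF : ∀ t ∈ Ico (0 : ℝ) t₀, 0 ≤ F (perturb θ t Ω) ∧
      F (perturb θ t Ω) ≤ C * t ^ 2) : HasEulerianSemiderivative F Ω θ 0 := by
  have hp : perturb θ 0 Ω = Ω := by simp [perturb]
  have hF0 : F Ω = 0 := by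
    have := hF 0 ⟨le_rfl, ht₀⟩
    rw [hp] at this
    linarith [this.1, this.2]
  have hlim : Tendsto (fun t : ℝ => C * t) (𝓝[>] 0) (𝓝 0) := by
    have : Tendsto (fun t : ℝ => C * t) (𝓝 0) (𝓝 (C * 0)) := (continuous_const_mul C).tendsto 0
    rw [mul_zero] at this
    exact this.mono_left nhdsWithin_le_nhds
  have hev : ∀ᶠ t : ℝ in 𝓝[>] 0, t ∈ Ioo 0 t₀ := Ioo_mem_nhdsGT ht₀
  refine tendsto_of_tendsto_of_tendsto_of_le_of_le' tendsto_const_nhds hlim ?_ ?_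
  · filter_upwards [hev] with t ht
    rw [hF0, sub_zero]
    exact div_nonneg (hF t ⟨ht.1.le, ht.2⟩).1 ht.1.le
  · filter_upwards [hev] with t ht
    rw [hF0, sub_zero, div_le_iff₀ ht.1]
    have := (hF t ⟨ht.1.le, ht.2⟩).2
    nlinarith

end CCBM

/-! ### Equivalence of the three conditions and stationarity -/

theorem corollary3p1
    (D : Set CCBM.Plane) (hDo : IsOpen D) (hDb : Bornology.IsBounded D)
    (hDr : CCBM.HasC11Boundary D)
    (d₀ : ℝ) (hd₀ : 0 < d₀)
    (Dd : Set CCBM.Plane) (hDd : CCBM.IsHoldAll D d₀ Dd)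
    (α ρ : ℝ) (hα : 0 < α) (hρ : 0 < ρ)
    (f g : CCBM.Plane → ℝ)
    (hf : MemLp f 2 (CCBM.arcLength (frontier D)))
    (hg : MemLp g 2 (CCBM.arcLength (frontier D)))
    (ω : Set CCBM.Plane) (hω : CCBM.IsAdmissibleCavity D d₀ ω)
    (Ω : Set CCBM.Plane) (hΩ : Ω = D \ closure ω)
    (u : CCBM.Plane → ℂ) (hu : CCBM.IsState D α ρ f g Ω u) :
    ((∀ᵐ x ∂(volume.restrict Ω), (u x).im = 0) ↔ CCBM.SolvesOverdetermined D α f g Ω u) ∧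
    ((∀ᵐ x ∂(volume.restrict Ω), (u x).im = 0) ↔ CCBM.HasCauchyData D f g Ω u) ∧
    ((∀ᵐ x ∂(volume.restrict Ω), (u x).im = 0) →
      ∀ θ : CCBM.Plane → CCBM.Plane, CCBM.IsDeformation Dd θ →
        (∃ t₀ > 0, ∀ t ∈ Set.Ico (0 : ℝ) t₀,
          CCBM.HasUniqueState D α ρ f g (CCBM.perturb θ t Ω)) ∧
        CCBM.HasEulerianSemiderivative (CCBM.cost D α ρ f g) Ω θ 0) := by
  subst hΩ
  have hd := CCBM.isStateDomain_sdiff_closure hDo hDb hDr hω.isOpen hω.closure_subset hω.c11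
  have h12 := CCBM.solvesOverdetermined_of_im_eq_zero hDo hDr hω.closure_subset hd hρ hf hu
  have h21 := CCBM.im_eq_zero_of_solvesOverdetermined hd hα hρ hu
  have h32 := CCBM.HasCauchyData.solvesOverdetermined hDo hω.closure_subset hd hρ hf hu
  refine ⟨⟨h12, h21⟩, ⟨fun h => (h12 h).hasCauchyData, fun h => h21 (h32 h)⟩, fun h0 θ hθ => ?_⟩
  obtain ⟨t₀, ht₀, C, hC⟩ := CCBM.exists_cost_perturb_le hd hα hρ hf hg hu h0 hθ.contDiff
    hθ.hasCompactSupport (hθ.eq_zero_on_frontier hd₀ hDd)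
  exact ⟨⟨t₀, ht₀, fun t ht => (hC t ht).1⟩,
    CCBM.hasEulerianSemiderivative_zero ht₀ fun t ht => (hC t ht).2⟩
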